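/- Let $(P,\omega)$ be a finite-dimensional symplectic manifold (Hausdorff, second countable), let $H\colon P\to\mathbb R$ be smooth, and let $g\colon P\to V$ be a smooth map into a finite-dimensional real vector space for which $0$ is a regular value. Put $M=g^{-1}(0)$, $\nu=\iota_M^*\omega$, and let $X_H$ be the Hamiltonian vector field, $\omega(X_H,\cdot)=\mathrm dH$. For an open set $O\subset P$ and $z\in M\cap O$ let $[z]_O$ denote the fibre of $z$ inside $O$, i.e. the leaf through $z$ of the foliation of $M\cap O$ tangent to $\ker\nu$ (the set of points that can be joined to $z$ by a $C^1$ curve in $M\cap O$ whose velocity lies in $\ker\nu$). Let $$M_H=\{z\in M:\ \exists\,Y\in T_zM,\ \mathrm dH(z)|_{T_zM}=\nu_z(Y,\cdot)\}$$ be the hidden constraint set. Assume 1. (Nondegeneracy) on every leaf of $\ker\nu$ in $M$, the critical points of the restriction of $H$ to the leaf are nondegenerate; 2. (Coisotropy) $(T_zM)^{\perp_\omega}\subset T_zM$ for all $z\in M$. Let $\Phi_h$ be a smooth method consistent with $\dot z=X_H(z)$: $(h,x)\mapsto\Phi_h(x)$ is a smooth map into $P$ on an open neighbourhood $D$ of $\{0\}\times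 P$ in $\mathbb R\times P$, with $\Phi_0=\mathrm{id}$ and $\frac{\partial}{\partial h}\Phi_h\big|_{h=0}=X_H$. Then there are arbitrarily small open neighbourhoods $O$ of $M_H$ in $P$ (that is, one inside every given open neighbourhood of $M_H$) with the following property. Every $z_0\in M\cap O$ has an open neighbourhood $U\subset O$ and a number $h_0>0$ such that, for all $h$ with $0<|h|<h_0$ and all $z\in M\cap U$: * $\Phi_h$ is defined on $[z]_O$, and the equation $g(\Phi_h(z^+))=0$, $z^+\in[z]_O$, has exactly one solution $z^+$; * the Shake map is well defined at $z$: there is exactly one point $S_h(z)$ of the form $S_h(z)=\Phi_h(y)\in M$ with $y\in[z]_O$, and it lies in $M\cap O$; * the Rattle map is well defined at $z$: there is exactly one point $R_h(z)\in[S_h(z)]_O\cap M_H$. -/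

import Mathlib

open Set Filter Topology
open scoped Manifold ContDiff

noncomputable section

namespace ConstrainedHamiltonian

/-- The 2-form `Ω` on the manifold `P`, read in the preferred chart at `x₀` as a form on the model
space `E` (the pull-back of `Ω` along the inverse of the chart). -/
def chartForm {E P : Type*} [NormedAddCommGroup E] [NormedSpace ℝ E] [TopologicalSpace P]
    [ChartedSpace E P] (Ω : ∀ x : P, (TangentSpace 𝓘(ℝ, E) x) [⋀^Fin 2]→L[ℝ] ℝ) (x₀ : P) (y : E) :
    E [⋀^Fin 2]→L[ℝ] ℝ :=
  (Ω ((extChartAt 𝓘(ℝ, E) x₀).symm y)).compContinuousLinearMap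
    (mfderiv 𝓘(ℝ, E) 𝓘(ℝ, E) (extChartAt 𝓘(ℝ, E) x₀).symm y)

/-- A symplectic form: a smooth, closed, nondegenerate 2-form. Smoothness and closedness are
expressed in the charts of the manifold. -/
structure SymplecticForm (E P : Type*) [NormedAddCommGroup E] [NormedSpace ℝ E]
    [TopologicalSpace P] [ChartedSpace E P] where
  form : ∀ x : P, (TangentSpace 𝓘(ℝ, E) x) [⋀^Fin 2]→L[ℝ] ℝ
  nondegenerate : ∀ (x : P) (u : TangentSpace 𝓘(ℝ, E) x),
    (∀ v : TangentSpace 𝓘(ℝ, E) x, form x ![u, v] = 0) → u = 0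
  smooth : ∀ x₀ : P, ContDiffOn ℝ ∞ (chartForm form x₀) (extChartAt 𝓘(ℝ, E) x₀).target
  closed : ∀ x₀ : P, ∀ y ∈ (extChartAt 𝓘(ℝ, E) x₀).target, extDeriv (chartForm form x₀) y = 0

section Basic

variable {E V P : Type*} [NormedAddCommGroup E] [NormedSpace ℝ E]
  [NormedAddCommGroup V] [NormedSpace ℝ V] [TopologicalSpace P] [ChartedSpace E P]

theorem update_zero {α : Type*} (a b c : α) : Function.update ![a, b] 0 c = ![c, b] := by
  funext i; fin_cases i <;> rfl

theorem update_one {α : Type*} (a b c : α) : Function.update ![a, b] 1 c = ![a, c] := by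
  funext i; fin_cases i <;> rfl

/-- `Ω_x(u, v)` as a bilinear form on `T_x P`. -/
def SymplecticForm.bilin (Ω : SymplecticForm E P) (x : P) :
    LinearMap.BilinForm ℝ (TangentSpace 𝓘(ℝ, E) x) :=
  LinearMap.mk₂ ℝ (fun u v => Ω.form x ![u, v])
    (fun u u' v => by simpa only [update_zero] using (Ω.form x).map_update_add ![u, v] 0 u u')
    (fun c u v => by simpa only [update_zero] using (Ω.form x).map_update_smul ![u, v] 0 c u)
    (fun u v v' => by simpa only [update_one] using (Ω.form x).map_update_add ![u, v] 1 v v')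
    (fun c u v => by simpa only [update_one] using (Ω.form x).map_update_smul ![u, v] 1 c v)

theorem SymplecticForm.bilin_apply (Ω : SymplecticForm E P) (x : P)
    (u v : TangentSpace 𝓘(ℝ, E) x) : Ω.bilin x u v = Ω.form x ![u, v] := rfl

/-- The map `T_x P → T_x^* P`, `u ↦ Ω_x(u, ·)`, is an isomorphism. -/
theorem SymplecticForm.bilin_bijective [FiniteDimensional ℝ E] (Ω : SymplecticForm E P) (x : P) :
    Function.Bijective (Ω.bilin x) := by
  have : FiniteDimensional ℝ (TangentSpace 𝓘(ℝ, E) x) := inferInstanceAs (FiniteDimensional ℝ E)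
  have hinj : Function.Injective (Ω.bilin x) := by
    rw [← LinearMap.ker_eq_bot, LinearMap.ker_eq_bot']
    intro u hu
    exact Ω.nondegenerate x u fun v => by
      rw [← Ω.bilin_apply, hu, LinearMap.zero_apply]
  exact ⟨hinj, (LinearMap.injective_iff_surjective_of_finrank_eq_finrank
    Subspace.dual_finrank_eq.symm).1 hinj⟩

/-- The Hamiltonian vector field `X_H`, defined by `Ω(X_H, ·) = dH`. -/
def hamiltonianVectorField [FiniteDimensional ℝ E] (Ω : SymplecticForm E P) (H : P → ℝ) (x : P) :
    TangentSpace 𝓘(ℝ, E) x :=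
  (LinearEquiv.ofBijective (Ω.bilin x) (Ω.bilin_bijective x)).symm
    (mfderiv 𝓘(ℝ, E) 𝓘(ℝ, ℝ) H x).toLinearMap

/-- The defining property `Ω(X_H, v) = dH(v)`. -/
theorem form_hamiltonianVectorField [FiniteDimensional ℝ E] (Ω : SymplecticForm E P) (H : P → ℝ)
    (x : P) (v : TangentSpace 𝓘(ℝ, E) x) :
    Ω.form x ![hamiltonianVectorField Ω H x, v] = mfderiv 𝓘(ℝ, E) 𝓘(ℝ, ℝ) H x v := by
  have h := LinearEquiv.apply_symm_apply
    (LinearEquiv.ofBijective (Ω.bilin x) (Ω.bilin_bijective x))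
    (mfderiv 𝓘(ℝ, E) 𝓘(ℝ, ℝ) H x).toLinearMap
  exact DFunLike.congr_fun h v

/-- The constraint manifold `M = g⁻¹(0)`. -/
def constraintSet (g : P → V) : Set P := {z | g z = 0}

/-- `0` is a regular value of `g`. -/
def IsRegularConstraint (E : Type*) [NormedAddCommGroup E] [NormedSpace ℝ E] [ChartedSpace E P]
    (g : P → V) : Prop :=
  ∀ z ∈ constraintSet g, Function.Surjective (mfderiv 𝓘(ℝ, E) 𝓘(ℝ, V) g z)

/-- The tangent space `T_z M = ker dg(z)` of the constraint manifold, as a subspace of `T_z P`. -/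
def tangentM (E : Type*) [NormedAddCommGroup E] [NormedSpace ℝ E] [ChartedSpace E P]
    (g : P → V) (z : P) : Submodule ℝ (TangentSpace 𝓘(ℝ, E) z) :=
  LinearMap.ker (mfderiv 𝓘(ℝ, E) 𝓘(ℝ, V) g z).toLinearMap

/-- The kernel at `z` of the presymplectic form `ν`, the restriction of `Ω` to `M`. -/
def kerForm (Ω : SymplecticForm E P) (g : P → V) (z : P) : Set (TangentSpace 𝓘(ℝ, E) z) :=
  {u | u ∈ tangentM E g z ∧ ∀ v ∈ tangentM E g z, Ω.form z ![u, v] = 0}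

/-- `M` is coisotropic: the `Ω`-orthogonal of `T_z M` is contained in `T_z M` for all `z ∈ M`. -/
def IsCoisotropic (Ω : SymplecticForm E P) (g : P → V) : Prop :=
  ∀ z ∈ constraintSet g, ∀ u : TangentSpace 𝓘(ℝ, E) z,
    (∀ v ∈ tangentM E g z, Ω.form z ![u, v] = 0) → u ∈ tangentM E g z

/-- The hidden constraint set `M_H`: the points `z ∈ M` at which `dH` restricted to `T_z M` is of
the form `ν(Y, ·)` for some `Y ∈ T_z M`. -/
def hiddenSet (Ω : SymplecticForm E P) (g : P → V) (H : P → ℝ) : Set P :=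
  {z | z ∈ constraintSet g ∧ ∃ Y ∈ tangentM E g z, ∀ v ∈ tangentM E g z,
    mfderiv 𝓘(ℝ, E) 𝓘(ℝ, ℝ) H z v = Ω.form z ![Y, v]}

/-- `φ` is a smooth local parametrisation, on the open set `S ⊆ ℝᵏ`, of a fibre, that is, of an
integral manifold of the distribution `ker ν` on `M`. -/
structure IsFibreParametrization (Ω : SymplecticForm E P) (g : P → V) {k : ℕ}
    (φ : EuclideanSpace ℝ (Fin k) → P) (S : Set (EuclideanSpace ℝ (Fin k))) : Prop where
  isOpen : IsOpen S
  smooth : ContMDiffOn 𝓘(ℝ, EuclideanSpace ℝ (Fin k)) 𝓘(ℝ, E) ∞ φ S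
  mem : ∀ s ∈ S, φ s ∈ constraintSet g
  injective : ∀ s ∈ S,
    Function.Injective (mfderiv 𝓘(ℝ, EuclideanSpace ℝ (Fin k)) 𝓘(ℝ, E) φ s)
  range_eq : ∀ s ∈ S,
    range (mfderiv 𝓘(ℝ, EuclideanSpace ℝ (Fin k)) 𝓘(ℝ, E) φ s) = kerForm Ω g (φ s)

/-- Nondegeneracy: on every fibre, the critical points of the restriction of `H` to the fibre are
nondegenerate, i.e. in local coordinates of the fibre the second derivative of `H` at a critical
point is a nondegenerate bilinear form. -/
def IsNondegenerate (Ω : SymplecticForm E P) (g : P → V) (H : P → ℝ) : Prop :=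
  ∀ (k : ℕ) (φ : EuclideanSpace ℝ (Fin k) → P) (S : Set (EuclideanSpace ℝ (Fin k))),
    IsFibreParametrization Ω g φ S → ∀ s ∈ S, fderiv ℝ (H ∘ φ) s = 0 →
      ∀ u : EuclideanSpace ℝ (Fin k), u ≠ 0 →
        ∃ v : EuclideanSpace ℝ (Fin k), fderiv ℝ (fderiv ℝ (H ∘ φ)) s u v ≠ 0

/-- The fibre of `z` inside `O`: the points that can be joined to `z` by a curve in `M ∩ O` whose
velocity lies in `ker ν`. For `O = univ` this is the whole fibre (the leaf of `ker ν` in `M`)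
through `z`; in general it is the leaf through `z` of the foliation of `M ∩ O`. -/
def fibreIn (Ω : SymplecticForm E P) (g : P → V) (O : Set P) (z : P) : Set P :=
  {y | ∃ γ : ℝ → P, ContMDiff 𝓘(ℝ, ℝ) 𝓘(ℝ, E) 1 γ ∧ γ 0 = z ∧ γ 1 = y ∧
    ∀ t ∈ Icc (0 : ℝ) 1, γ t ∈ constraintSet g ∧ γ t ∈ O ∧
      mfderiv 𝓘(ℝ, ℝ) 𝓘(ℝ, E) γ t (1 : ℝ) ∈ kerForm Ω g (γ t)}

/-- `Φ` is a smooth method, `Φ h` being defined on `{x | (h, x) ∈ D}`, that is consistent with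
`ż = X_H(z)`: `Φ 0` is the identity, and the derivative of `h ↦ Φ h x` at `h = 0` is `X_H(x)`
(with `x` written as `Φ 0 x`). -/
structure IsConsistentMethod [FiniteDimensional ℝ E] (Ω : SymplecticForm E P) (H : P → ℝ)
    (Φ : ℝ → P → P) (D : Set (ℝ × P)) : Prop where
  isOpen : IsOpen D
  mem : ∀ x : P, ((0 : ℝ), x) ∈ D
  smooth : ContMDiffOn (𝓘(ℝ, ℝ).prod 𝓘(ℝ, E)) 𝓘(ℝ, E) ∞ (fun q : ℝ × P => Φ q.1 q.2) D
  zero : ∀ x : P, Φ 0 x = x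
  consistent : ∀ x : P, mfderiv 𝓘(ℝ, ℝ) 𝓘(ℝ, E) (fun h : ℝ => Φ h x) 0 (1 : ℝ) =
    hamiltonianVectorField Ω H (Φ 0 x)

/-- The relation `w = S_h(z)` defining the Shake map on `O`: `w = Φ_h(y)` lies on `M`, for some `y`
in the fibre of `z` inside `O`. -/
def IsShakeStep (Ω : SymplecticForm E P) (g : P → V) (Φ : ℝ → P → P) (O : Set P) (h : ℝ)
    (z w : P) : Prop :=
  ∃ y ∈ fibreIn Ω g O z, Φ h y ∈ constraintSet g ∧ w = Φ h y

/-- The relation `z₁ = R_h(z)` defining the Rattle map: `z₁` is a point of `M_H` in the fibre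
inside `O` of `w = S_h(z)`. -/
def IsRattleStep (Ω : SymplecticForm E P) (g : P → V) (H : P → ℝ) (Φ : ℝ → P → P) (O : Set P)
    (h : ℝ) (z z₁ : P) : Prop :=
  ∃ w, IsShakeStep Ω g Φ O h z w ∧ z₁ ∈ fibreIn Ω g O w ∧ z₁ ∈ hiddenSet Ω g H

end Basic

end ConstrainedHamiltonian

end

open ConstrainedHamiltonian

/-! Coisotropy makes (TM)^⊥ equal to ker ν, so ker ν has constant rank dim V. Since ν is closed, ker
ν is integrable, and its leaves have dimension dim V. Coisotropy also turns the condition defining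
M_H into dg(X_H) = 0 (`mem_hiddenSet_iff`). For v tangent to a leaf, dH(v) = ω(X_H, v) depends only
on the component of X_H transverse to M, that is, on dg(X_H). So M_H consists of the critical points
of H along the leaves. Nondegeneracy of the Hessian there says that dg(X_H), restricted to the leaf,
has a bijective differential. Hence near each point of M_H there are coordinates (a, b, c) with a
constant on the leaves, b = dg(X_H) and c = g (`exists_isFlowBox`). In them M is c = 0, the leaves
are a = const, c = 0, and M_H is b = c = 0.

In such a box consistency gives g(Φ_h(a, b, 0)) = h b + O(h²). After division by h ≠ 0 the Shake
equation is a small perturbation of b = 0. A contraction argument yields exactly one root near b = 0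
(`exists_existsUnique_zero`). Away from b = 0 the first order term excludes roots
(`eventually_ne_zero`), uniformly on compact sets. Together these give
`eventually_existsUnique_localFibre`.

The remaining difficulty is global: O must be such that its fibres are short pieces of leaves, each
inside one box. `exists_isOpen_fine` supplies a neighbourhood W of the diagonal over M_H that is
fine with respect to the boxes. The set M ∩ O is the union, over m in M_H, of the leaves through m
inside the W-section of m; outside M, O is an arbitrary given neighbourhood. These pieces are
disjoint, each meets M_H only in its base point, and they are exactly the fibres of O
(`fibreIn_fibredNhd`). The unique root on a piece gives S_h, and the base point of the piece
containing S_h(z) gives R_h(z).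

Integrability is proved in `exists_straightening` with the time-one map of the fields spanning ker
ν. Its smoothness comes from the inverse function theorem in a Banach space of curves
(`exists_contDiffOn_flow`). -/

noncomputable section

namespace ConstrainedHamiltonian

/-! ### Smoothness of composition operators on spaces of continuous functions. -/

section Superposition

universe u

variable {X : Type*} [TopologicalSpace X]

/-- The superposition operator `Y ↦ f ∘ Y` on continuous functions. -/
def superpose {W W' : Type*} [TopologicalSpace W] [TopologicalSpace W'] (f : W → W')
    (hf : Continuous f) (Y : C(X, W)) : C(X, W') := (⟨f, hf⟩ : C(W, W')).comp Y

@[simp] theorem superpose_apply {W W' : Type*} [TopologicalSpace W] [TopologicalSpace W']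
    (f : W → W') (hf : Continuous f) (Y : C(X, W)) (x : X) : superpose f hf Y x = f (Y x) := rfl

variable [CompactSpace X] {W W' : Type*} [NormedAddCommGroup W] [NormedSpace ℝ W]
  [NormedAddCommGroup W'] [NormedSpace ℝ W']

/-- Pointwise application of a continuous family of operators to a continuous function. -/
def pointwiseApply : C(X, W →L[ℝ] W') →L[ℝ] C(X, W) →L[ℝ] C(X, W') :=
  LinearMap.mkContinuous₂
    (LinearMap.mk₂ ℝ
      (fun (A : C(X, W →L[ℝ] W')) (Y : C(X, W)) => (⟨fun x => A x (Y x), by fun_prop⟩ : C(X, W')))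
      (fun A A' Y => by ext x; simp) (fun c A Y => by ext x; simp)
      (fun A Y Y' => by ext x; simp) (fun c A Y => by ext x; simp)) 1
    (fun A Y => by
      refine (ContinuousMap.norm_le _ (by positivity)).2 fun x => ?_
      rw [one_mul]
      exact ((A x).le_opNorm (Y x)).trans
        (mul_le_mul (A.norm_coe_le_norm x) (Y.norm_coe_le_norm x) (by positivity) (by positivity)))

@[simp] theorem pointwiseApply_apply (A : C(X, W →L[ℝ] W')) (Y : C(X, W)) (x : X) :
    pointwiseApply A Y x = A x (Y x) := rfl

/-- First order Taylor expansion of a `C¹` function, uniformly on a compact set. -/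
theorem exists_forall_norm_sub_sub_fderiv_le {f : W → W'} (hf : ContDiff ℝ 1 f) {S : Set W}
    (hS : IsCompact S) {ε : ℝ} (hε : 0 < ε) :
    ∃ r > 0, ∀ x ∈ S, ∀ y, ‖y - x‖ < r → ‖f y - f x - fderiv ℝ f x (y - x)‖ ≤ ε * ‖y - x‖ := by
  have hcont : Continuous (fderiv ℝ f) := hf.continuous_fderiv (by simp)
  have h := hS.uniformContinuousAt_of_continuousAt (fderiv ℝ f)
    (fun a _ => hcont.continuousAt) (Metric.dist_mem_uniformity hε)
  obtain ⟨r, hr, h⟩ := Metric.mem_uniformity_dist.1 h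
  refine ⟨r, hr, fun x hx y hy => ?_⟩
  refine (convex_ball x r).norm_image_sub_le_of_norm_fderiv_le' (𝕜 := ℝ)
    (fun z _ => (hf.differentiable (by simp)).differentiableAt) (fun z hz => ?_)
    (Metric.mem_ball_self hr) (by rwa [Metric.mem_ball, dist_eq_norm])
  have hz' : dist x z < r := by rw [dist_comm]; exact hz
  have := h hz' hx
  rw [← dist_eq_norm, dist_comm]
  exact this.le

/-- The range of `Y` is compact, so the Taylor remainder of `f` is small uniformly along it, which
is smallness in the sup norm. -/
theorem hasFDerivAt_superpose {f : W → W'} (hf : ContDiff ℝ 1 f) (Y : C(X, W)) :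
    HasFDerivAt (superpose f hf.continuous)
      (pointwiseApply (superpose (fderiv ℝ f) (hf.continuous_fderiv (by simp)) Y)) Y := by
  rw [hasFDerivAt_iff_isLittleO, Asymptotics.isLittleO_iff]
  intro ε hε
  obtain ⟨r, hr, h⟩ := exists_forall_norm_sub_sub_fderiv_le hf (isCompact_range Y.continuous) hε
  filter_upwards [Metric.ball_mem_nhds Y hr] with Z hZ
  refine (ContinuousMap.norm_le _ (by positivity)).2 fun x => ?_
  have hle : ‖Z x - Y x‖ ≤ ‖Z - Y‖ := (Z - Y).norm_coe_le_norm x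
  have hlt : ‖Z x - Y x‖ < r := hle.trans_lt (by rwa [Metric.mem_ball, dist_eq_norm] at hZ)
  exact (h _ (mem_range_self x) _ hlt).trans (by gcongr)

/-- The derivative of a superposition operator is, up to a continuous linear map, the superposition
operator of `fderiv ℝ f`; this drives the induction. The target changes to W →L W' at each step,
which is why both spaces live in one universe. -/
theorem contDiff_superpose_nat (n : ℕ) {W W' : Type u} [NormedAddCommGroup W] [NormedSpace ℝ W]
    [NormedAddCommGroup W'] [NormedSpace ℝ W'] {f : W → W'} (hf : ContDiff ℝ ∞ f) :
    ContDiff ℝ n (superpose (X := X) f hf.continuous) := by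
  induction n generalizing W' with
  | zero =>
    rw [Nat.cast_zero, contDiff_zero]
    exact continuous_iff_continuousAt.2 fun Y =>
      (hasFDerivAt_superpose (hf.of_le (by simp)) Y).continuousAt
  | succ n ih =>
    rw [Nat.cast_succ, contDiff_succ_iff_hasFDerivAt]
    exact ⟨_, (ContinuousLinearMap.contDiff _).comp (ih (hf.fderiv_right (m := ∞) (by simp))),
      fun Y => hasFDerivAt_superpose (hf.of_le (by simp)) Y⟩

theorem contDiff_superpose {W W' : Type u} [NormedAddCommGroup W] [NormedSpace ℝ W]
    [NormedAddCommGroup W'] [NormedSpace ℝ W'] {f : W → W'} (hf : ContDiff ℝ ∞ f) :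
    ContDiff ℝ ∞ (superpose (X := X) f hf.continuous) :=
  contDiff_infty.2 fun n => contDiff_superpose_nat n hf

end Superposition

/-! ### A smooth local inverse on a whole neighbourhood. -/

section LocalDiffeo

variable {E F : Type*} [NormedAddCommGroup E] [NormedSpace ℝ E] [CompleteSpace E]
  [NormedAddCommGroup F] [NormedSpace ℝ F]

/-- The inverse function theorem, with smoothness on the whole source and target. -/
theorem exists_openPartialHomeomorph_contDiffOn {f : E → F} {a : E} {U : Set E} (hU : U ∈ 𝓝 a)
    (hf : ContDiffOn ℝ ∞ f U) {f' : E ≃L[ℝ] F} (hf' : HasFDerivAt f (f' : E →L[ℝ] F) a) :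
    ∃ e : OpenPartialHomeomorph E F, (∀ x, e x = f x) ∧ a ∈ e.source ∧ e.source ⊆ U ∧
      ContDiffOn ℝ ∞ e e.source ∧ ContDiffOn ℝ ∞ e.symm e.target ∧
      ∀ x ∈ e.source, (fderiv ℝ f x).IsInvertible := by
  have hfa : ContDiffAt ℝ ∞ f a := hf.contDiffAt hU
  set e₀ := hfa.toOpenPartialHomeomorph f hf' (by simp) with he₀
  have ha₀ : a ∈ e₀.source := hfa.mem_toOpenPartialHomeomorph_source hf' (by simp)
  have hcont : ContinuousAt (fderiv ℝ f) a :=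
    (hfa.fderiv_right (m := ∞) (by simp)).continuousAt
  have hinv : ∀ᶠ x in 𝓝 a, fderiv ℝ f x ∈ range ((↑) : (E ≃L[ℝ] F) → E →L[ℝ] F) :=
    hcont.eventually_mem (hf'.fderiv ▸ ContinuousLinearEquiv.nhds f')
  -- On this open set the derivative is invertible at every point, so the inverse is smooth at every
  -- point of the target and not only at `f a`.
  obtain ⟨O, hOsub, hO, haO⟩ := mem_nhds_iff.1 (Filter.inter_mem hU hinv)
  refine ⟨e₀.restrOpen O hO, fun x => rfl, ⟨ha₀, haO⟩, fun x hx => (hOsub hx.2).1,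
    hf.mono fun x hx => (hOsub hx.2).1, fun y hy => ?_, fun x hx => ?_⟩
  · have hx := (e₀.restrOpen O hO).map_target hy
    obtain ⟨e', he'⟩ := (hOsub hx.2).2
    have hd : HasFDerivAt f (e' : E →L[ℝ] F) ((e₀.restrOpen O hO).symm y) := by
      rw [he']
      exact ((hf.contDiffAt (mem_of_superset (hO.mem_nhds hx.2)
        fun x hx => (hOsub hx).1)).differentiableAt (by simp)).hasFDerivAt
    exact ((e₀.restrOpen O hO).contDiffAt_symm hy hd (hf.contDiffAt (mem_of_superset
      (hO.mem_nhds hx.2) fun x hx => (hOsub hx).1))).contDiffWithinAt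
  · obtain ⟨e', he'⟩ := (hOsub hx.2).2
    exact ⟨e', he'⟩

end LocalDiffeo

/-! ### The primitive as a bounded operator on curves. -/

section IntegralOperator

variable {K : Type*} [NormedAddCommGroup K] [NormedSpace ℝ K]

/-- `(primitive Y)(t) = ∫₀ᵗ Y`. -/
def primitiveFun (Y : C(unitInterval, K)) (t : ℝ) : K :=
  ∫ s in (0 : ℝ)..t, IccExtend zero_le_one Y s

theorem primitiveFun_zero (Y : C(unitInterval, K)) : primitiveFun Y 0 = 0 :=
  intervalIntegral.integral_same

variable [CompleteSpace K]

theorem hasDerivAt_primitiveFun (Y : C(unitInterval, K)) (t : ℝ) :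
    HasDerivAt (primitiveFun Y) (IccExtend zero_le_one Y t) t :=
  have hc : Continuous (IccExtend zero_le_one Y) := Y.continuous.Icc_extend'
  intervalIntegral.integral_hasDerivAt_right (hc.intervalIntegrable _ _)
    hc.aestronglyMeasurable.stronglyMeasurableAtFilter hc.continuousAt

/-- The integral operator on continuous functions on the unit interval. -/
def primitive : C(unitInterval, K) →L[ℝ] C(unitInterval, K) :=
  LinearMap.mkContinuous
    { toFun := fun Y => ⟨fun t => primitiveFun Y t, by
        have : Continuous (primitiveFun Y) :=
          continuous_iff_continuousAt.2 fun t => (hasDerivAt_primitiveFun Y t).continuousAt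
        fun_prop⟩
      map_add' := fun Y Z => by
        ext t
        have h : ∀ Y : C(unitInterval, K), Continuous (IccExtend zero_le_one Y) :=
          fun Y => Y.continuous.Icc_extend'
        exact intervalIntegral.integral_add ((h Y).intervalIntegrable _ _)
          ((h Z).intervalIntegrable _ _)
      map_smul' := fun c Y => by
        ext t
        exact intervalIntegral.integral_smul _ _ } 1
    (fun Y => by
      refine (ContinuousMap.norm_le _ (by positivity)).2 fun t => ?_
      refine (intervalIntegral.norm_integral_le_of_norm_le_const (C := ‖Y‖) fun s _ =>
        Y.norm_coe_le_norm _).trans ?_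
      rw [sub_zero, abs_of_nonneg t.2.1, one_mul]
      exact mul_le_of_le_one_right (norm_nonneg _) t.2.2)

theorem primitive_apply (Y : C(unitInterval, K)) (t : unitInterval) :
    primitive Y t = primitiveFun Y t := rfl

end IntegralOperator

end ConstrainedHamiltonian

end

noncomputable section

namespace ConstrainedHamiltonian

/-! ### Smooth dependence of solutions on initial value and parameter. -/

section ParametricODE

universe u

/-- Constant functions on the unit interval, as a continuous linear map. -/
def constFun (K : Type*) [NormedAddCommGroup K] [NormedSpace ℝ K] :
    K →L[ℝ] C(unitInterval, K) :=
  LinearMap.mkContinuous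
    { toFun := fun x => ContinuousMap.const _ x
      map_add' := fun _ _ => rfl
      map_smul' := fun _ _ => rfl } 1
    (fun x => (ContinuousMap.norm_le _ (by positivity)).2 fun t => (one_mul ‖x‖).ge)

@[simp] theorem constFun_apply {K : Type*} [NormedAddCommGroup K] [NormedSpace ℝ K] (x : K)
    (t : unitInterval) : constFun K x t = x := rfl

variable {K : Type u} [NormedAddCommGroup K] [NormedSpace ℝ K]
  {Y : Type} [NormedAddCommGroup Y] [NormedSpace ℝ Y]

/-- A curve in `K` and a parameter in `Y`, as a curve in `K × Y`. -/
def pairFun (K : Type u) [NormedAddCommGroup K] [NormedSpace ℝ K]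
    (Y : Type) [NormedAddCommGroup Y] [NormedSpace ℝ Y] :
    (K × Y) × C(unitInterval, K) →L[ℝ] C(unitInterval, K × Y) :=
  (ContinuousLinearMap.compLeftContinuous ℝ unitInterval (ContinuousLinearMap.inl ℝ K Y)).comp
      (ContinuousLinearMap.snd ℝ _ _) +
    (constFun (K × Y)).comp ((ContinuousLinearMap.inr ℝ K Y).comp
      ((ContinuousLinearMap.snd ℝ K Y).comp (ContinuousLinearMap.fst ℝ _ _)))

@[simp] theorem pairFun_apply (q : (K × Y) × C(unitInterval, K)) (t : unitInterval) :
    pairFun K Y q t = (q.2 t, q.1.2) := by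
  simp [pairFun]

variable [CompleteSpace K]

/-- `x ↦ ` the defect of `x` in the integral form of `z' = f(z, η)`, `z(0) = x₀`. -/
def odeDefect {f : K × Y → K} (hf : ContDiff ℝ ∞ f) (q : (K × Y) × C(unitInterval, K)) :
    (K × Y) × C(unitInterval, K) :=
  (q.1, q.2 - (constFun K q.1.1 + primitive (superpose f hf.continuous (pairFun K Y q))))

theorem contDiff_odeDefect {f : K × Y → K} (hf : ContDiff ℝ ∞ f) :
    ContDiff ℝ ∞ (odeDefect hf) := by
  refine contDiff_fst.prodMk (contDiff_snd.sub (ContDiff.add ?_ ?_))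
  · exact (constFun K).contDiff.comp (contDiff_fst.comp contDiff_fst)
  · exact primitive.contDiff.comp ((contDiff_superpose hf).comp (pairFun K Y).contDiff)

theorem hasFDerivAt_odeDefect {f : K × Y → K} (hf : ContDiff ℝ ∞ f)
    (q : (K × Y) × C(unitInterval, K)) :
    HasFDerivAt (fun q => primitive (superpose f hf.continuous (pairFun K Y q)))
      (primitive.comp ((pointwiseApply (superpose (fderiv ℝ f)
        (hf.continuous_fderiv (by simp)) (pairFun K Y q))).comp (pairFun K Y))) q :=
  HasFDerivAt.comp q (g := primitive) (f := fun q => superpose f hf.continuous (pairFun K Y q))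
    (primitive (K := K)).hasFDerivAt (HasFDerivAt.comp q (f := pairFun K Y)
      (hasFDerivAt_superpose (hf.of_le (by simp)) _) (pairFun K Y).hasFDerivAt)

variable [CompleteSpace Y]

/-- Smooth dependence of the solutions of `z' = f(z, η)` on `[0, 1]` on the initial value and on
the parameter, near the rest point `(0, 0)`, with the variational equation. -/
theorem exists_contDiffOn_flow {f : K × Y → K} (hf : ContDiff ℝ ∞ f) (hf0 : ∀ x, f (x, 0) = 0)
    {Q : Set K} (hQ : Q ∈ 𝓝 0) :
    ∃ (F : K × Y → K) (S : Set (K × Y)), IsOpen S ∧ (0 : K × Y) ∈ S ∧ ContDiffOn ℝ ∞ F S ∧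
      F 0 = 0 ∧ (∀ δ, fderiv ℝ F 0 δ = δ.1 + fderiv ℝ f 0 (0, δ.2)) ∧
      ∀ p ∈ S, ∀ δ : K × Y, ∃ c J : ℝ → K, c 0 = p.1 ∧ J 0 = δ.1 ∧ c 1 = F p ∧
        J 1 = fderiv ℝ F p δ ∧ ∀ t ∈ Icc (0 : ℝ) 1, c t ∈ Q ∧
          HasDerivAt c (f (c t, p.2)) t ∧
          HasDerivAt J (fderiv ℝ f (c t, p.2) (J t, δ.2)) t := by
  have hf00 : f 0 = 0 := hf0 0
  have hDx : ∀ x : K, fderiv ℝ f 0 (x, 0) = 0 := fun x => by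
    have h1 : HasFDerivAt (fun y : K => f (y, 0))
        ((fderiv ℝ f 0).comp (ContinuousLinearMap.inl ℝ K Y)) 0 :=
      ((hf.differentiable (by simp)).differentiableAt.hasFDerivAt).comp (0 : K)
        (ContinuousLinearMap.inl ℝ K Y).hasFDerivAt
    simp only [hf0] at h1
    exact DFunLike.congr_fun (h1.unique (hasFDerivAt_const _ _)) x
  have hDf : ∀ δ : K × Y, fderiv ℝ f 0 δ = fderiv ℝ f 0 (0, δ.2) := fun δ => by
    conv_lhs => rw [show δ = (δ.1, 0) + (0, δ.2) by simp, map_add, hDx, zero_add]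
  set A : K × Y →L[ℝ] C(unitInterval, K) :=
    (constFun K).comp (ContinuousLinearMap.fst ℝ K Y) +
      primitive.comp ((constFun K).comp ((fderiv ℝ f 0).comp
        ((ContinuousLinearMap.inr ℝ K Y).comp (ContinuousLinearMap.snd ℝ K Y)))) with hA
  -- As `f` vanishes on K × {0}, its derivative at 0 in the K-direction is zero. Hence the
  -- derivative of the defect in the curve variable is the identity, and the total derivative is a
  -- shear, which is invertible.
  have hder : HasFDerivAt (odeDefect hf)
      (((ContinuousLinearEquiv.refl ℝ (K × Y)).skewProd
        (ContinuousLinearEquiv.refl ℝ C(unitInterval, K)) (-A) :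
        ((K × Y) × C(unitInterval, K)) ≃L[ℝ] _) : _ →L[ℝ] _) 0 := by
    have h := hasFDerivAt_fst.prodMk (hasFDerivAt_snd.sub
      (((constFun K).hasFDerivAt.comp (0 : (K × Y) × C(unitInterval, K))
        (hasFDerivAt_fst.comp (0 : (K × Y) × C(unitInterval, K)) hasFDerivAt_fst)).add
      (hasFDerivAt_odeDefect hf 0)))
    refine h.congr_fderiv ?_
    refine ContinuousLinearMap.ext fun q => Prod.ext rfl ?_
    have h0 : primitive (pointwiseApply (superpose (fderiv ℝ f) (hf.continuous_fderiv (by simp))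
        (pairFun K Y 0)) (pairFun K Y q)) = primitive (constFun K (fderiv ℝ f 0 (0, q.1.2))) := by
      congr 1
      ext t
      simpa using hDf (q.2 t, q.1.2)
    rw [map_zero] at h0
    simp [hA, h0, sub_eq_add_neg]
  obtain ⟨e, he, h0e, -, -, hsymm, -⟩ := exists_openPartialHomeomorph_contDiffOn univ_mem
    (contDiff_odeDefect hf).contDiffOn hder
  have hd0 : odeDefect hf (0 : (K × Y) × C(unitInterval, K)) = 0 := by
    have : superpose f hf.continuous (pairFun K Y 0) = 0 := by
      ext t
      simpa using hf00
    rw [map_zero] at this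
    simp [odeDefect, this]
  have h0t : ((0 : K × Y), (0 : C(unitInterval, K))) ∈ e.target := by
    have := e.map_source h0e
    rwa [he, hd0] at this
  have h0s : e.symm ((0 : K × Y), (0 : C(unitInterval, K))) = 0 := by
    have := e.left_inv h0e
    rwa [he, hd0] at this
  -- The curve with data `p` and zero defect, i.e. the solution of the integral equation.
  set Z : K × Y → C(unitInterval, K) := fun p => (e.symm (p, 0)).2 with hZ
  have hS₀ : IsOpen {p : K × Y | (p, (0 : C(unitInterval, K))) ∈ e.target} :=
    e.open_target.preimage (by fun_prop)
  have hZs₀ : ContDiffOn ℝ ∞ Z {p : K × Y | (p, (0 : C(unitInterval, K))) ∈ e.target} :=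
    contDiff_snd.comp_contDiffOn (hsymm.comp (by fun_prop) fun p hp => hp)
  obtain ⟨r, hr, hrQ⟩ := Metric.mem_nhds_iff.1 hQ
  set S : Set (K × Y) := {p : K × Y | (p, (0 : C(unitInterval, K))) ∈ e.target} ∩
    Z ⁻¹' Metric.ball 0 r with hSdef
  have hS : IsOpen S := hZs₀.continuousOn.isOpen_inter_preimage hS₀ Metric.isOpen_ball
  have hZS : ContDiffOn ℝ ∞ Z S := hZs₀.mono inter_subset_left
  have hZ0 : Z 0 = 0 := congrArg Prod.snd h0s
  have h0S : (0 : K × Y) ∈ S := ⟨h0t, by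
    rw [mem_preimage, hZ0]
    exact Metric.mem_ball_self hr⟩
  have hfix : ∀ p ∈ S, Z p = constFun K p.1 + primitive (superpose f hf.continuous
      (pairFun K Y (p, Z p))) := fun p hp => by
    have h1 := e.right_inv hp.1
    rw [he] at h1
    have h2 : (e.symm (p, 0)).1 = p := congrArg Prod.fst h1
    have h3 := congrArg Prod.snd h1
    have h4 : e.symm (p, 0) = (p, Z p) := Prod.ext h2 rfl
    rw [h4] at h3
    exact sub_eq_zero.1 h3
  have hZd : ∀ p ∈ S, HasFDerivAt Z (fderiv ℝ Z p) p := fun p hp =>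
    ((hZS.contDiffAt (hS.mem_nhds hp)).differentiableAt (by simp)).hasFDerivAt
  -- Differentiating the integral equation with respect to the data gives the integral form of the
  -- variational equation.
  have hfix' : ∀ p ∈ S, ∀ δ, fderiv ℝ Z p δ = constFun K δ.1 + primitive (pointwiseApply
      (superpose (fderiv ℝ f) (hf.continuous_fderiv (by simp)) (pairFun K Y (p, Z p)))
      (pairFun K Y (δ, fderiv ℝ Z p δ))) := fun p hp δ => by
    have h1 : HasFDerivAt (fun p => (p, Z p)) ((ContinuousLinearMap.id ℝ (K × Y)).prod
        (fderiv ℝ Z p)) p := (hasFDerivAt_id p).prodMk (hZd p hp)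
    have h2 := ((constFun K).hasFDerivAt.comp p (hasFDerivAt_fst (𝕜 := ℝ) (p := p))).add
      (HasFDerivAt.comp p (f := fun p => (p, Z p)) (hasFDerivAt_odeDefect hf (p, Z p)) h1)
    have h3 : Z =ᶠ[𝓝 p] fun p => constFun K p.1 + primitive (superpose f hf.continuous
      (pairFun K Y (p, Z p))) := by
      filter_upwards [hS.mem_nhds hp] with q hq using hfix q hq
    exact DFunLike.congr_fun ((hZd p hp).unique (h2.congr_of_eventuallyEq h3)) δ
  have hFd : ∀ p ∈ S, ∀ δ, fderiv ℝ (fun p => Z p 1) p δ = fderiv ℝ Z p δ 1 := fun p hp δ => by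
    have := (ContinuousMap.evalCLM ℝ (1 : unitInterval)).hasFDerivAt.comp p (hZd p hp)
    exact DFunLike.congr_fun this.fderiv δ
  have hev : ContDiff ℝ ∞ (fun Y : C(unitInterval, K) => Y 1) :=
    (ContinuousMap.evalCLM ℝ (1 : unitInterval) : C(unitInterval, K) →L[ℝ] K).contDiff
  refine ⟨fun p => Z p 1, S, hS, h0S, hev.comp_contDiffOn hZS, by simp [hZ0],
    fun δ => ?_, fun p hp δ => ?_⟩
  · rw [hFd 0 h0S, hfix' 0 h0S]
    have h1 : pointwiseApply (superpose (fderiv ℝ f) (hf.continuous_fderiv (by simp))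
        (pairFun K Y (0, Z 0))) (pairFun K Y (δ, fderiv ℝ Z 0 δ)) =
        constFun K (fderiv ℝ f 0 (0, δ.2)) := by
      ext t
      simpa [hZ0, Prod.mk_zero_zero] using hDf (fderiv ℝ Z 0 δ t, δ.2)
    rw [h1]
    simp [primitive_apply, primitiveFun, IccExtend]
  · set Y₁ := superpose f hf.continuous (pairFun K Y (p, Z p)) with hY₁
    set Y₂ := pointwiseApply (superpose (fderiv ℝ f) (hf.continuous_fderiv (by simp))
      (pairFun K Y (p, Z p))) (pairFun K Y (δ, fderiv ℝ Z p δ)) with hY₂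
    have hc : ∀ t (ht : t ∈ Icc (0 : ℝ) 1), p.1 + primitiveFun Y₁ t = Z p ⟨t, ht⟩ :=
      fun t ht => (DFunLike.congr_fun (hfix p hp) ⟨t, ht⟩).symm
    have hJ : ∀ t (ht : t ∈ Icc (0 : ℝ) 1), δ.1 + primitiveFun Y₂ t = fderiv ℝ Z p δ ⟨t, ht⟩ :=
      fun t ht => (DFunLike.congr_fun (hfix' p hp δ) ⟨t, ht⟩).symm
    refine ⟨fun t => p.1 + primitiveFun Y₁ t, fun t => δ.1 + primitiveFun Y₂ t,
      by simp [primitiveFun_zero], by simp [primitiveFun_zero], hc 1 (by simp), ?_,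
      fun t ht => ⟨?_, ?_, ?_⟩⟩
    · rw [hFd p hp]
      exact hJ 1 (by simp)
    · simp only [hc t ht]
      exact hrQ (mem_ball_zero_iff.2
        (((Z p).norm_coe_le_norm _).trans_lt (mem_ball_zero_iff.1 hp.2)))
    · simp only [hc t ht]
      refine ((hasDerivAt_primitiveFun Y₁ t).const_add p.1).congr_deriv ?_
      rw [IccExtend_of_mem _ _ ht]
      simp [hY₁]
    · simp only [hc t ht, hJ t ht]
      refine ((hasDerivAt_primitiveFun Y₂ t).const_add δ.1).congr_deriv ?_
      rw [IccExtend_of_mem _ _ ht]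
      simp [hY₂]

end ParametricODE

end ConstrainedHamiltonian

end

noncomputable section

namespace ConstrainedHamiltonian

/-! ### Integrability of the kernel of a closed 2-form of constant rank. -/

section Frobenius

universe u

/-- An injective linear map between spaces of the same finite dimension is an isomorphism. -/
theorem exists_continuousLinearEquiv_of_injective {E F : Type*} [NormedAddCommGroup E]
    [NormedSpace ℝ E] [FiniteDimensional ℝ E] [NormedAddCommGroup F] [NormedSpace ℝ F]
    [FiniteDimensional ℝ F] (A : E →L[ℝ] F) (hA : Function.Injective A)
    (h : Module.finrank ℝ E = Module.finrank ℝ F) : ∃ e : E ≃L[ℝ] F, (e : E →L[ℝ] F) = A := by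
  have hA' : Function.Injective (A : E →ₗ[ℝ] F) := hA
  refine ⟨(LinearEquiv.ofBijective (A : E →ₗ[ℝ] F) ⟨hA',
    (LinearMap.injective_iff_surjective_of_finrank_eq_finrank h).1 hA'⟩).toContinuousLinearEquiv,
    ?_⟩
  ext x
  rfl

variable {K : Type u} [NormedAddCommGroup K] [NormedSpace ℝ K]
  {Y : Type} [NormedAddCommGroup Y] [NormedSpace ℝ Y]

/-- The variation of the integral curves `c` of the fields `X(·)(s)`, which span the kernel of the
closed form `ν`, with respect to the parameter `s` is in the kernel of `ν`. -/
theorem form_variation_eq_zero {ν : K → K →L[ℝ] K →L[ℝ] ℝ} {X : K → Y →L[ℝ] K} {U : Set K}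
    (hU : IsOpen U) (hν : ContDiffOn ℝ ∞ ν U) (hX : ContDiffOn ℝ ∞ X U)
    (halt : ∀ x ∈ U, ∀ a b, ν x a b = -ν x b a)
    (hclosed : ∀ x ∈ U, ∀ a b c,
      fderiv ℝ ν x a b c + fderiv ℝ ν x b c a + fderiv ℝ ν x c a b = 0)
    (hker : ∀ x ∈ U, ∀ s, ν x (X x s) = 0) {c J : ℝ → K} {s η : Y} (hJ0 : J 0 = 0)
    (hcU : ∀ t ∈ Icc (0 : ℝ) 1, c t ∈ U)
    (hc : ∀ t ∈ Icc (0 : ℝ) 1, HasDerivAt c (X (c t) s) t)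
    (hJ : ∀ t ∈ Icc (0 : ℝ) 1, HasDerivAt J (fderiv ℝ X (c t) (J t) s + X (c t) η) t) :
    ν (c 1) (J 1) = 0 := by
  have hνd : ∀ x ∈ U, HasFDerivAt ν (fderiv ℝ ν x) x := fun x hx =>
    ((hν.contDiffAt (hU.mem_nhds hx)).differentiableAt (by simp)).hasFDerivAt
  have hXd : ∀ x ∈ U, HasFDerivAt X (fderiv ℝ X x) x := fun x hx =>
    ((hX.contDiffAt (hU.mem_nhds hx)).differentiableAt (by simp)).hasFDerivAt
  -- differentiating `ν x (X x s) = 0`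
  have hkerd : ∀ x ∈ U, ∀ a, fderiv ℝ ν x a (X x s) + ν x (fderiv ℝ X x a s) = 0 := by
    intro x hx a
    have h1 := (hνd x hx).clm_apply ((hXd x hx).clm_apply (hasFDerivAt_const s x))
    have h2 : (fun x => ν x (X x s)) =ᶠ[𝓝 x] fun _ => 0 := by
      filter_upwards [hU.mem_nhds hx] with y hy using hker y hy s
    have h3 := DFunLike.congr_fun (h1.unique ((hasFDerivAt_const _ x).congr_of_eventuallyEq h2)) a
    simpa [add_comm] using h3
  have hskew : ∀ x ∈ U, ∀ a b d, fderiv ℝ ν x a b d = -fderiv ℝ ν x a d b := by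
    intro x hx a b d
    have h1 := ((hνd x hx).clm_apply (hasFDerivAt_const b x)).clm_apply (hasFDerivAt_const d x)
    have h2 := ((hνd x hx).clm_apply (hasFDerivAt_const d x)).clm_apply (hasFDerivAt_const b x)
    have h3 : (fun x => ν x b d) =ᶠ[𝓝 x] fun x => -ν x d b := by
      filter_upwards [hU.mem_nhds hx] with y hy using halt y hy b d
    have h4 := DFunLike.congr_fun (h1.unique (h2.neg.congr_of_eventuallyEq h3)) a
    simpa using h4
  set A : ℝ → K →L[ℝ] K := fun t =>
    (ContinuousLinearMap.apply ℝ K s).comp (fderiv ℝ X (c t)) with hA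
  have hcc : ContinuousOn c (Icc 0 1) := fun t ht => (hc t ht).continuousAt.continuousWithinAt
  have hAc : ContinuousOn A (Icc 0 1) := by
    have h1 : ContinuousOn (fderiv ℝ X) U := hX.continuousOn_fderiv_of_isOpen hU (by simp)
    exact continuousOn_const.clm_comp (h1.comp hcc hcU)
  obtain ⟨M, hM⟩ := isCompact_Icc.exists_bound_of_continuousOn hAc
  -- This is Cartan's formula in coordinates: a field X with ι_X ν = 0 preserves the closed form ν.
  -- So the covector ν(J, ·) along the curve satisfies a linear homogeneous equation; since it
  -- vanishes at time 0, Grönwall's inequality makes it vanish at time 1.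
  have hα : ∀ t ∈ Icc (0 : ℝ) 1,
      HasDerivAt (fun t => ν (c t) (J t)) (-(ν (c t) (J t)).comp (A t)) t := by
    intro t ht
    have hx := hcU t ht
    have h0 : HasDerivAt (fun t => ν (c t)) (fderiv ℝ ν (c t) (X (c t) s)) t :=
      HasFDerivAt.comp_hasDerivAt (l := ν) (l' := fderiv ℝ ν (c t)) t (hνd (c t) hx) (hc t ht)
    refine (h0.clm_apply (hJ t ht)).congr_deriv (ContinuousLinearMap.ext fun w => ?_)
    have e1 : fderiv ℝ ν (c t) (J t) (X (c t) s) w + ν (c t) (fderiv ℝ X (c t) (J t) s) w = 0 :=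
      DFunLike.congr_fun (hkerd (c t) hx (J t)) w
    have e2 : fderiv ℝ ν (c t) w (X (c t) s) (J t) + ν (c t) (fderiv ℝ X (c t) w s) (J t) = 0 :=
      DFunLike.congr_fun (hkerd (c t) hx w) (J t)
    have e3 := hclosed (c t) hx (X (c t) s) (J t) w
    have e4 := hskew (c t) hx (J t) w (X (c t) s)
    have e5 := halt (c t) hx (fderiv ℝ X (c t) w s) (J t)
    have e6 : (-(ν (c t) (J t)).comp (A t)) w = -ν (c t) (J t) (fderiv ℝ X (c t) w s) := rfl
    rw [e6, map_add, hker (c t) hx, add_zero, add_apply]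
    linarith
  have h0 : ν (c 0) (J 0) = 0 := by rw [hJ0, map_zero]
  refine eq_zero_of_abs_deriv_le_mul_abs_self_of_eq_zero_right (K := M)
    (f := fun t => ν (c t) (J t)) (f' := fun t => -(ν (c t) (J t)).comp (A t))
    (fun t ht => (hα t ht).continuousAt.continuousWithinAt)
    (fun t ht => (hα t (Ico_subset_Icc_self ht)).hasDerivWithinAt) h0 (fun t ht => ?_) 1
    (right_mem_Icc.2 zero_le_one)
  rw [norm_neg, mul_comm]
  exact (ContinuousLinearMap.opNorm_comp_le _ _).trans
    (mul_le_mul_of_nonneg_left (hM t (Ico_subset_Icc_self ht)) (norm_nonneg _))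

variable [FiniteDimensional ℝ K] [FiniteDimensional ℝ Y]

/-- The kernel of a closed 2-form of constant rank is integrable: near `0` there are coordinates
in which it is the tangent space of the second factor. -/
theorem exists_straightening {ν : K → K →L[ℝ] K →L[ℝ] ℝ} {X : K → Y →L[ℝ] K} {U : Set K}
    (hU : IsOpen U) (h0U : (0 : K) ∈ U) (hν : ContDiffOn ℝ ∞ ν U) (hX : ContDiffOn ℝ ∞ X U)
    (halt : ∀ x ∈ U, ∀ a b, ν x a b = -ν x b a)
    (hclosed : ∀ x ∈ U, ∀ a b c,
      fderiv ℝ ν x a b c + fderiv ℝ ν x b c a + fderiv ℝ ν x c a b = 0)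
    (hker : ∀ x ∈ U, ∀ w, ν x w = 0 ↔ ∃ s, X x s = w)
    (hinj : ∀ x ∈ U, Function.Injective (X x)) :
    ∃ (n : ℕ) (β : OpenPartialHomeomorph K (EuclideanSpace ℝ (Fin n) × Y)),
      0 ∈ β.source ∧ β.source ⊆ U ∧ β 0 = 0 ∧ ContDiffOn ℝ ∞ β β.source ∧
      ContDiffOn ℝ ∞ β.symm β.target ∧
      ∀ x ∈ β.source, ∀ w, (fderiv ℝ β x w).1 = 0 ↔ ν x w = 0 := by
  obtain ⟨r, hr, hrU⟩ := Metric.mem_nhds_iff.1 (hU.mem_nhds h0U)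
  -- The cut-off makes the fields globally smooth. The curves will be kept in the ball of radius r /
  -- 4, where it equals 1 and has no effect.
  let χ : ContDiffBump (0 : K) := ⟨r / 4, r / 2, by positivity, by linarith⟩
  have hχU : ∀ x ∉ U, ∀ᶠ y in 𝓝 x, χ y = 0 := fun x hx => by
    have h1 : x ∉ Metric.closedBall (0 : K) (r / 2) := fun h =>
      hx (hrU (Metric.closedBall_subset_ball (by linarith) h))
    filter_upwards [Metric.isClosed_closedBall.isOpen_compl.mem_nhds h1] with y hy
    refine χ.zero_of_le_dist ?_
    exact (not_le.1 (show ¬dist y 0 ≤ r / 2 from hy)).le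
  set f : K × Y → K := fun p => χ p.1 • X p.1 p.2 with hf
  have hfs : ContDiff ℝ ∞ f := contDiff_iff_contDiffAt.2 fun p => by
    by_cases hp : p.1 ∈ U
    · have h1 : ContDiffAt ℝ ∞ (fun p : K × Y => X p.1) p :=
        (hX.contDiffAt (hU.mem_nhds hp)).comp p contDiffAt_fst
      exact (χ.contDiff.contDiffAt.comp p contDiffAt_fst).smul (h1.clm_apply contDiffAt_snd)
    · refine (contDiffAt_const (c := (0 : K))).congr_of_eventuallyEq ?_
      filter_upwards [continuousAt_fst.eventually (hχU p.1 hp)] with q hq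
      simp [hf, hq]
  have hQ : Metric.ball (0 : K) (r / 4) ∈ 𝓝 0 := Metric.ball_mem_nhds _ (by positivity)
  have hQU : Metric.ball (0 : K) (r / 4) ⊆ U :=
    (Metric.ball_subset_ball (by linarith)).trans hrU
  have hfX : ∀ p : K × Y, p.1 ∈ Metric.ball (0 : K) (r / 4) → f p = X p.1 p.2 := fun p hp => by
    have : χ p.1 = 1 := χ.one_of_mem_closedBall (Metric.ball_subset_closedBall hp)
    simp [hf, this]
  have hfd : ∀ p : K × Y, p.1 ∈ Metric.ball (0 : K) (r / 4) → ∀ δ : K × Y,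
      fderiv ℝ f p δ = fderiv ℝ X p.1 δ.1 p.2 + X p.1 δ.2 := fun p hp δ => by
    have h1 : HasFDerivAt X (fderiv ℝ X p.1) p.1 :=
      ((hX.contDiffAt (hU.mem_nhds (hQU hp))).differentiableAt (by simp)).hasFDerivAt
    have h2 := (h1.comp p (hasFDerivAt_fst (𝕜 := ℝ) (E := K) (F := Y))).clm_apply
      (hasFDerivAt_snd (𝕜 := ℝ) (E := K) (F := Y))
    have h3 : f =ᶠ[𝓝 p] fun p => X p.1 p.2 := by
      filter_upwards [continuousAt_fst.preimage_mem_nhds (Metric.isOpen_ball.mem_nhds hp)] with q hq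
      exact hfX q hq
    rw [(h2.congr_of_eventuallyEq h3).fderiv]
    simp [add_comm]
  have : CompleteSpace K := FiniteDimensional.complete ℝ K
  have : CompleteSpace Y := FiniteDimensional.complete ℝ Y
  obtain ⟨F, S, hS, h0S, hF, hF0, hFd0, hflow⟩ := exists_contDiffOn_flow hfs
    (fun x => by simp [hf]) hQ
  -- The derivative of the time-one map in the parameter is the endpoint of a variation starting at
  -- 0, so it lies in ker ν.
  have hFker : ∀ p ∈ S, ∀ η, ν (F p) (fderiv ℝ F p (0, η)) = 0 := by
    intro p hp η
    obtain ⟨c, J, -, hJ0, hc1, hJ1, h⟩ := hflow p hp (0, η)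
    rw [← hc1, ← hJ1]
    refine form_variation_eq_zero (s := p.2) (η := η) hU hν hX halt hclosed
      (fun x hx s => (hker x hx _).2 ⟨s, rfl⟩) hJ0 (fun t ht => hQU (h t ht).1) (fun t ht => ?_)
      fun t ht => ?_
    · rw [← hfX (c t, p.2) (h t ht).1]
      exact (h t ht).2.1
    · have := (h t ht).2.2
      rwa [hfd (c t, p.2) (h t ht).1] at this
  have hFU : ∀ p ∈ S, F p ∈ U := fun p hp => by
    obtain ⟨c, J, -, -, hc1, -, h⟩ := hflow p hp 0
    rw [← hc1]
    exact hQU (h 1 (by simp)).1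
  -- At 0 the time-one map has derivative (x, s) ↦ x + X(0)s. Restricting the initial values to a
  -- complement of the range of `X 0` makes it an isomorphism; the inverse of the restricted map is
  -- the required chart.
  obtain ⟨C, hC⟩ := (LinearMap.range (X 0 : Y →ₗ[ℝ] K)).exists_isCompl
  set n := Module.finrank ℝ C with hn
  let ι : EuclideanSpace ℝ (Fin n) →L[ℝ] K := C.subtypeL.comp
    ((ContinuousLinearEquiv.ofFinrankEq (by simp [hn]) : EuclideanSpace ℝ (Fin n) ≃L[ℝ] C) :
      EuclideanSpace ℝ (Fin n) →L[ℝ] C)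
  have hιC : ∀ τ, ι τ ∈ C := fun τ => Subtype.coe_prop _
  have hι0 : ∀ τ, ι τ = 0 → τ = 0 := fun τ h => by
    simpa [ι] using h
  let m : EuclideanSpace ℝ (Fin n) × Y →L[ℝ] K × Y := ι.prodMap (ContinuousLinearMap.id ℝ Y)
  set G : EuclideanSpace ℝ (Fin n) × Y → K := fun q => F (m q) with hG
  have hm0 : m 0 = 0 := map_zero m
  have hS' : IsOpen (m ⁻¹' S) := hS.preimage m.continuous
  have hGs : ContDiffOn ℝ ∞ G (m ⁻¹' S) := hF.comp m.contDiff.contDiffOn fun q hq => hq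
  have hGd : ∀ q, m q ∈ S → HasFDerivAt G ((fderiv ℝ F (m q)).comp m) q := fun q hq =>
    (((hF.contDiffAt (hS.mem_nhds hq)).differentiableAt (by simp)).hasFDerivAt).comp q
      m.hasFDerivAt
  have hGd0 : ∀ δ : EuclideanSpace ℝ (Fin n) × Y,
      (fderiv ℝ F (m 0)).comp m δ = ι δ.1 + X 0 δ.2 := fun δ => by
    rw [hm0, ContinuousLinearMap.comp_apply, hFd0, hfd 0 (Metric.mem_ball_self (by positivity))]
    simp [m]
  obtain ⟨e', he'⟩ := exists_continuousLinearEquiv_of_injective ((fderiv ℝ F (m 0)).comp m)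
    ((injective_iff_map_eq_zero _).2 fun δ hδ => by
      rw [hGd0] at hδ
      have h1 : ι δ.1 = -(X 0 δ.2) := eq_neg_of_add_eq_zero_left hδ
      have h2 : ι δ.1 ∈ LinearMap.range (X 0 : Y →ₗ[ℝ] K) := by
        rw [h1]
        exact neg_mem ⟨δ.2, rfl⟩
      have h3 : ι δ.1 = 0 := (Submodule.disjoint_def.1 hC.disjoint) _ h2 (hιC _)
      have h4 : X 0 δ.2 = 0 := by rw [h3] at h1; simpa using h1.symm
      exact Prod.ext (hι0 _ h3) (hinj 0 h0U (h4.trans (map_zero _).symm)))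
    (by
      have h1 := Submodule.finrank_add_eq_of_isCompl hC
      have h2 := LinearMap.finrank_range_of_inj (f := (X 0 : Y →ₗ[ℝ] K)) (hinj 0 h0U)
      rw [Module.finrank_prod, finrank_euclideanSpace_fin]
      omega)
  obtain ⟨e, he, h0e, heS, hes, hesymm, heinv⟩ := exists_openPartialHomeomorph_contDiffOn
    (hS'.mem_nhds (by rw [mem_preimage, hm0]; exact h0S)) hGs
    (he' ▸ hGd 0 (by rw [hm0]; exact h0S))
  have hG0 : G 0 = 0 := by rw [hG]; simp only [hm0, hF0]
  refine ⟨n, e.symm, ?_, fun x hx => ?_, ?_, hesymm, hes, fun x hx w => ?_⟩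
  · have := e.map_source h0e
    rwa [he, hG0] at this
  · have h1 := e.map_target hx
    have h2 := e.right_inv hx
    rw [← h2, he]
    exact hFU _ (heS h1)
  · have := e.left_inv h0e
    rwa [he, hG0] at this
  · have hq := e.map_target hx
    set q := e.symm x with hqdef
    have hGq : G q = x := by rw [← he]; exact e.right_inv hx
    have hxU : x ∈ U := by rw [← hGq]; exact hFU _ (heS hq)
    have hd : HasFDerivAt G ((fderiv ℝ F (m q)).comp m) q := hGd q (heS hq)
    set L := (fderiv ℝ F (m q)).comp m with hL
    have hLinj : Function.Injective L := by
      obtain ⟨A, hA⟩ := heinv q hq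
      rw [hd.fderiv] at hA
      rw [← hA]
      exact A.injective
    have hsymmd : HasFDerivAt e.symm (fderiv ℝ e.symm x) x :=
      ((hesymm.contDiffAt (e.open_target.mem_nhds hx)).differentiableAt (by simp)).hasFDerivAt
    have hw : ∀ w, L (fderiv ℝ e.symm x w) = w := fun w => by
      have h1 := HasFDerivAt.comp x (g := G) (f := e.symm) hd hsymmd
      have h2 : G ∘ e.symm =ᶠ[𝓝 x] id := by
        filter_upwards [e.open_target.mem_nhds hx] with y hy
        rw [Function.comp, ← he, e.right_inv hy]; rfl
      exact DFunLike.congr_fun (h1.unique ((hasFDerivAt_id x).congr_of_eventuallyEq h2)) w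
    have hLk : ∀ η, ν x (L (0, η)) = 0 := fun η => by
      have h1 := hFker (m q) (heS hq) η
      have h2 : m (0, η) = (0, η) := by simp [m]
      rw [hL, ContinuousLinearMap.comp_apply, h2, ← hGq]
      exact h1
    constructor
    · intro h
      have h1 : fderiv ℝ e.symm x w = (0, (fderiv ℝ e.symm x w).2) := Prod.ext h rfl
      rw [← hw w, h1]
      exact hLk _
    · intro h
      -- So far L({0} × Y) ⊆ ker ν. Both have the dimension of Y: transported to Y through X(x), the
      -- inclusion becomes an injective endomorphism, hence it is onto and equality holds.
      choose N hN using fun η => (hker x hxU _).1 (hLk η)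
      let N' : Y →ₗ[ℝ] Y :=
        { toFun := N
          map_add' := fun a b => hinj x hxU (by
            rw [map_add, hN, hN, hN, ← map_add]; simp)
          map_smul' := fun a b => hinj x hxU (by
            rw [map_smul, hN, hN, ← map_smul]; simp) }
      have hN'inj : Function.Injective N' := (injective_iff_map_eq_zero _).2 fun η hη => by
        have h1 : L (0, η) = 0 := by rw [← hN, show N η = 0 from hη, map_zero]
        exact congrArg Prod.snd (hLinj (h1.trans (map_zero L).symm))
      obtain ⟨s, hs⟩ := (hker x hxU w).1 h
      obtain ⟨η, hη⟩ := LinearMap.surjective_of_injective hN'inj s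
      have h1 : L (0, η) = w := by rw [← hN, show N η = s from hη, hs]
      have h2 := hLinj (h1.trans (hw w).symm)
      rw [← h2]

end Frobenius

end ConstrainedHamiltonian

end

noncomputable section

namespace ConstrainedHamiltonian

/-! ### Alternating 2-forms as bilinear maps: closedness and pull-back. -/

section Bilinear

variable {W W' : Type*} [NormedAddCommGroup W] [NormedSpace ℝ W]
  [NormedAddCommGroup W'] [NormedSpace ℝ W']

/-- The bilinear map of a continuous alternating 2-form. -/
def bilinOfForm (w : W [⋀^Fin 2]→L[ℝ] ℝ) : W →L[ℝ] W →L[ℝ] ℝ :=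
  LinearMap.mkContinuous₂
    (LinearMap.mk₂ ℝ (fun u v : W => w ![u, v])
      (fun u u' v => by simpa only [update_zero] using w.map_update_add ![u, v] 0 u u')
      (fun c u v => by simpa only [update_zero] using w.map_update_smul ![u, v] 0 c u)
      (fun u v v' => by simpa only [update_one] using w.map_update_add ![u, v] 1 v v')
      (fun c u v => by simpa only [update_one] using w.map_update_smul ![u, v] 1 c v))
    ‖w‖ (fun u v => by
      simpa [Fin.prod_univ_two, mul_assoc] using w.le_opNorm ![u, v])

theorem norm_bilinOfForm_le (w : W [⋀^Fin 2]→L[ℝ] ℝ) : ‖bilinOfForm w‖ ≤ ‖w‖ :=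
  LinearMap.mkContinuous₂_norm_le _ (norm_nonneg w) _

/-- The bilinear map of an alternating form, as a continuous linear function of the form. -/
def toBilin : (W [⋀^Fin 2]→L[ℝ] ℝ) →L[ℝ] W →L[ℝ] W →L[ℝ] ℝ :=
  LinearMap.mkContinuous (E := W [⋀^Fin 2]→L[ℝ] ℝ) (F := W →L[ℝ] W →L[ℝ] ℝ)
    { toFun := bilinOfForm
      map_add' := fun _ _ => rfl
      map_smul' := fun _ _ => rfl } 1
    (fun w => (norm_bilinOfForm_le w).trans (one_mul ‖w‖).ge)

@[simp] theorem toBilin_apply (w : W [⋀^Fin 2]→L[ℝ] ℝ) (u v : W) : toBilin w u v = w ![u, v] :=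
  rfl

theorem hasFDerivAt_toBilin (w : W [⋀^Fin 2]→L[ℝ] ℝ) :
    HasFDerivAt (𝕜 := ℝ) (fun w : W [⋀^Fin 2]→L[ℝ] ℝ => toBilin w) toBilin w :=
  ContinuousLinearMap.hasFDerivAt (E := W [⋀^Fin 2]→L[ℝ] ℝ) (F := W →L[ℝ] W →L[ℝ] ℝ) toBilin

theorem contDiff_toBilin : ContDiff ℝ ∞ (fun w : W [⋀^Fin 2]→L[ℝ] ℝ => toBilin w) := by
  fun_prop

theorem toBilin_skew (w : W [⋀^Fin 2]→L[ℝ] ℝ) (u v : W) : toBilin w u v = -toBilin w v u := by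
  have h : (![v, u] : Fin 2 → W) = ![u, v] ∘ Equiv.swap 0 1 := by
    funext i
    fin_cases i <;> simp
  have h' := w.toAlternatingMap.map_swap ![u, v] (show (0 : Fin 2) ≠ 1 by simp)
  rw [toBilin_apply, toBilin_apply, h]
  exact (neg_eq_iff_eq_neg.2 h').symm

/-- The exterior derivative is the alternating sum of derivatives with one argument removed; skew
symmetry absorbs the sign of the middle term. -/
theorem cyclic_sum_fderiv_of_extDeriv_eq_zero {w : W → W [⋀^Fin 2]→L[ℝ] ℝ} {x : W}
    (hw : DifferentiableAt ℝ w x) (h : extDeriv w x = 0) (a b c : W) :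
    fderiv ℝ (fun y => toBilin (w y)) x a b c + fderiv ℝ (fun y => toBilin (w y)) x b c a +
      fderiv ℝ (fun y => toBilin (w y)) x c a b = 0 := by
  have hd : HasFDerivAt (fun y => toBilin (w y)) ((toBilin : _ →L[ℝ] _).comp (fderiv ℝ w x)) x :=
    HasFDerivAt.comp x (g := fun w => toBilin w) (hasFDerivAt_toBilin (w x)) hw.hasFDerivAt
  have happ : ∀ u v y, fderiv ℝ (fun z => w z ![u, v]) x y =
      fderiv ℝ (fun y => toBilin (w y)) x y u v := fun u v y => by
    rw [hd.fderiv]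
    exact fderiv_continuousAlternatingMap_apply_const_apply hw ![u, v] y
  have h1 := extDeriv_apply hw ![a, b, c]
  have e0 : Fin.removeNth 0 ![a, b, c] = ![b, c] := by
    funext i; fin_cases i <;> rfl
  have e1 : Fin.removeNth 1 ![a, b, c] = ![a, c] := by
    funext i; fin_cases i <;> rfl
  have e2 : Fin.removeNth 2 ![a, b, c] = ![a, b] := by
    funext i; fin_cases i <;> rfl
  rw [h, Fin.sum_univ_three, e0, e1, e2, happ, happ, happ] at h1
  have h2 : fderiv ℝ (fun y => toBilin (w y)) x b a c =
      -fderiv ℝ (fun y => toBilin (w y)) x b c a := by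
    rw [← happ, ← happ, ← neg_apply, ← fderiv_fun_neg]
    congr 2
    funext z
    exact toBilin_skew (w z) a c
  simp [h2] at h1
  linarith

/-- The form Aᵗ w A of the pull-back shows it as a composition of operators, so it is smooth as soon
as `w` and `A` are. -/
theorem toBilin_compContinuousLinearMap (w : W' [⋀^Fin 2]→L[ℝ] ℝ) (A : W →L[ℝ] W') :
    toBilin (w.compContinuousLinearMap A) =
      ((ContinuousLinearMap.compL ℝ W W' ℝ).flip A).comp ((toBilin w).comp A) := by
  ext u v
  simp only [toBilin_apply, ContinuousLinearMap.comp_apply, ContinuousLinearMap.flip_apply,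
    ContinuousLinearMap.compL_apply, ContinuousAlternatingMap.compContinuousLinearMap_apply]
  congr 1
  funext i
  fin_cases i <;> rfl

theorem contDiffAt_toBilin_pullback {w : W' → W' [⋀^Fin 2]→L[ℝ] ℝ} {f : W → W'} {z : W}
    (hw : ContDiffAt ℝ ∞ w (f z)) (hf : ContDiffAt ℝ ∞ f z) :
    ContDiffAt ℝ ∞ (fun z => toBilin ((w (f z)).compContinuousLinearMap (fderiv ℝ f z))) z := by
  have h2 : ContDiffAt ℝ ∞ (fderiv ℝ f) z := hf.fderiv_right (by simp)
  have h3 : ContDiffAt ℝ ∞ (fun z => toBilin (w (f z))) z :=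
    ContDiffAt.comp z (g := fun w => toBilin w) contDiff_toBilin.contDiffAt (hw.comp z hf)
  have h4 : ContDiffAt ℝ ∞ (fun z => (ContinuousLinearMap.compL ℝ W W' ℝ).flip (fderiv ℝ f z)) z :=
    ContDiffAt.comp z (g := fun A => (ContinuousLinearMap.compL ℝ W W' ℝ).flip A)
      (by fun_prop) h2
  simp only [toBilin_compContinuousLinearMap]
  exact h4.clm_comp (h3.clm_comp h2)

end Bilinear

/-! ### Charts of P in which the constraint is a coordinate. -/

section StraightChart

variable {E V P : Type*} [NormedAddCommGroup E] [NormedSpace ℝ E]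
  [NormedAddCommGroup V] [NormedSpace ℝ V] [TopologicalSpace P] [ChartedSpace E P]

/-- The form `Ω` read in a local parametrisation `ψ : W → P`. -/
def formIn {W : Type*} [NormedAddCommGroup W] [NormedSpace ℝ W] (Ω : SymplecticForm E P)
    (ψ : W → P) (z : W) : W →L[ℝ] W →L[ℝ] ℝ :=
  toBilin ((Ω.form (ψ z)).compContinuousLinearMap
    (mfderiv 𝓘(ℝ, W) 𝓘(ℝ, E) ψ z : W →L[ℝ] TangentSpace 𝓘(ℝ, E) (ψ z)))

theorem formIn_apply {W : Type*} [NormedAddCommGroup W] [NormedSpace ℝ W]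
    (Ω : SymplecticForm E P) (ψ : W → P) (z u v : W) :
    formIn Ω ψ z u v = Ω.form (ψ z) ![mfderiv 𝓘(ℝ, W) 𝓘(ℝ, E) ψ z u,
      mfderiv 𝓘(ℝ, W) 𝓘(ℝ, E) ψ z v] := by
  refine congrArg (Ω.form (ψ z)) ?_
  funext i
  fin_cases i <;> rfl

/-- Smooth coordinates on `P` in which the constraint `g` is a coordinate projection. -/
structure IsStraightChart (Ω : SymplecticForm E P) (g : P → V) {d : ℕ}
    (ξ : OpenPartialHomeomorph P (EuclideanSpace ℝ (Fin d) × V)) : Prop where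
  snd_eq : ∀ y ∈ ξ.source, (ξ y).2 = g y
  smooth : ContMDiffOn 𝓘(ℝ, E) 𝓘(ℝ, EuclideanSpace ℝ (Fin d) × V) ∞ ξ ξ.source
  smooth_symm : ContMDiffOn 𝓘(ℝ, EuclideanSpace ℝ (Fin d) × V) 𝓘(ℝ, E) ∞ ξ.symm ξ.target
  form_smooth : ContDiffOn ℝ ∞ (formIn Ω ξ.symm) ξ.target
  form_closed : ∀ z ∈ ξ.target, ∀ a b c, fderiv ℝ (formIn Ω ξ.symm) z a b c +
    fderiv ℝ (formIn Ω ξ.symm) z b c a + fderiv ℝ (formIn Ω ξ.symm) z c a b = 0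

variable [FiniteDimensional ℝ E] [FiniteDimensional ℝ V] [IsManifold 𝓘(ℝ, E) ∞ P]

/-- Around a point of the constraint manifold there are coordinates in which the constraint is a
coordinate projection. -/
theorem exists_straight_chart (Ω : SymplecticForm E P) {g : P → V}
    (hg : ContMDiff 𝓘(ℝ, E) 𝓘(ℝ, V) ∞ g) {m : P} (hm : m ∈ constraintSet g)
    (hreg : Function.Surjective (mfderiv 𝓘(ℝ, E) 𝓘(ℝ, V) g m)) :
    ∃ (d : ℕ) (ξ : OpenPartialHomeomorph P (EuclideanSpace ℝ (Fin d) × V)),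
      m ∈ ξ.source ∧ ξ m = 0 ∧ IsStraightChart Ω g ξ := by
  set c := chartAt E m with hc
  have hcs : ContMDiffOn 𝓘(ℝ, E) 𝓘(ℝ, E) ∞ c c.source := contMDiffOn_chart
  have hct : ContMDiffOn 𝓘(ℝ, E) 𝓘(ℝ, E) ∞ c.symm c.target := contMDiffOn_chart_symm
  have hmc : m ∈ c.source := mem_chart_source E m
  set x₀ := c m with hx₀
  have hx₀t : x₀ ∈ c.target := c.map_source hmc
  have hcx₀ : c.symm x₀ = m := c.left_inv hmc
  have hcd : c.MDifferentiable 𝓘(ℝ, E) 𝓘(ℝ, E) := mdifferentiable_chart m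
  have hgs : ContDiffOn ℝ ∞ (g ∘ c.symm) c.target :=
    contMDiffOn_iff_contDiffOn.1 (hg.comp_contMDiffOn hct)
  have hgd : HasFDerivAt (g ∘ c.symm) (fderiv ℝ (g ∘ c.symm) x₀) x₀ :=
    ((hgs.contDiffAt (c.open_target.mem_nhds hx₀t)).differentiableAt (by simp)).hasFDerivAt
  set γ := fderiv ℝ (g ∘ c.symm) x₀ with hγ
  have hγs : Function.Surjective γ := by
    have h1 : γ = (mfderiv 𝓘(ℝ, E) 𝓘(ℝ, V) g (c.symm x₀)).comp
        (mfderiv 𝓘(ℝ, E) 𝓘(ℝ, E) c.symm x₀) := by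
      rw [hγ, ← mfderiv_eq_fderiv]
      exact mfderiv_comp x₀ (hg.mdifferentiable (by simp) _) (hcd.mdifferentiableAt_symm hx₀t)
    rw [h1]
    rw [← hcx₀] at hreg
    exact hreg.comp (hcd.symm.mfderiv_surjective hx₀t)
  set d := Module.finrank ℝ (LinearMap.ker (γ : E →ₗ[ℝ] V)) with hd
  obtain ⟨p, hp⟩ := Submodule.ClosedComplemented.of_finiteDimensional_quotient
    (p := LinearMap.ker (γ : E →ₗ[ℝ] V)) (Submodule.closed_of_finiteDimensional _)
  -- A projection onto the kernel of dg, read in ℝ^d, completes g to a local coordinate system.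
  let ℓ : LinearMap.ker (γ : E →ₗ[ℝ] V) ≃L[ℝ] EuclideanSpace ℝ (Fin d) :=
    ContinuousLinearEquiv.ofFinrankEq (by simp [hd])
  set χ₀ : E → EuclideanSpace ℝ (Fin d) × V := fun x => (ℓ (p (x - x₀)), (g ∘ c.symm) x) with hχ₀
  have hχs : ContDiffOn ℝ ∞ χ₀ c.target :=
    ContDiffOn.prodMk (by fun_prop) hgs
  have hχd : HasFDerivAt χ₀ (((ℓ : _ →L[ℝ] _).comp p).prod γ) x₀ := by
    refine HasFDerivAt.prodMk ?_ hgd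
    exact ((ℓ : _ →L[ℝ] EuclideanSpace ℝ (Fin d)).comp p).hasFDerivAt.comp x₀
      ((hasFDerivAt_id x₀).sub_const x₀)
  obtain ⟨χ', hχ'⟩ := exists_continuousLinearEquiv_of_injective
    (((ℓ : _ →L[ℝ] EuclideanSpace ℝ (Fin d)).comp p).prod γ)
    ((injective_iff_map_eq_zero _).2 fun v hv => by
      have h1 : ℓ (p v) = 0 := congrArg Prod.fst hv
      have h2 : γ v = 0 := congrArg Prod.snd hv
      have h3 : p v = ⟨v, h2⟩ := hp ⟨v, h2⟩
      rw [h3] at h1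
      exact congrArg Subtype.val (ℓ.injective (h1.trans (map_zero ℓ).symm)))
    (by
      have h1 := LinearMap.finrank_range_add_finrank_ker (γ : E →ₗ[ℝ] V)
      have h2 : LinearMap.range (γ : E →ₗ[ℝ] V) = ⊤ := LinearMap.range_eq_top.2 hγs
      rw [h2, finrank_top] at h1
      rw [Module.finrank_prod, finrank_euclideanSpace_fin]
      omega)
  have : CompleteSpace E := FiniteDimensional.complete ℝ E
  obtain ⟨χ, hχ, hx₀χ, hχc, hχs, hχsymm, -⟩ := exists_openPartialHomeomorph_contDiffOn
    (c.open_target.mem_nhds hx₀t) hχs (hχ' ▸ hχd)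
  have hsymmt : ∀ z ∈ (c.trans χ).target, z ∈ χ.target ∧ χ.symm z ∈ c.target := fun z hz => by
    simpa only [OpenPartialHomeomorph.trans_target, mem_inter_iff, mem_preimage] using hz
  have hsrc : ∀ y ∈ (c.trans χ).source, y ∈ c.source ∧ c y ∈ χ.source := fun y hy => by
    simpa only [OpenPartialHomeomorph.trans_source, mem_inter_iff, mem_preimage] using hy
  have hχd : ∀ z ∈ χ.target, DifferentiableAt ℝ χ.symm z := fun z hz =>
    (hχsymm.contDiffAt (χ.open_target.mem_nhds hz)).differentiableAt (by simp)
  have hform : ∀ z ∈ (c.trans χ).target, formIn Ω (c.trans χ).symm z =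
      toBilin ((chartForm Ω.form m (χ.symm z)).compContinuousLinearMap (fderiv ℝ χ.symm z)) := by
    intro z hz
    have h1 : mfderiv 𝓘(ℝ, EuclideanSpace ℝ (Fin d) × V) 𝓘(ℝ, E) (c.trans χ).symm z =
        (mfderiv 𝓘(ℝ, E) 𝓘(ℝ, E) c.symm (χ.symm z)).comp (fderiv ℝ χ.symm z) := by
      refine (mfderiv_comp z (hcd.mdifferentiableAt_symm (hsymmt z hz).2)
        (hχd z (hsymmt z hz).1).mdifferentiableAt).trans ?_
      rw [mfderiv_eq_fderiv]
      rfl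
    refine ContinuousLinearMap.ext fun u => ContinuousLinearMap.ext fun v => ?_
    rw [formIn_apply, h1, toBilin_apply, ContinuousAlternatingMap.compContinuousLinearMap_apply]
    refine congrArg (Ω.form (c.symm (χ.symm z))) ?_
    funext i
    fin_cases i <;> rfl
  have htc : (extChartAt 𝓘(ℝ, E) m).target = c.target := by simp [hc, mfld_simps]
  have hcf : ∀ y ∈ c.target, ContDiffAt ℝ ∞ (chartForm Ω.form m) y := fun y hy =>
    (Ω.smooth m).contDiffAt (by rw [htc]; exact c.open_target.mem_nhds hy)
  have hev : ∀ z ∈ (c.trans χ).target, formIn Ω (c.trans χ).symm =ᶠ[𝓝 z] fun z =>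
      toBilin ((chartForm Ω.form m (χ.symm z)).compContinuousLinearMap (fderiv ℝ χ.symm z)) :=
    fun z hz => by
      filter_upwards [(c.trans χ).open_target.mem_nhds hz] with y hy using hform y hy
  refine ⟨d, c.trans χ, ?_, ?_, fun y hy => ?_, ?_, ?_, fun z hz => ?_, fun z hz a b e => ?_⟩
  · rw [OpenPartialHomeomorph.trans_source]
    exact ⟨hmc, hx₀χ⟩
  · rw [OpenPartialHomeomorph.trans_apply, hχ, hχ₀]
    refine Prod.ext (by simp [hx₀]) ?_
    change g (c.symm x₀) = 0
    rw [hcx₀]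
    exact hm
  · rw [OpenPartialHomeomorph.trans_apply, hχ]
    change g (c.symm (c y)) = g y
    rw [c.left_inv (hsrc y hy).1]
  · exact (contMDiffOn_iff_contDiffOn.2 hχs).comp (hcs.mono fun y hy => (hsrc y hy).1)
      fun y hy => (hsrc y hy).2
  · exact hct.comp ((contMDiffOn_iff_contDiffOn.2 hχsymm).mono fun z hz => (hsymmt z hz).1)
      fun z hz => (hsymmt z hz).2
  · refine ContDiffAt.contDiffWithinAt (ContDiffAt.congr_of_eventuallyEq ?_ (hev z hz))
    have h1 : ContDiffAt ℝ ∞ χ.symm z :=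
      hχsymm.contDiffAt (χ.open_target.mem_nhds (hsymmt z hz).1)
    exact contDiffAt_toBilin_pullback (hcf _ (hsymmt z hz).2) h1
  · have h1 : ContDiffAt ℝ ∞ χ.symm z :=
      hχsymm.contDiffAt (χ.open_target.mem_nhds (hsymmt z hz).1)
    have h2 : ContDiffAt ℝ ∞ (fderiv ℝ χ.symm) z := h1.fderiv_right (by simp)
    have h3 := (hcf _ (hsymmt z hz).2).differentiableAt (by simp)
    rw [(hev z hz).fderiv_eq]
    refine cyclic_sum_fderiv_of_extDeriv_eq_zero
      (w := fun z => (chartForm Ω.form m (χ.symm z)).compContinuousLinearMap (fderiv ℝ χ.symm z))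
      ((h3.comp z (h1.differentiableAt
        (by simp))).continuousAlternatingMapCompContinuousLinearMap
        (h2.differentiableAt (by simp))) ?_ a b e
    rw [extDeriv_pullback (r := 2) h3 (contDiffAt_infty.1 h1 2) (by simp),
      Ω.closed m _ (by rw [htc]; exact (hsymmt z hz).2)]
    rfl

end StraightChart

end ConstrainedHamiltonian

end

noncomputable section

namespace ConstrainedHamiltonian

/-! ### Coordinates on M adapted to the leaves. -/

section LeafCoordinates

variable {K V : Type*} [NormedAddCommGroup K] [NormedSpace ℝ K]
  [NormedAddCommGroup V] [NormedSpace ℝ V]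

/-- The restriction of a bilinear form on `K × V` to `K`. -/
def restrictFst (K V : Type*) [NormedAddCommGroup K] [NormedSpace ℝ K]
    [NormedAddCommGroup V] [NormedSpace ℝ V] :
    (K × V →L[ℝ] K × V →L[ℝ] ℝ) →L[ℝ] K →L[ℝ] K →L[ℝ] ℝ :=
  (ContinuousLinearMap.compL ℝ K (K × V →L[ℝ] ℝ) (K →L[ℝ] ℝ)
      ((ContinuousLinearMap.compL ℝ K (K × V) ℝ).flip (ContinuousLinearMap.inl ℝ K V))).comp
    ((ContinuousLinearMap.compL ℝ K (K × V) (K × V →L[ℝ] ℝ)).flip (ContinuousLinearMap.inl ℝ K V))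

@[simp] theorem restrictFst_apply (b : K × V →L[ℝ] K × V →L[ℝ] ℝ) (u v : K) :
    restrictFst K V b u v = b (u, 0) (v, 0) := rfl

theorem finrank_continuousDual (V : Type*) [NormedAddCommGroup V] [NormedSpace ℝ V]
    [FiniteDimensional ℝ V] : Module.finrank ℝ (V →L[ℝ] ℝ) = Module.finrank ℝ V :=
  (LinearEquiv.finrank_eq (LinearMap.toContinuousLinearMap (𝕜 := ℝ) (E := V) (F' := ℝ))).symm.trans
    Subspace.dual_finrank_eq

variable [FiniteDimensional ℝ K] [FiniteDimensional ℝ V]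

/-- The vector fields spanning the kernel of the restriction of `B` to `K × {0}`. -/
def leafField (B : K × V → K × V →L[ℝ] K × V →L[ℝ] ℝ)
    (e : EuclideanSpace ℝ (Fin (Module.finrank ℝ V)) ≃L[ℝ] (V →L[ℝ] ℝ)) (x : K) :
    EuclideanSpace ℝ (Fin (Module.finrank ℝ V)) →L[ℝ] K :=
  (ContinuousLinearMap.fst ℝ K V).comp ((B (x, 0)).inverse.comp
    ((((ContinuousLinearMap.compL ℝ (K × V) V ℝ).flip (ContinuousLinearMap.snd ℝ K V))).comp
      (e : EuclideanSpace ℝ (Fin (Module.finrank ℝ V)) →L[ℝ] V →L[ℝ] ℝ)))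

/-- Coordinates on `K = K × {0}` in which the kernel of the restriction to `K` of the closed
nondegenerate form `B` on `K × V` is the tangent space of the second factor. -/
theorem exists_leaf_coordinates {B : K × V → K × V →L[ℝ] K × V →L[ℝ] ℝ} {Q : Set (K × V)}
    (hQ : IsOpen Q) (h0 : (0 : K × V) ∈ Q) (hB : ContDiffOn ℝ ∞ B Q)
    (hskew : ∀ z ∈ Q, ∀ u v, B z u v = -B z v u)
    (hclosed : ∀ z ∈ Q, ∀ a b c,
      fderiv ℝ B z a b c + fderiv ℝ B z b c a + fderiv ℝ B z c a b = 0)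
    (hnondeg : ∀ z ∈ Q, ∀ u, (∀ v, B z u v = 0) → u = 0)
    (hcois : ∀ x : K, (x, (0 : V)) ∈ Q → ∀ u, (∀ k : K, B (x, 0) u (k, 0) = 0) → u.2 = 0) :
    ∃ (n : ℕ) (β : OpenPartialHomeomorph K
        (EuclideanSpace ℝ (Fin n) × EuclideanSpace ℝ (Fin (Module.finrank ℝ V)))),
      0 ∈ β.source ∧ (∀ x ∈ β.source, (x, (0 : V)) ∈ Q) ∧ β 0 = 0 ∧
      ContDiffOn ℝ ∞ β β.source ∧ ContDiffOn ℝ ∞ β.symm β.target ∧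
      ∀ x ∈ β.source, ∀ w, (fderiv ℝ β x w).1 = 0 ↔ ∀ k : K, B (x, 0) (w, 0) (k, 0) = 0 := by
  obtain ⟨e⟩ : Nonempty (EuclideanSpace ℝ (Fin (Module.finrank ℝ V)) ≃L[ℝ] (V →L[ℝ] ℝ)) :=
    ⟨ContinuousLinearEquiv.ofFinrankEq (by simp [finrank_continuousDual])⟩
  set U : Set K := {x | (x, (0 : V)) ∈ Q} with hUdef
  have hU : IsOpen U := hQ.preimage (by fun_prop)
  have hinc : ContDiff ℝ ∞ (fun x : K => (x, (0 : V))) := by fun_prop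
  have hBU : ContDiffOn ℝ ∞ (fun x : K => B (x, 0)) U := hB.comp hinc.contDiffOn fun x hx => hx
  have hA : ∀ z ∈ Q, ∃ A : (K × V) ≃L[ℝ] (K × V →L[ℝ] ℝ), (A : _ →L[ℝ] _) = B z := fun z hz =>
    exists_continuousLinearEquiv_of_injective (B z)
      ((injective_iff_map_eq_zero _).2 fun u hu => hnondeg z hz u fun v => by rw [hu]; rfl)
      (finrank_continuousDual _).symm
  set X := leafField B e with hXdef
  have hXs : ContDiffOn ℝ ∞ X U := fun x hx => by
    obtain ⟨A, hA⟩ := hA (x, 0) hx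
    have h1 : ContDiffAt ℝ ∞ (fun x : K => B (x, 0)) x := hBU.contDiffAt (hU.mem_nhds hx)
    have : CompleteSpace (K × V) := FiniteDimensional.complete ℝ _
    have h2 : ContDiffAt ℝ ∞ (fun x : K => (B (x, 0)).inverse) x :=
      ContDiffAt.comp x (g := ContinuousLinearMap.inverse)
        (by rw [← hA]; exact contDiffAt_map_inverse A) h1
    exact (contDiffAt_const.clm_comp (h2.clm_comp contDiffAt_const)).contDiffWithinAt
  -- the defining property of the fields
  have hX : ∀ x ∈ U, ∀ s, ∀ v, B (x, 0) (X x s, 0) v = e s v.2 := by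
    intro x hx s v
    obtain ⟨A, hA⟩ := hA (x, 0) hx
    set u : K × V := (B (x, 0)).inverse ((e s).comp (ContinuousLinearMap.snd ℝ K V)) with hu
    have h1 : B (x, 0) u = (e s).comp (ContinuousLinearMap.snd ℝ K V) := by
      rw [hu, ← hA, ContinuousLinearMap.inverse_equiv]
      exact A.apply_symm_apply _
    -- The covector e(s) ∘ snd vanishes on K × {0}, so `u` is orthogonal to K × {0}. Coisotropy then
    -- puts `u` in K × {0}, and the projection in `leafField` loses nothing.
    have h2 : u.2 = 0 := hcois x hx u fun k => by rw [h1]; simp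
    have h3 : (X x s, (0 : V)) = u := Prod.ext rfl h2.symm
    rw [h3, h1]
    rfl
  have hXinj : ∀ x ∈ U, Function.Injective (X x) := fun x hx =>
    (injective_iff_map_eq_zero _).2 fun s hs => by
      refine e.injective (ContinuousLinearMap.ext fun v => ?_)
      have h1 := hX x hx s (0, v)
      rw [hs] at h1
      rw [map_zero, ← h1, Prod.mk_zero_zero, map_zero]
      rfl
  have hker : ∀ x ∈ U, ∀ w, restrictFst K V (B (x, 0)) w = 0 ↔ ∃ s, X x s = w := by
    intro x hx w
    constructor
    · intro h
      -- For `w` in the kernel, B(w, ·) vanishes on K × {0} and is therefore determined by its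
      -- restriction to V, which selects `s`.
      refine ⟨e.symm ((B (x, 0) (w, 0)).comp (ContinuousLinearMap.inr ℝ K V)), ?_⟩
      set s := e.symm ((B (x, 0) (w, 0)).comp (ContinuousLinearMap.inr ℝ K V)) with hs
      have h1 : ((X x s - w, 0) : K × V) = 0 := hnondeg (x, 0) hx _ fun v => by
        have h2 : ((X x s - w, 0) : K × V) = (X x s, 0) - (w, 0) := by simp
        have h3 : B (x, 0) (w, 0) (v.1, 0) = 0 := DFunLike.congr_fun h v.1
        have h4 : v = (v.1, 0) + (0, v.2) := by simp
        rw [h2, map_sub, sub_apply, hX x hx, hs, e.apply_symm_apply, sub_eq_zero]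
        conv_rhs => rw [h4, map_add, h3, zero_add]
        rfl
      exact sub_eq_zero.1 (congrArg Prod.fst h1)
    · rintro ⟨s, rfl⟩
      ext k
      rw [restrictFst_apply, hX x hx]
      simp
  have hνs : ContDiffOn ℝ ∞ (fun x : K => restrictFst K V (B (x, 0))) U :=
    (show ContDiff ℝ ∞ (fun b => restrictFst K V b) by fun_prop).comp_contDiffOn hBU
  have hνd : ∀ x ∈ U, ∀ a b c : K, fderiv ℝ (fun x : K => restrictFst K V (B (x, 0))) x a b c =
      fderiv ℝ B (x, 0) (a, 0) (b, 0) (c, 0) := by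
    intro x hx a b c
    have h1 : HasFDerivAt B (fderiv ℝ B (x, 0)) (x, 0) :=
      ((hB.contDiffAt (hQ.mem_nhds hx)).differentiableAt (by simp)).hasFDerivAt
    have h2 : HasFDerivAt (fun x : K => (x, (0 : V))) (ContinuousLinearMap.inl ℝ K V) x :=
      (hasFDerivAt_id x).prodMk (hasFDerivAt_const _ x)
    have h3 : HasFDerivAt (fun x : K => B (x, 0)) _ x :=
      HasFDerivAt.comp (g := B) (f := fun x : K => (x, (0 : V))) x h1 h2
    have h4 : HasFDerivAt (fun b => restrictFst K V b) (restrictFst K V) (B (x, 0)) :=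
      ContinuousLinearMap.hasFDerivAt (E := K × V →L[ℝ] K × V →L[ℝ] ℝ)
        (F := K →L[ℝ] K →L[ℝ] ℝ) (restrictFst K V)
    have h5 := HasFDerivAt.comp (g := fun b => restrictFst K V b) (f := fun x : K => B (x, 0))
      x h4 h3
    have h6 : fderiv ℝ (fun x : K => restrictFst K V (B (x, 0))) x = _ := h5.fderiv
    rw [h6]
    rfl
  obtain ⟨n, β, h0β, hβU, hβ0, hβs, hβsymm, hβ⟩ := exists_straightening
    (ν := fun x : K => restrictFst K V (B (x, 0))) (X := X) hU h0 hνs hXs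
    (fun x hx a b => hskew _ hx _ _)
    (fun x hx a b c => by
      rw [hνd x hx, hνd x hx, hνd x hx]
      exact hclosed _ hx _ _ _) hker hXinj
  refine ⟨n, β, h0β, hβU, hβ0, hβs, hβsymm, fun x hx w => (hβ x hx w).trans ⟨fun h k => ?_,
    fun h => ContinuousLinearMap.ext fun k => h k⟩⟩
  exact DFunLike.congr_fun h k

end LeafCoordinates

end ConstrainedHamiltonian

end

noncomputable section

namespace ConstrainedHamiltonian

/-! ### Tangent spaces, ker ν and X_H read in a straight chart. -/

section StraightChartLemmas

variable {E V P : Type*} [NormedAddCommGroup E] [NormedSpace ℝ E]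
  [NormedAddCommGroup V] [NormedSpace ℝ V] [TopologicalSpace P] [ChartedSpace E P]

namespace IsStraightChart

variable {Ω : SymplecticForm E P} {g : P → V} {d : ℕ}
  {ξ : OpenPartialHomeomorph P (EuclideanSpace ℝ (Fin d) × V)}

theorem mdifferentiable (hξ : IsStraightChart Ω g ξ) :
    ξ.MDifferentiable 𝓘(ℝ, E) 𝓘(ℝ, EuclideanSpace ℝ (Fin d) × V) :=
  ⟨hξ.smooth.mdifferentiableOn (by simp), hξ.smooth_symm.mdifferentiableOn (by simp)⟩

theorem apply_symm_eq (hξ : IsStraightChart Ω g ξ) {z : EuclideanSpace ℝ (Fin d) × V}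
    (hz : z ∈ ξ.target) : g (ξ.symm z) = z.2 := by
  rw [← hξ.snd_eq _ (ξ.map_target hz), ξ.right_inv hz]

theorem mfderiv_apply (hξ : IsStraightChart Ω g ξ) (hg : ContMDiff 𝓘(ℝ, E) 𝓘(ℝ, V) ∞ g)
    {z : EuclideanSpace ℝ (Fin d) × V} (hz : z ∈ ξ.target)
    (u : EuclideanSpace ℝ (Fin d) × V) :
    mfderiv 𝓘(ℝ, E) 𝓘(ℝ, V) g (ξ.symm z)
      (mfderiv 𝓘(ℝ, EuclideanSpace ℝ (Fin d) × V) 𝓘(ℝ, E) ξ.symm z u) = u.2 := by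
  have h1 := mfderiv_comp z (hg.mdifferentiable (by simp) (ξ.symm z))
    (hξ.mdifferentiable.mdifferentiableAt_symm hz)
  have h2 : g ∘ ξ.symm =ᶠ[𝓝 z] Prod.snd := by
    filter_upwards [ξ.open_target.mem_nhds hz] with y hy using hξ.apply_symm_eq hy
  have h3 : mfderiv 𝓘(ℝ, EuclideanSpace ℝ (Fin d) × V) 𝓘(ℝ, V) (g ∘ ξ.symm) z =
      ContinuousLinearMap.snd ℝ (EuclideanSpace ℝ (Fin d)) V := by
    rw [mfderiv_eq_fderiv, h2.fderiv_eq]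
    exact fderiv_snd
  rw [h3] at h1
  exact (DFunLike.congr_fun h1 u).symm

theorem exists_eq_mfderiv_symm (hξ : IsStraightChart Ω g ξ)
    {z : EuclideanSpace ℝ (Fin d) × V} (hz : z ∈ ξ.target)
    (u : TangentSpace 𝓘(ℝ, E) (ξ.symm z)) : ∃ u' : EuclideanSpace ℝ (Fin d) × V,
      mfderiv 𝓘(ℝ, EuclideanSpace ℝ (Fin d) × V) 𝓘(ℝ, E) ξ.symm z u' = u :=
  hξ.mdifferentiable.symm.mfderiv_surjective hz u

theorem mem_tangentM_iff (hξ : IsStraightChart Ω g ξ) (hg : ContMDiff 𝓘(ℝ, E) 𝓘(ℝ, V) ∞ g)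
    {z : EuclideanSpace ℝ (Fin d) × V} (hz : z ∈ ξ.target)
    (u : EuclideanSpace ℝ (Fin d) × V) :
    mfderiv 𝓘(ℝ, EuclideanSpace ℝ (Fin d) × V) 𝓘(ℝ, E) ξ.symm z u ∈ tangentM E g (ξ.symm z) ↔
      u.2 = 0 := by
  rw [← hξ.mfderiv_apply hg hz u]
  rfl

theorem formIn_skew (z u v : EuclideanSpace ℝ (Fin d) × V) :
    formIn Ω ξ.symm z u v = -formIn Ω ξ.symm z v u :=
  toBilin_skew _ u v

theorem formIn_nondegenerate (hξ : IsStraightChart Ω g ξ)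
    {z : EuclideanSpace ℝ (Fin d) × V} (hz : z ∈ ξ.target) (u : EuclideanSpace ℝ (Fin d) × V)
    (h : ∀ v, formIn Ω ξ.symm z u v = 0) : u = 0 := by
  have h1 : mfderiv 𝓘(ℝ, EuclideanSpace ℝ (Fin d) × V) 𝓘(ℝ, E) ξ.symm z u = 0 :=
    Ω.nondegenerate _ _ fun v => by
      obtain ⟨v', rfl⟩ := hξ.exists_eq_mfderiv_symm hz v
      rw [← formIn_apply]
      exact h v'
  exact hξ.mdifferentiable.symm.mfderiv_injective hz (h1.trans (map_zero _).symm)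

theorem formIn_fst_eq_zero_iff (hξ : IsStraightChart Ω g ξ) (hg : ContMDiff 𝓘(ℝ, E) 𝓘(ℝ, V) ∞ g)
    {z : EuclideanSpace ℝ (Fin d) × V} (hz : z ∈ ξ.target) (u : EuclideanSpace ℝ (Fin d) × V) :
    (∀ k, formIn Ω ξ.symm z u (k, 0) = 0) ↔ ∀ v ∈ tangentM E g (ξ.symm z),
      Ω.form (ξ.symm z)
        ![mfderiv 𝓘(ℝ, EuclideanSpace ℝ (Fin d) × V) 𝓘(ℝ, E) ξ.symm z u, v] = 0 := by
  constructor
  · intro h v hv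
    obtain ⟨v', rfl⟩ := hξ.exists_eq_mfderiv_symm hz v
    rw [← formIn_apply, show v' = (v'.1, 0) from Prod.ext rfl ((hξ.mem_tangentM_iff hg hz v').1 hv)]
    exact h _
  · intro h k
    rw [formIn_apply]
    exact h _ ((hξ.mem_tangentM_iff hg hz _).2 rfl)

theorem formIn_coisotropic (hξ : IsStraightChart Ω g ξ) (hg : ContMDiff 𝓘(ℝ, E) 𝓘(ℝ, V) ∞ g)
    (hcois : IsCoisotropic Ω g) {x : EuclideanSpace ℝ (Fin d)} (hx : (x, (0 : V)) ∈ ξ.target)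
    (u : EuclideanSpace ℝ (Fin d) × V) (h : ∀ k, formIn Ω ξ.symm (x, 0) u (k, 0) = 0) :
    u.2 = 0 :=
  (hξ.mem_tangentM_iff hg hx u).1 (hcois _ (hξ.apply_symm_eq hx) _
    ((hξ.formIn_fst_eq_zero_iff hg hx u).1 h))

theorem mem_kerForm_iff (hξ : IsStraightChart Ω g ξ) (hg : ContMDiff 𝓘(ℝ, E) 𝓘(ℝ, V) ∞ g)
    {z : EuclideanSpace ℝ (Fin d) × V} (hz : z ∈ ξ.target) (u : EuclideanSpace ℝ (Fin d) × V) :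
    mfderiv 𝓘(ℝ, EuclideanSpace ℝ (Fin d) × V) 𝓘(ℝ, E) ξ.symm z u ∈ kerForm Ω g (ξ.symm z) ↔
      u.2 = 0 ∧ ∀ k, formIn Ω ξ.symm z u (k, 0) = 0 :=
  and_congr (hξ.mem_tangentM_iff hg hz u) (hξ.formIn_fst_eq_zero_iff hg hz u).symm

theorem exists_equiv [FiniteDimensional ℝ V] (hξ : IsStraightChart Ω g ξ)
    {z : EuclideanSpace ℝ (Fin d) × V} (hz : z ∈ ξ.target) :
    ∃ A : (EuclideanSpace ℝ (Fin d) × V) ≃L[ℝ] (EuclideanSpace ℝ (Fin d) × V →L[ℝ] ℝ),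
      (A : _ →L[ℝ] _) = formIn Ω ξ.symm z :=
  exists_continuousLinearEquiv_of_injective _
    ((injective_iff_map_eq_zero _).2 fun u hu => hξ.formIn_nondegenerate hz u fun v => by
      rw [hu]; rfl) (finrank_continuousDual _).symm

theorem contDiffOn_comp_symm (hξ : IsStraightChart Ω g ξ) {H : P → ℝ}
    (hH : ContMDiff 𝓘(ℝ, E) 𝓘(ℝ, ℝ) ∞ H) : ContDiffOn ℝ ∞ (H ∘ ξ.symm) ξ.target :=
  contMDiffOn_iff_contDiffOn.1 (hH.comp_contMDiffOn hξ.smooth_symm)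

end IsStraightChart

end StraightChartLemmas

section HamiltonianField

variable {E V P : Type*} [NormedAddCommGroup E] [NormedSpace ℝ E]
  [NormedAddCommGroup V] [NormedSpace ℝ V] [TopologicalSpace P] [ChartedSpace E P]

variable [FiniteDimensional ℝ V] {Ω : SymplecticForm E P} {g : P → V} {d : ℕ}
  {ξ : OpenPartialHomeomorph P (EuclideanSpace ℝ (Fin d) × V)}

/-- The Hamiltonian vector field in the coordinates `ξ`. -/
def hamiltonianFieldIn (Ω : SymplecticForm E P)
    (ξ : OpenPartialHomeomorph P (EuclideanSpace ℝ (Fin d) × V)) (H : P → ℝ)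
    (z : EuclideanSpace ℝ (Fin d) × V) : EuclideanSpace ℝ (Fin d) × V :=
  (formIn Ω ξ.symm z).inverse (fderiv ℝ (H ∘ ξ.symm) z)

theorem IsStraightChart.formIn_hamiltonianFieldIn (hξ : IsStraightChart Ω g ξ) (H : P → ℝ)
    {z : EuclideanSpace ℝ (Fin d) × V} (hz : z ∈ ξ.target) :
    formIn Ω ξ.symm z (hamiltonianFieldIn Ω ξ H z) = fderiv ℝ (H ∘ ξ.symm) z := by
  obtain ⟨A, hA⟩ := hξ.exists_equiv hz
  rw [hamiltonianFieldIn, ← hA, ContinuousLinearMap.inverse_equiv]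
  exact A.apply_symm_apply _

theorem IsStraightChart.contDiffOn_hamiltonianFieldIn (hξ : IsStraightChart Ω g ξ) {H : P → ℝ}
    (hH : ContMDiff 𝓘(ℝ, E) 𝓘(ℝ, ℝ) ∞ H) :
    ContDiffOn ℝ ∞ (hamiltonianFieldIn Ω ξ H) ξ.target := by
  intro z hz
  obtain ⟨A, hA⟩ := hξ.exists_equiv hz
  have h1 : ContDiffAt ℝ ∞ (formIn Ω ξ.symm) z :=
    hξ.form_smooth.contDiffAt (ξ.open_target.mem_nhds hz)
  have : CompleteSpace (EuclideanSpace ℝ (Fin d) × V) := FiniteDimensional.complete ℝ _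
  have h2 : ContDiffAt ℝ ∞ (fun z => (formIn Ω ξ.symm z).inverse) z :=
    ContDiffAt.comp z (g := ContinuousLinearMap.inverse)
      (by rw [← hA]; exact contDiffAt_map_inverse A) h1
  have h3 : ContDiffAt ℝ ∞ (fderiv ℝ (H ∘ ξ.symm)) z :=
    ((hξ.contDiffOn_comp_symm hH).contDiffAt (ξ.open_target.mem_nhds hz)).fderiv_right (by simp)
  exact (h2.clm_apply h3).contDiffWithinAt

end HamiltonianField

section HiddenFun

variable {E V P : Type*} [NormedAddCommGroup E] [NormedSpace ℝ E] [FiniteDimensional ℝ E]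
  [NormedAddCommGroup V] [NormedSpace ℝ V] [TopologicalSpace P] [ChartedSpace E P]

/-- The function `dg(X_H)`, whose zeros on the constraint manifold form the hidden constraint
set. -/
def hiddenFun (Ω : SymplecticForm E P) (g : P → V) (H : P → ℝ) (y : P) : V :=
  mfderiv 𝓘(ℝ, E) 𝓘(ℝ, V) g y (hamiltonianVectorField Ω H y)

/-- If dH = ν(Y, ·) on T_zM, then X_H − Y is orthogonal to T_zM, hence tangent to M by coisotropy;
as Y is tangent too, so is X_H. Conversely, a tangent X_H serves as Y. -/
theorem mem_hiddenSet_iff {Ω : SymplecticForm E P} {g : P → V} {H : P → ℝ}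
    (hcois : IsCoisotropic Ω g) {z : P} :
    z ∈ hiddenSet Ω g H ↔ z ∈ constraintSet g ∧ hiddenFun Ω g H z = 0 := by
  constructor
  · rintro ⟨hz, Y, hY, h⟩
    refine ⟨hz, ?_⟩
    have h1 : hamiltonianVectorField Ω H z - Y ∈ tangentM E g z :=
      hcois z hz _ fun v hv => by
        rw [← Ω.bilin_apply, map_sub, LinearMap.sub_apply, Ω.bilin_apply, Ω.bilin_apply,
          form_hamiltonianVectorField, h v hv, sub_self]
    have h2 := add_mem h1 hY
    rw [sub_add_cancel] at h2
    exact h2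
  · rintro ⟨hz, h⟩
    exact ⟨hz, _, h, fun v _ => (form_hamiltonianVectorField Ω H z v).symm⟩

variable [FiniteDimensional ℝ V] {Ω : SymplecticForm E P} {g : P → V} {d : ℕ}
  {ξ : OpenPartialHomeomorph P (EuclideanSpace ℝ (Fin d) × V)}

theorem IsStraightChart.hiddenFun_symm (hξ : IsStraightChart Ω g ξ)
    (hg : ContMDiff 𝓘(ℝ, E) 𝓘(ℝ, V) ∞ g) {H : P → ℝ} (hH : ContMDiff 𝓘(ℝ, E) 𝓘(ℝ, ℝ) ∞ H)
    {z : EuclideanSpace ℝ (Fin d) × V} (hz : z ∈ ξ.target) :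
    hiddenFun Ω g H (ξ.symm z) = (hamiltonianFieldIn Ω ξ H z).2 := by
  obtain ⟨X, hX⟩ := hξ.exists_eq_mfderiv_symm hz (hamiltonianVectorField Ω H (ξ.symm z))
  have h1 : X = hamiltonianFieldIn Ω ξ H z := by
    rw [← sub_eq_zero]
    refine hξ.formIn_nondegenerate hz _ fun u => ?_
    rw [map_sub, sub_apply, sub_eq_zero, hξ.formIn_hamiltonianFieldIn H hz, formIn_apply, hX,
      form_hamiltonianVectorField]
    have h2 := mfderiv_comp z (hH.mdifferentiable (by simp) (ξ.symm z))
      (hξ.mdifferentiable.mdifferentiableAt_symm hz)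
    rw [mfderiv_eq_fderiv] at h2
    exact (DFunLike.congr_fun h2 u).symm
  rw [hiddenFun, ← hX, hξ.mfderiv_apply hg hz, h1]

end HiddenFun

end ConstrainedHamiltonian

end

noncomputable section

namespace ConstrainedHamiltonian

/-- At a zero of `a` the product rule leaves only the term with a'η. It is used to compute the
Hessian of H along a leaf at a critical point. -/
theorem fderiv_clm_apply_apply_eq_zero {X W : Type*} [NormedAddCommGroup X] [NormedSpace ℝ X]
    [NormedAddCommGroup W] [NormedSpace ℝ W] {B : X → W →L[ℝ] W →L[ℝ] ℝ} {a c : X → W} {x η : X}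
    {a' : X →L[ℝ] W} (hB : DifferentiableAt ℝ B x) (ha : HasFDerivAt a a' x)
    (hc : DifferentiableAt ℝ c x) (h0 : a x = 0) (h1 : a' η = 0) :
    fderiv ℝ (fun s => B s (a s) (c s)) x η = 0 := by
  have h := (hB.hasFDerivAt.clm_apply ha).clm_apply hc.hasFDerivAt
  rw [h.fderiv]
  simp [h0, h1]

/-! ### Leaf charts and the meaning of nondegeneracy. -/

section FlowBox

variable {E V P : Type*} [NormedAddCommGroup E] [NormedSpace ℝ E]
  [NormedAddCommGroup V] [NormedSpace ℝ V] [TopologicalSpace P] [ChartedSpace E P]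

variable {Ω : SymplecticForm E P} {g : P → V} {d n : ℕ}
  {ξ : OpenPartialHomeomorph P (EuclideanSpace ℝ (Fin d) × V)}
  {β : OpenPartialHomeomorph (EuclideanSpace ℝ (Fin d))
    (EuclideanSpace ℝ (Fin n) × EuclideanSpace ℝ (Fin (Module.finrank ℝ V)))}

/-- Coordinates `β` on the constraint manifold, in terms of a straight chart `ξ`, in which the
fibres are the level sets of the first factor. -/
structure IsLeafChart (Ω : SymplecticForm E P)
    (ξ : OpenPartialHomeomorph P (EuclideanSpace ℝ (Fin d) × V))
    (β : OpenPartialHomeomorph (EuclideanSpace ℝ (Fin d))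
      (EuclideanSpace ℝ (Fin n) × EuclideanSpace ℝ (Fin (Module.finrank ℝ V)))) : Prop where
  mem_source : 0 ∈ β.source
  mem_target : ∀ x ∈ β.source, (x, (0 : V)) ∈ ξ.target
  map_zero : β 0 = 0
  smooth : ContDiffOn ℝ ∞ β β.source
  smooth_symm : ContDiffOn ℝ ∞ β.symm β.target
  fst_eq_zero_iff : ∀ x ∈ β.source, ∀ w, (fderiv ℝ β x w).1 = 0 ↔
    ∀ k : EuclideanSpace ℝ (Fin d), formIn Ω ξ.symm (x, 0) (w, 0) (k, 0) = 0

theorem IsStraightChart.exists_isLeafChart [FiniteDimensional ℝ V] (hξ : IsStraightChart Ω g ξ)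
    (hg : ContMDiff 𝓘(ℝ, E) 𝓘(ℝ, V) ∞ g) (hcois : IsCoisotropic Ω g) (h0 : 0 ∈ ξ.target) :
    ∃ (n : ℕ) (β : OpenPartialHomeomorph (EuclideanSpace ℝ (Fin d))
      (EuclideanSpace ℝ (Fin n) × EuclideanSpace ℝ (Fin (Module.finrank ℝ V)))),
      IsLeafChart Ω ξ β := by
  obtain ⟨n, β, h1, h2, h3, h4, h5, h6⟩ := exists_leaf_coordinates ξ.open_target h0 hξ.form_smooth
    (fun z _ => IsStraightChart.formIn_skew z) hξ.form_closed
    (fun z hz u => hξ.formIn_nondegenerate hz u)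
    (fun x hx u => hξ.formIn_coisotropic hg hcois hx u)
  exact ⟨n, β, h1, h2, h3, h4, h5, h6⟩

namespace IsLeafChart

theorem hasFDerivAt (hβ : IsLeafChart Ω ξ β) {x} (hx : x ∈ β.source) :
    HasFDerivAt β (fderiv ℝ β x) x :=
  ((hβ.smooth.contDiffAt (β.open_source.mem_nhds hx)).differentiableAt (by simp)).hasFDerivAt

theorem hasFDerivAt_symm (hβ : IsLeafChart Ω ξ β) {q} (hq : q ∈ β.target) :
    HasFDerivAt β.symm (fderiv ℝ β.symm q) q :=
  ((hβ.smooth_symm.contDiffAt (β.open_target.mem_nhds hq)).differentiableAt (by simp)).hasFDerivAt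

theorem fderiv_fderiv_symm (hβ : IsLeafChart Ω ξ β) {q} (hq : q ∈ β.target) (w) :
    fderiv ℝ β (β.symm q) (fderiv ℝ β.symm q w) = w := by
  have h1 := HasFDerivAt.comp q (g := β) (f := β.symm) (hβ.hasFDerivAt (β.map_target hq))
    (hβ.hasFDerivAt_symm hq)
  have h2 : β ∘ β.symm =ᶠ[𝓝 q] id := by
    filter_upwards [β.open_target.mem_nhds hq] with y hy using β.right_inv hy
  exact DFunLike.congr_fun (h1.unique ((hasFDerivAt_id q).congr_of_eventuallyEq h2)) w

theorem fderiv_symm_fderiv (hβ : IsLeafChart Ω ξ β) {q} (hq : q ∈ β.target) (w) :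
    fderiv ℝ β.symm q (fderiv ℝ β (β.symm q) w) = w := by
  have hx := β.map_target hq
  have h0 : HasFDerivAt β.symm (fderiv ℝ β.symm q) (β (β.symm q)) := by
    rw [β.right_inv hq]; exact hβ.hasFDerivAt_symm hq
  have h1 := HasFDerivAt.comp (β.symm q) (g := β.symm) (f := β) h0 (hβ.hasFDerivAt hx)
  have h2 : β.symm ∘ β =ᶠ[𝓝 (β.symm q)] id := by
    filter_upwards [β.open_source.mem_nhds hx] with y hy using β.left_inv hy
  exact DFunLike.congr_fun (h1.unique ((hasFDerivAt_id _).congr_of_eventuallyEq h2)) w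

/-- This is the dimension count behind the flow box: n transverse directions and dim V directions
along the leaf make up dim M. -/
theorem finrank_eq (hβ : IsLeafChart Ω ξ β) : d = n + Module.finrank ℝ V := by
  have h0 : (0 : EuclideanSpace ℝ (Fin n) × EuclideanSpace ℝ (Fin (Module.finrank ℝ V))) ∈
      β.target := hβ.map_zero ▸ β.map_source hβ.mem_source
  let A := LinearEquiv.ofBijective (fderiv ℝ β.symm 0).toLinearMap
    ⟨fun a b (h : fderiv ℝ β.symm 0 a = fderiv ℝ β.symm 0 b) => by
      rw [← hβ.fderiv_fderiv_symm h0 a, h, hβ.fderiv_fderiv_symm h0 b], fun w => ⟨_, hβ.fderiv_symm_fderiv h0 w⟩⟩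
  have := A.finrank_eq
  simpa using this.symm

/-- The parametrisation of the fibre through the centre of the leaf chart. -/
theorem isFibreParametrization (hβ : IsLeafChart Ω ξ β) (hξ : IsStraightChart Ω g ξ)
    (hg : ContMDiff 𝓘(ℝ, E) 𝓘(ℝ, V) ∞ g) :
    IsFibreParametrization Ω g
      (fun s : EuclideanSpace ℝ (Fin (Module.finrank ℝ V)) =>
        ξ.symm (β.symm (0, s), (0 : V))) {s | (0, s) ∈ β.target} := by
  have hinc : ContDiff ℝ ∞ (fun s : EuclideanSpace ℝ (Fin (Module.finrank ℝ V)) =>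
    ((0 : EuclideanSpace ℝ (Fin n)), s)) := by fun_prop
  have hψ : ContDiffOn ℝ ∞ (fun s => (β.symm (0, s), (0 : V))) {s | (0, s) ∈ β.target} :=
    (hβ.smooth_symm.comp hinc.contDiffOn fun s hs => hs).prodMk contDiffOn_const
  have ht : ∀ s ∈ {s | (0, s) ∈ β.target}, (β.symm (0, s), (0 : V)) ∈ ξ.target := fun s hs =>
    hβ.mem_target _ (β.map_target hs)
  have hd : ∀ s ∈ {s | (0, s) ∈ β.target}, ∀ v,
      mfderiv 𝓘(ℝ, EuclideanSpace ℝ (Fin (Module.finrank ℝ V))) 𝓘(ℝ, E)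
        (fun s => ξ.symm (β.symm (0, s), (0 : V))) s v =
      mfderiv 𝓘(ℝ, EuclideanSpace ℝ (Fin d) × V) 𝓘(ℝ, E) ξ.symm (β.symm (0, s), (0 : V))
        (fderiv ℝ β.symm (0, s) (0, v), (0 : V)) := by
    intro s hs v
    have h1 : HasFDerivAt (fun s => (β.symm ((0 : EuclideanSpace ℝ (Fin n)), s), (0 : V)))
        (((fderiv ℝ β.symm (0, s)).comp (ContinuousLinearMap.inr ℝ _ _)).prod 0) s :=
      HasFDerivAt.prodMk ((hβ.hasFDerivAt_symm hs).comp s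
        ((hasFDerivAt_const _ s).prodMk (hasFDerivAt_id s))) (hasFDerivAt_const _ s)
    have h2 := mfderiv_comp (I' := 𝓘(ℝ, EuclideanSpace ℝ (Fin d) × V)) s
      (f := fun s => (β.symm ((0 : EuclideanSpace ℝ (Fin n)), s), (0 : V)))
      (hξ.mdifferentiable.mdifferentiableAt_symm (ht s hs))
      h1.differentiableAt.mdifferentiableAt
    rw [mfderiv_eq_fderiv, h1.fderiv] at h2
    exact DFunLike.congr_fun h2 v
  have hker : ∀ s ∈ {s | (0, s) ∈ β.target}, ∀ w : EuclideanSpace ℝ (Fin d),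
      (∀ k : EuclideanSpace ℝ (Fin d),
        formIn Ω ξ.symm (β.symm (0, s), 0) (w, 0) (k, 0) = 0) ↔
      ∃ v, fderiv ℝ β.symm (0, s) (0, v) = w := by
    intro s hs w
    rw [← hβ.fst_eq_zero_iff _ (β.map_target hs)]
    constructor
    · intro h
      refine ⟨(fderiv ℝ β (β.symm (0, s)) w).2, ?_⟩
      have h3 : (0, (fderiv ℝ β (β.symm (0, s)) w).2) = fderiv ℝ β (β.symm (0, s)) w :=
        Prod.ext h.symm rfl
      rw [h3]
      exact hβ.fderiv_symm_fderiv hs w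
    · rintro ⟨v, rfl⟩
      rw [hβ.fderiv_fderiv_symm hs]
  refine ⟨β.open_target.preimage (by fun_prop), hξ.smooth_symm.comp
    (contMDiffOn_iff_contDiffOn.2 hψ) ht, fun s hs => hξ.apply_symm_eq (ht s hs), fun s hs => ?_,
    fun s hs => ?_⟩
  · refine (injective_iff_map_eq_zero (mfderiv 𝓘(ℝ, EuclideanSpace ℝ (Fin (Module.finrank ℝ V)))
      𝓘(ℝ, E) (fun s => ξ.symm (β.symm (0, s), (0 : V))) s)).2 fun v hv => ?_
    rw [hd s hs] at hv
    have h1 := hξ.mdifferentiable.symm.mfderiv_injective (ht s hs) (hv.trans (_root_.map_zero _).symm)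
    have h2 : fderiv ℝ β.symm (0, s) (0, v) = 0 := congrArg Prod.fst h1
    have h3 := hβ.fderiv_fderiv_symm hs (0, v)
    rw [h2, _root_.map_zero] at h3
    exact (congrArg Prod.snd h3).symm
  · ext u
    obtain ⟨u', rfl⟩ := hξ.exists_eq_mfderiv_symm (ht s hs) u
    constructor
    · rintro ⟨v, hv⟩
      rw [← hv, hd s hs]
      exact (hξ.mem_kerForm_iff hg (ht s hs) _).2 ⟨rfl, (hker s hs _).2 ⟨v, rfl⟩⟩
    · intro h
      obtain ⟨h1, h2⟩ := (hξ.mem_kerForm_iff hg (ht s hs) _).1 h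
      have h3 : u' = (u'.1, 0) := Prod.ext rfl h1
      rw [h3] at h2 ⊢
      obtain ⟨v, hv⟩ := (hker s hs _).1 h2
      refine ⟨v, ?_⟩
      exact (hd s hs v).trans (by rw [hv])

/-- Nondegeneracy of the critical points of `H` along the fibres: the derivative of `dg(X_H)`
along the fibre is injective at a point of the hidden constraint set. -/
theorem eq_zero_of_fderiv_eq_zero [FiniteDimensional ℝ V] (hβ : IsLeafChart Ω ξ β) (hξ : IsStraightChart Ω g ξ)
    (hg : ContMDiff 𝓘(ℝ, E) 𝓘(ℝ, V) ∞ g) {H : P → ℝ} (hH : ContMDiff 𝓘(ℝ, E) 𝓘(ℝ, ℝ) ∞ H)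
    (hnondeg : IsNondegenerate Ω g H) (h0 : (hamiltonianFieldIn Ω ξ H 0).2 = 0)
    {w : EuclideanSpace ℝ (Fin d)} (hw : (fderiv ℝ β 0 w).1 = 0)
    (hw' : (fderiv ℝ (hamiltonianFieldIn Ω ξ H) 0 (w, 0)).2 = 0) : w = 0 := by
  set X := hamiltonianFieldIn Ω ξ H with hX
  set S : Set (EuclideanSpace ℝ (Fin (Module.finrank ℝ V))) := {s | (0, s) ∈ β.target} with hS
  set ψ : EuclideanSpace ℝ (Fin (Module.finrank ℝ V)) → EuclideanSpace ℝ (Fin d) × V :=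
    fun s => (β.symm (0, s), 0) with hψ
  -- Nondegeneracy is available only through parametrisations of leaves; the slice of the leaf chart
  -- through its centre provides one.
  have hpar := hβ.isFibreParametrization hξ hg
  have ht : ∀ s ∈ S, ψ s ∈ ξ.target := fun s hs => hβ.mem_target _ (β.map_target hs)
  have hβ0 : β.symm 0 = 0 := by
    rw [← hβ.map_zero, β.left_inv hβ.mem_source]
  have h0t : (0 : EuclideanSpace ℝ (Fin n) × EuclideanSpace ℝ (Fin (Module.finrank ℝ V))) ∈
      β.target := hβ.map_zero ▸ β.map_source hβ.mem_source
  have h0S : (0 : EuclideanSpace ℝ (Fin (Module.finrank ℝ V))) ∈ S := h0t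
  have hψ0 : ψ 0 = 0 := Prod.ext hβ0 rfl
  have hψs : ContDiffOn ℝ ∞ ψ S := by
    have hinc : ContDiff ℝ ∞ (fun s : EuclideanSpace ℝ (Fin (Module.finrank ℝ V)) =>
      ((0 : EuclideanSpace ℝ (Fin n)), s)) := by fun_prop
    exact (hβ.smooth_symm.comp hinc.contDiffOn fun s hs => hs).prodMk contDiffOn_const
  have hψd : ∀ s ∈ S, HasFDerivAt ψ
      (((fderiv ℝ β.symm (0, s)).comp (ContinuousLinearMap.inr ℝ _ _)).prod 0) s := fun s hs =>
    HasFDerivAt.prodMk ((hβ.hasFDerivAt_symm hs).comp s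
      ((hasFDerivAt_const _ s).prodMk (hasFDerivAt_id s))) (hasFDerivAt_const _ s)
  have hHs := hξ.contDiffOn_comp_symm hH
  have hXs : ContDiffOn ℝ ∞ X ξ.target := hξ.contDiffOn_hamiltonianFieldIn hH
  have hf : ContDiffOn ℝ ∞ ((H ∘ ξ.symm) ∘ ψ) S := hHs.comp hψs ht
  -- Along the leaf dH = Ω(X_H, ·). The part of X_H tangent to M pairs to zero with ker ν, so only
  -- the V-component of X_H, which is dg(X_H), remains.
  have hfd : ∀ s ∈ S, ∀ v, fderiv ℝ ((H ∘ ξ.symm) ∘ ψ) s v =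
      formIn Ω ξ.symm (ψ s) (0, (X (ψ s)).2) (fderiv ℝ β.symm (0, s) (0, v), 0) := by
    intro s hs v
    have h1 : HasFDerivAt (H ∘ ξ.symm) (formIn Ω ξ.symm (ψ s) (X (ψ s))) (ψ s) := by
      rw [hX, hξ.formIn_hamiltonianFieldIn H (ht s hs)]
      exact ((hHs.contDiffAt (ξ.open_target.mem_nhds (ht s hs))).differentiableAt
        (by simp)).hasFDerivAt
    rw [(h1.comp s (hψd s hs)).fderiv]
    have h2 : X (ψ s) = ((X (ψ s)).1, 0) + (0, (X (ψ s)).2) := by simp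
    have h3 : formIn Ω ξ.symm (ψ s) ((X (ψ s)).1, 0)
        (fderiv ℝ β.symm (0, s) (0, v), 0) = 0 := by
      rw [IsStraightChart.formIn_skew, neg_eq_zero]
      exact (hβ.fst_eq_zero_iff _ (β.map_target hs) _).1
        (by rw [hβ.fderiv_fderiv_symm hs]) _
    rw [ContinuousLinearMap.comp_apply]
    conv_lhs => rw [h2]
    rw [map_add, add_apply]
    exact (congrArg (· + _) h3).trans (zero_add _)
  set η := (fderiv ℝ β 0 w).2 with hη
  have hηw : fderiv ℝ β.symm 0 (0, η) = w := by
    have h1 := hβ.fderiv_symm_fderiv h0t w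
    rw [hβ0] at h1
    rw [← h1]
    congr 1
    exact Prod.ext hw.symm rfl
  by_contra hne
  have hη0 : η ≠ 0 := fun h => hne (by rw [← hηw, h, Prod.mk_zero_zero, _root_.map_zero])
  have hcrit : fderiv ℝ ((H ∘ ξ.symm) ∘ ψ) 0 = 0 := by
    ext v
    rw [hfd 0 h0S, hψ0, h0, Prod.mk_zero_zero, _root_.map_zero]
    rfl
  obtain ⟨v, hv⟩ := hnondeg _ _ S hpar 0 h0S hcrit η hη0
  -- If dg(X_H) had zero derivative in the direction η, then η would be in the kernel of the
  -- Hessian, against the choice of `v`.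
  refine hv ?_
  change fderiv ℝ (fderiv ℝ ((H ∘ ξ.symm) ∘ ψ)) 0 η v = 0
  have hSn : S ∈ 𝓝 (0 : EuclideanSpace ℝ (Fin (Module.finrank ℝ V))) := hpar.isOpen.mem_nhds h0S
  have hd2 : DifferentiableAt ℝ (fderiv ℝ ((H ∘ ξ.symm) ∘ ψ)) 0 :=
    ((hf.contDiffAt hSn).fderiv_right (m := ∞) (by simp)).differentiableAt (by simp)
  have h1 : fderiv ℝ (fderiv ℝ ((H ∘ ξ.symm) ∘ ψ)) 0 η v =
      fderiv ℝ (fun s => fderiv ℝ ((H ∘ ξ.symm) ∘ ψ) s v) 0 η := by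
    rw [(hd2.hasFDerivAt.clm_apply (hasFDerivAt_const v _)).fderiv]
    simp
  have h2 : (fun s => fderiv ℝ ((H ∘ ξ.symm) ∘ ψ) s v) =ᶠ[𝓝 0] fun s =>
      formIn Ω ξ.symm (ψ s) (0, (X (ψ s)).2) (fderiv ℝ β.symm (0, s) (0, v), 0) := by
    filter_upwards [hSn] with s hs using hfd s hs v
  have hψ0t : ψ 0 ∈ ξ.target := ht 0 h0S
  have hB : DifferentiableAt ℝ (fun s => formIn Ω ξ.symm (ψ s)) 0 :=
    ((hξ.form_smooth.contDiffAt (ξ.open_target.mem_nhds hψ0t)).differentiableAt (by simp)).comp 0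
      (hψd 0 h0S).differentiableAt
  have hX1 : HasFDerivAt X (fderiv ℝ X (ψ 0)) (ψ 0) :=
    ((hXs.contDiffAt (ξ.open_target.mem_nhds hψ0t)).differentiableAt (by simp)).hasFDerivAt
  have hX2 : HasFDerivAt (fun s => ((0 : EuclideanSpace ℝ (Fin d)), (X (ψ s)).2)) _ 0 :=
    (hasFDerivAt_const (0 : EuclideanSpace ℝ (Fin d)) (0 : EuclideanSpace ℝ
      (Fin (Module.finrank ℝ V)))).prodMk ((hasFDerivAt_snd (𝕜 := ℝ)).comp 0
        (hX1.comp 0 (hψd 0 h0S)))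
  have hD : DifferentiableAt ℝ (fun s => (fderiv ℝ β.symm
      ((0 : EuclideanSpace ℝ (Fin n)), s) (0, v), (0 : V))) 0 := by
    have h3 : ContDiffAt ℝ ∞ (fderiv ℝ β.symm) ((0 : EuclideanSpace ℝ (Fin n)),
        (0 : EuclideanSpace ℝ (Fin (Module.finrank ℝ V)))) :=
      (hβ.smooth_symm.contDiffAt (β.open_target.mem_nhds h0t)).fderiv_right (by simp)
    have h4 : DifferentiableAt ℝ (fun s => fderiv ℝ β.symm
        ((0 : EuclideanSpace ℝ (Fin n)), s)) (0 : EuclideanSpace ℝ (Fin (Module.finrank ℝ V))) :=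
      (h3.differentiableAt (by simp)).comp _ (by fun_prop)
    exact (h4.clm_apply (differentiableAt_const _)).prodMk (differentiableAt_const _)
  have h6 : (X (ψ 0)).2 = 0 := by rw [hψ0]; exact h0
  have h7 : (fderiv ℝ X (ψ 0) (fderiv ℝ β.symm (0, 0) (0, η), 0)).2 = 0 := by
    rw [Prod.mk_zero_zero, hηw, hψ0]; exact hw'
  rw [h1, h2.fderiv_eq]
  exact fderiv_clm_apply_apply_eq_zero hB hX2 hD (Prod.ext rfl h6) (Prod.ext rfl h7)

end IsLeafChart

end FlowBox

end ConstrainedHamiltonian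

end

noncomputable section

namespace ConstrainedHamiltonian

/-! ### Flow boxes around points of M_H. -/

section FlowBox

variable {E V P : Type*} [NormedAddCommGroup E] [NormedSpace ℝ E] [FiniteDimensional ℝ E]
  [NormedAddCommGroup V] [NormedSpace ℝ V] [TopologicalSpace P] [ChartedSpace E P]

/-- Coordinates on `P` consisting of coordinates transverse to the fibres of the constraint
manifold, the function `dg(X_H)` and the constraint function. -/
structure IsFlowBox (Ω : SymplecticForm E P) (g : P → V) (H : P → ℝ) {n : ℕ}
    (θ : OpenPartialHomeomorph P (EuclideanSpace ℝ (Fin n) × V × V)) : Prop where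
  smooth : ContMDiffOn 𝓘(ℝ, E) 𝓘(ℝ, EuclideanSpace ℝ (Fin n) × V × V) ∞ θ θ.source
  smooth_symm : ContMDiffOn 𝓘(ℝ, EuclideanSpace ℝ (Fin n) × V × V) 𝓘(ℝ, E) ∞ θ.symm θ.target
  hiddenFun_eq : ∀ y ∈ θ.source, (θ y).2.1 = hiddenFun Ω g H y
  constraint_eq : ∀ y ∈ θ.source, (θ y).2.2 = g y
  mem_kerForm_iff : ∀ y ∈ θ.source, g y = 0 → ∀ u : TangentSpace 𝓘(ℝ, E) y,
    u ∈ kerForm Ω g y ↔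
      (mfderiv 𝓘(ℝ, E) 𝓘(ℝ, EuclideanSpace ℝ (Fin n) × V × V) θ y u).1 = 0 ∧
      (mfderiv 𝓘(ℝ, E) 𝓘(ℝ, EuclideanSpace ℝ (Fin n) × V × V) θ y u).2.2 = 0

variable [FiniteDimensional ℝ V] [IsManifold 𝓘(ℝ, E) ∞ P]

/-- A vector killed by the derivative of (a, dg(X_H), g) is tangent to M by its third component,
tangent to the leaf by its first, and zero by nondegeneracy and its second. The dimensions agree
because d = n + dim V, so the inverse function theorem applies. -/
theorem exists_isFlowBox {Ω : SymplecticForm E P} {g : P → V} {H : P → ℝ}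
    (hH : ContMDiff 𝓘(ℝ, E) 𝓘(ℝ, ℝ) ∞ H) (hg : ContMDiff 𝓘(ℝ, E) 𝓘(ℝ, V) ∞ g)
    (hreg : IsRegularConstraint E g) (hnondeg : IsNondegenerate Ω g H)
    (hcois : IsCoisotropic Ω g) {m : P} (hm : m ∈ hiddenSet Ω g H) :
    ∃ (n : ℕ) (θ : OpenPartialHomeomorph P (EuclideanSpace ℝ (Fin n) × V × V)),
      m ∈ θ.source ∧ IsFlowBox Ω g H θ := by
  obtain ⟨hmg, hmh⟩ := (mem_hiddenSet_iff hcois).1 hm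
  obtain ⟨d, ξ, hmξ, hξm, hξ⟩ := exists_straight_chart Ω hg hmg (hreg m hmg)
  have h0ξ : 0 ∈ ξ.target := hξm ▸ ξ.map_source hmξ
  obtain ⟨n, β, hβ⟩ := hξ.exists_isLeafChart hg hcois h0ξ
  have hξ0 : ξ.symm 0 = m := by rw [← hξm, ξ.left_inv hmξ]
  set X := hamiltonianFieldIn Ω ξ H with hX
  have hXs : ContDiffOn ℝ ∞ X ξ.target := hξ.contDiffOn_hamiltonianFieldIn hH
  have hX0 : (X 0).2 = 0 := by rw [← hξ.hiddenFun_symm hg hH h0ξ, hξ0, hmh]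
  set f : EuclideanSpace ℝ (Fin d) × V → EuclideanSpace ℝ (Fin n) × V × V :=
    fun z => ((β z.1).1, (X z).2, z.2) with hf
  set U : Set (EuclideanSpace ℝ (Fin d) × V) := ξ.target ∩ Prod.fst ⁻¹' β.source with hU
  have hUo : IsOpen U := ξ.open_target.inter (β.open_source.preimage continuous_fst)
  have h0U : (0 : EuclideanSpace ℝ (Fin d) × V) ∈ U := ⟨h0ξ, hβ.mem_source⟩
  have hfs : ContDiffOn ℝ ∞ f U :=
    ((hβ.smooth.comp contDiffOn_fst fun z hz => hz.2).fst).prodMk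
      (((hXs.mono inter_subset_left).snd).prodMk contDiffOn_snd)
  have hfd : ∀ z ∈ U, ∀ u, fderiv ℝ f z u =
      ((fderiv ℝ β z.1 u.1).1, (fderiv ℝ X z u).2, u.2) := by
    intro z hz u
    have h1 : HasFDerivAt (fun z : EuclideanSpace ℝ (Fin d) × V => β z.1)
        ((fderiv ℝ β z.1).comp (ContinuousLinearMap.fst ℝ _ _)) z :=
      (hβ.hasFDerivAt hz.2).comp z hasFDerivAt_fst
    have h2 : HasFDerivAt X (fderiv ℝ X z) z :=
      ((hXs.contDiffAt (ξ.open_target.mem_nhds hz.1)).differentiableAt (by simp)).hasFDerivAt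
    have h3 : HasFDerivAt f _ z := h1.fst.prodMk (h2.snd.prodMk hasFDerivAt_snd)
    rw [h3.fderiv]
    rfl
  have hinj : Function.Injective (fderiv ℝ f 0) := by
    refine (injective_iff_map_eq_zero _).2 fun u hu => ?_
    rw [hfd 0 h0U] at hu
    have hu2 : u.2 = 0 := congrArg (fun q => q.2.2) hu
    have hu' : u = (u.1, 0) := Prod.ext rfl hu2
    have h1 : (fderiv ℝ β 0 u.1).1 = 0 := congrArg Prod.fst hu
    have h2 : (fderiv ℝ X 0 u).2 = 0 := congrArg (fun q => q.2.1) hu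
    rw [hu'] at h2
    rw [hu', hβ.eq_zero_of_fderiv_eq_zero hξ hg hH hnondeg hX0 h1 h2, Prod.mk_zero_zero]
  obtain ⟨A, hA⟩ := exists_continuousLinearEquiv_of_injective (fderiv ℝ f 0) hinj (by
    simp [hβ.finrank_eq]; ring)
  have hf0 : HasFDerivAt f (A : _ →L[ℝ] _) 0 := by
    rw [hA]
    exact ((hfs.contDiffAt (hUo.mem_nhds h0U)).differentiableAt (by simp)).hasFDerivAt
  have : CompleteSpace (EuclideanSpace ℝ (Fin d) × V) := FiniteDimensional.complete ℝ _
  obtain ⟨e, he, h0e, heU, hes, hes', -⟩ :=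
    exists_openPartialHomeomorph_contDiffOn (hUo.mem_nhds h0U) hfs hf0
  have hef : (e : _ → _) = f := funext he
  have hsrc : ∀ y ∈ (ξ.trans e).source, y ∈ ξ.source ∧ ξ y ∈ e.source := fun y hy => by
    simpa using hy
  have happ : ∀ y, (ξ.trans e) y = f (ξ y) := fun y => he _
  refine ⟨n, ξ.trans e, ?_, ?_⟩
  · simp [hmξ, hξm, h0e]
  refine ⟨?_, ?_, fun y hy => ?_, fun y hy => ?_, fun y hy hgy u => ?_⟩
  · rw [OpenPartialHomeomorph.coe_trans]
    exact (contMDiffOn_iff_contDiffOn.2 hes).comp (hξ.smooth.mono fun y hy => (hsrc y hy).1)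
      fun y hy => (hsrc y hy).2
  · rw [OpenPartialHomeomorph.coe_trans_symm]
    refine hξ.smooth_symm.comp ((contMDiffOn_iff_contDiffOn.2 hes').mono fun y hy => ?_)
      fun y hy => ?_
    · exact (by simpa using hy : y ∈ e.target ∧ e.symm y ∈ ξ.target).1
    · exact (by simpa using hy : y ∈ e.target ∧ e.symm y ∈ ξ.target).2
  · obtain ⟨h1, h2⟩ := hsrc y hy
    rw [happ]
    have h3 := hξ.hiddenFun_symm hg hH (ξ.map_source h1)
    rw [ξ.left_inv h1] at h3
    exact h3.symm
  · rw [happ]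
    exact hξ.snd_eq y (hsrc y hy).1
  · obtain ⟨h1, h2⟩ := hsrc y hy
    have hz := ξ.map_source h1
    obtain ⟨z, hz', rfl⟩ : ∃ z ∈ ξ.target, ξ.symm z = y := ⟨ξ y, hz, ξ.left_inv h1⟩
    rw [ξ.right_inv hz'] at h2
    have hz2 : z.2 = 0 := by rw [← hξ.apply_symm_eq hz', hgy]
    obtain ⟨x, v⟩ := z
    obtain rfl : v = 0 := hz2
    obtain ⟨u', rfl⟩ := hξ.exists_eq_mfderiv_symm hz' u
    have hd : mfderiv 𝓘(ℝ, E) 𝓘(ℝ, EuclideanSpace ℝ (Fin n) × V × V) (ξ.trans e) (ξ.symm (x, 0))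
        (mfderiv 𝓘(ℝ, EuclideanSpace ℝ (Fin d) × V) 𝓘(ℝ, E) ξ.symm (x, 0) u') =
        fderiv ℝ f (x, 0) u' := by
      have hs : MDifferentiableAt 𝓘(ℝ, E) 𝓘(ℝ, EuclideanSpace ℝ (Fin n) × V × V)
          (ξ.trans e) (ξ.symm (x, 0)) := by
        rw [OpenPartialHomeomorph.coe_trans]
        refine MDifferentiableAt.comp _ (I' := 𝓘(ℝ, EuclideanSpace ℝ (Fin d) × V)) ?_
          (hξ.mdifferentiable.mdifferentiableAt h1)
        rw [ξ.right_inv hz']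
        exact ((hes.contDiffAt (e.open_source.mem_nhds h2)).differentiableAt
          (by simp)).mdifferentiableAt
      have h4 := mfderiv_comp (x, (0 : V)) hs (hξ.mdifferentiable.mdifferentiableAt_symm hz')
      have h5 : (ξ.trans e) ∘ ξ.symm =ᶠ[𝓝 (x, (0 : V))] f := by
        filter_upwards [ξ.open_target.mem_nhds hz'] with z hz
        rw [Function.comp_apply, happ, ξ.right_inv hz]
      rw [mfderiv_eq_fderiv, h5.fderiv_eq] at h4
      exact (DFunLike.congr_fun h4 u').symm
    rw [hξ.mem_kerForm_iff hg hz' u', hd, hfd _ (heU h2)]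
    have hx : x ∈ β.source := (heU h2).2
    constructor
    · rintro ⟨h3, h4⟩
      have h5 : u' = (u'.1, 0) := Prod.ext rfl h3
      rw [h5] at h4
      exact ⟨(hβ.fst_eq_zero_iff x hx _).2 h4, h3⟩
    · rintro ⟨h3, h4⟩
      have h5 : u' = (u'.1, 0) := Prod.ext rfl h4
      have h6 := (hβ.fst_eq_zero_iff x hx _).1 h3
      rw [← h5] at h6
      exact ⟨h4, h6⟩

end FlowBox

end ConstrainedHamiltonian

end

noncomputable section

namespace ConstrainedHamiltonian

/-! ### Being joined by a leaf curve is an equivalence relation. -/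

section LeafCurves

variable {E V P : Type*} [NormedAddCommGroup E] [NormedSpace ℝ E]
  [NormedAddCommGroup V] [NormedSpace ℝ V] [TopologicalSpace P] [ChartedSpace E P]

theorem smul_mem_kerForm {Ω : SymplecticForm E P} {g : P → V} {z : P}
    {u : TangentSpace 𝓘(ℝ, E) z} (c : ℝ) (hu : u ∈ kerForm Ω g z) : c • u ∈ kerForm Ω g z :=
  ⟨(tangentM E g z).smul_mem c hu.1, fun v hv => by
    rw [← Ω.bilin_apply, map_smul, LinearMap.smul_apply, Ω.bilin_apply, hu.2 v hv, smul_zero]⟩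

theorem zero_mem_kerForm (Ω : SymplecticForm E P) (g : P → V) (z : P) :
    (0 : TangentSpace 𝓘(ℝ, E) z) ∈ kerForm Ω g z :=
  ⟨zero_mem _, fun v _ => by rw [← Ω.bilin_apply, map_zero, LinearMap.zero_apply]⟩

/-- At the time `t`, the curve `γ` is in `M ∩ O` and tangent to the fibres. -/
def IsLeafCurveAt (Ω : SymplecticForm E P) (g : P → V) (O : Set P) (γ : ℝ → P) (t : ℝ) : Prop :=
  γ t ∈ constraintSet g ∧ γ t ∈ O ∧
    mfderiv 𝓘(ℝ, ℝ) 𝓘(ℝ, E) γ t (1 : ℝ) ∈ kerForm Ω g (γ t)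

variable {Ω : SymplecticForm E P} {g : P → V} {O O' : Set P}

theorem mem_fibreIn_iff {z y : P} : y ∈ fibreIn Ω g O z ↔
    ∃ γ : ℝ → P, ContMDiff 𝓘(ℝ, ℝ) 𝓘(ℝ, E) 1 γ ∧ γ 0 = z ∧ γ 1 = y ∧
      ∀ t ∈ Icc (0 : ℝ) 1, IsLeafCurveAt Ω g O γ t := Iff.rfl

theorem IsLeafCurveAt.comp {γ : ℝ → P} (hγ : ContMDiff 𝓘(ℝ, ℝ) 𝓘(ℝ, E) 1 γ) {φ : ℝ → ℝ} {t : ℝ}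
    (hφ : DifferentiableAt ℝ φ t) (h : IsLeafCurveAt Ω g O γ (φ t)) (hO' : γ (φ t) ∈ O') :
    IsLeafCurveAt Ω g O' (fun s => γ (φ s)) t := by
  refine ⟨h.1, hO', ?_⟩
  have h1 := mfderiv_comp t (hγ.mdifferentiable (by simp) (φ t)) hφ.mdifferentiableAt
  have h2 : mfderiv 𝓘(ℝ, ℝ) 𝓘(ℝ, E) (fun s => γ (φ s)) t (1 : ℝ) =
      deriv φ t • mfderiv 𝓘(ℝ, ℝ) 𝓘(ℝ, E) γ (φ t) (1 : ℝ) := by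
    rw [mfderiv_eq_fderiv] at h1
    refine (DFunLike.congr_fun h1 (1 : ℝ)).trans ?_
    have h3 : fderiv ℝ φ t 1 = deriv φ t • (1 : ℝ) := by simp
    exact (congrArg (mfderiv 𝓘(ℝ, ℝ) 𝓘(ℝ, E) γ (φ t)) h3).trans (map_smul _ _ _)
  rw [h2]
  exact smul_mem_kerForm _ h.2.2

theorem IsLeafCurveAt.congr {γ γ' : ℝ → P} {t : ℝ} (h : IsLeafCurveAt Ω g O γ t)
    (he : γ' =ᶠ[𝓝 t] γ) : IsLeafCurveAt Ω g O γ' t := by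
  have h1 := he.eq_of_nhds
  refine ⟨h1 ▸ h.1, h1 ▸ h.2.1, ?_⟩
  rw [he.mfderiv_eq]
  -- The two tangent spaces are copies of E indexed by different terms; stating the transfer for
  -- general points allows the equality of points to be substituted.
  have h2 : ∀ x y : P, x = y → ∀ u : E, (u : TangentSpace 𝓘(ℝ, E) x) ∈ kerForm Ω g x →
      (u : TangentSpace 𝓘(ℝ, E) y) ∈ kerForm Ω g y := by
    rintro x _ rfl u hu; exact hu
  exact h2 _ _ h1.symm _ h.2.2

theorem fibreIn_mono (h : O ⊆ O') (z : P) : fibreIn Ω g O z ⊆ fibreIn Ω g O' z :=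
  fun _ ⟨γ, h1, h2, h3, h4⟩ => ⟨γ, h1, h2, h3, fun t ht =>
    ⟨(h4 t ht).1, h (h4 t ht).2.1, (h4 t ht).2.2⟩⟩

theorem fibreIn_subset (z : P) : fibreIn Ω g O z ⊆ constraintSet g ∩ O := by
  rintro _ ⟨γ, h1, h2, rfl, h4⟩
  exact ⟨(h4 1 (by simp)).1, (h4 1 (by simp)).2.1⟩

theorem mem_fibreIn_self {z : P} (hz : z ∈ constraintSet g) (hO : z ∈ O) :
    z ∈ fibreIn Ω g O z := by
  refine ⟨fun _ => z, contMDiff_const, rfl, rfl, fun t _ => ⟨hz, hO, ?_⟩⟩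
  rw [mfderiv_const]
  exact zero_mem_kerForm Ω g z

/-- A piece of a curve tangent to the fibres. -/
theorem mem_fibreIn_of_segment {γ : ℝ → P} (hγ : ContMDiff 𝓘(ℝ, ℝ) 𝓘(ℝ, E) 1 γ) {s t : ℝ}
    (h : ∀ r ∈ uIcc s t, IsLeafCurveAt Ω g O γ r) (hO : ∀ r ∈ uIcc s t, γ r ∈ O') :
    γ t ∈ fibreIn Ω g O' (γ s) := by
  have hφ : ContDiff ℝ 1 (fun r : ℝ => s + r * (t - s)) := by fun_prop
  have hmem : ∀ r ∈ Icc (0 : ℝ) 1, s + r * (t - s) ∈ uIcc s t := by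
    intro r hr
    rw [← segment_eq_uIcc]
    exact ⟨1 - r, r, by linarith [hr.2], hr.1, by ring, by simp; ring⟩
  refine ⟨fun r => γ (s + r * (t - s)), hγ.comp hφ.contMDiff, by simp, by simp, fun r hr => ?_⟩
  exact (h _ (hmem r hr)).comp hγ (hφ.differentiable (by simp) r) (hO _ (hmem r hr))

theorem fibreIn_symm {z y : P} (h : y ∈ fibreIn Ω g O z) : z ∈ fibreIn Ω g O y := by
  obtain ⟨γ, h1, rfl, rfl, h4⟩ := h
  have h5 : uIcc (1 : ℝ) 0 = Icc 0 1 := by rw [uIcc_comm, uIcc_of_le zero_le_one]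
  exact mem_fibreIn_of_segment h1 (h5 ▸ h4) (h5 ▸ fun r hr => (h4 r hr).2.1)

/-- Both curves are reparametrised to be constant around the junction: the first has stopped after t
= 1/3 and the second starts only at t = 2/3. They agree between these times, so the concatenation is
C¹. -/
theorem fibreIn_trans {x y z : P} (hxy : y ∈ fibreIn Ω g O x) (hyz : z ∈ fibreIn Ω g O y) :
    z ∈ fibreIn Ω g O x := by
  obtain ⟨γ, h1, rfl, rfl, h4⟩ := hxy
  obtain ⟨η, k1, k2, rfl, k4⟩ := hyz
  have hσ : ContDiff ℝ 1 Real.smoothTransition := Real.smoothTransition.contDiff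
  have hφ : ContDiff ℝ 1 (fun t : ℝ => Real.smoothTransition (3 * t)) := hσ.comp (by fun_prop)
  have hψ : ContDiff ℝ 1 (fun t : ℝ => Real.smoothTransition (3 * t - 2)) := hσ.comp (by fun_prop)
  have hI : ∀ x : ℝ, Real.smoothTransition x ∈ Icc (0 : ℝ) 1 := fun x =>
    ⟨Real.smoothTransition.nonneg x, Real.smoothTransition.le_one x⟩
  set c : ℝ → P := fun t => if t ≤ 1 / 2 then γ (Real.smoothTransition (3 * t)) else
    η (Real.smoothTransition (3 * t - 2)) with hc
  have hl : ∀ t < 2 / 3, c =ᶠ[𝓝 t] fun t => γ (Real.smoothTransition (3 * t)) := by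
    intro t ht
    filter_upwards [Iio_mem_nhds ht] with s hs
    have hs : s < 2 / 3 := hs
    simp only [hc]
    split_ifs with h
    · rfl
    · rw [Real.smoothTransition.one_of_one_le (by linarith : (1 : ℝ) ≤ 3 * s),
        Real.smoothTransition.zero_of_nonpos (by linarith : 3 * s - 2 ≤ 0), k2]
  have hr : ∀ t > 1 / 3, c =ᶠ[𝓝 t] fun t => η (Real.smoothTransition (3 * t - 2)) := by
    intro t ht
    filter_upwards [Ioi_mem_nhds ht] with s hs
    have hs : 1 / 3 < s := hs
    simp only [hc]
    split_ifs with h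
    · rw [Real.smoothTransition.one_of_one_le (by linarith : (1 : ℝ) ≤ 3 * s),
        Real.smoothTransition.zero_of_nonpos (by linarith : 3 * s - 2 ≤ 0), k2]
    · rfl
  refine mem_fibreIn_iff.2 ⟨c, fun t => ?_, ?_, ?_, fun t _ => ?_⟩
  · rcases lt_or_ge t (2 / 3) with ht | ht
    · exact (h1.comp hφ.contMDiff t).congr_of_eventuallyEq (hl t ht)
    · exact (k1.comp hψ.contMDiff t).congr_of_eventuallyEq (hr t (by linarith))
  · rw [(hl 0 (by norm_num)).eq_of_nhds]; simp
  · rw [(hr 1 (by norm_num)).eq_of_nhds]; norm_num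
  · rcases lt_or_ge t (2 / 3) with ht | ht
    · exact (IsLeafCurveAt.comp h1 (hφ.differentiable (by simp) t) (h4 _ (hI _))
        (h4 _ (hI _)).2.1).congr (hl t ht)
    · exact (IsLeafCurveAt.comp k1 (hψ.differentiable (by simp) t) (k4 _ (hI _))
        (k4 _ (hI _)).2.1).congr (hr t (by linarith))

/-- A fibre inside `O` is joined to its base point inside itself. -/
theorem mem_fibreIn_fibreIn {z y : P} (h : y ∈ fibreIn Ω g O z) :
    y ∈ fibreIn Ω g (fibreIn Ω g O z) z := by
  obtain ⟨γ, h1, rfl, rfl, h4⟩ := h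
  refine mem_fibreIn_of_segment h1 (s := 0) (t := 1) (by rwa [uIcc_of_le zero_le_one])
    fun r hr => mem_fibreIn_of_segment h1 (fun q hq => h4 q ?_) fun q hq => (h4 q ?_).2.1
  all_goals
    rw [uIcc_of_le zero_le_one] at hr
    rw [uIcc_of_le hr.1] at hq
    exact ⟨hq.1, hq.2.trans hr.2⟩

end LeafCurves

/-! ### Leaf curves in a flow box. -/

section Box

variable {E V P : Type*} [NormedAddCommGroup E] [NormedSpace ℝ E] [FiniteDimensional ℝ E]
  [NormedAddCommGroup V] [NormedSpace ℝ V] [TopologicalSpace P] [ChartedSpace E P]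

namespace IsFlowBox

variable {Ω : SymplecticForm E P} {g : P → V} {H : P → ℝ} {O : Set P} {n : ℕ}
  {θ : OpenPartialHomeomorph P (EuclideanSpace ℝ (Fin n) × V × V)}

theorem mdifferentiable (hθ : IsFlowBox Ω g H θ) :
    θ.MDifferentiable 𝓘(ℝ, E) 𝓘(ℝ, EuclideanSpace ℝ (Fin n) × V × V) :=
  ⟨hθ.smooth.mdifferentiableOn (by simp), hθ.smooth_symm.mdifferentiableOn (by simp)⟩

theorem constraint_symm (hθ : IsFlowBox Ω g H θ) {q} (hq : q ∈ θ.target) :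
    g (θ.symm q) = q.2.2 := by
  rw [← hθ.constraint_eq _ (θ.map_target hq), θ.right_inv hq]

theorem hiddenFun_symm (hθ : IsFlowBox Ω g H θ) {q} (hq : q ∈ θ.target) :
    hiddenFun Ω g H (θ.symm q) = q.2.1 := by
  rw [← hθ.hiddenFun_eq _ (θ.map_target hq), θ.right_inv hq]

theorem symm_mem_hiddenSet (hθ : IsFlowBox Ω g H θ) (hcois : IsCoisotropic Ω g) {a}
    (ha : (a, (0 : V), (0 : V)) ∈ θ.target) : θ.symm (a, 0, 0) ∈ hiddenSet Ω g H :=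
  (mem_hiddenSet_iff hcois).2 ⟨hθ.constraint_symm ha, hθ.hiddenFun_symm ha⟩

theorem apply_eq_of_mem_hiddenSet (hθ : IsFlowBox Ω g H θ) (hcois : IsCoisotropic Ω g) {m : P}
    (hm : m ∈ hiddenSet Ω g H) (hmθ : m ∈ θ.source) : θ m = ((θ m).1, 0, 0) := by
  obtain ⟨h1, h2⟩ := (mem_hiddenSet_iff hcois).1 hm
  refine Prod.ext rfl (Prod.ext ?_ ?_)
  · rw [hθ.hiddenFun_eq m hmθ, h2]
  · exact (hθ.constraint_eq m hmθ).trans h1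

/-- The transverse coordinates are constant along the fibres. -/
theorem fst_eq_of_leafCurve (hθ : IsFlowBox Ω g H θ) {γ : ℝ → P}
    (hγ : ContMDiff 𝓘(ℝ, ℝ) 𝓘(ℝ, E) 1 γ)
    (h : ∀ t ∈ Icc (0 : ℝ) 1, IsLeafCurveAt Ω g O γ t) (hO : O ⊆ θ.source) {t : ℝ}
    (ht : t ∈ Icc (0 : ℝ) 1) : (θ (γ t)).1 = (θ (γ 0)).1 := by
  have hd : ∀ t ∈ Icc (0 : ℝ) 1, HasDerivAt (fun t => (θ (γ t)).1) 0 t := by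
    intro t ht
    obtain ⟨h1, h2, h3⟩ := h t ht
    have h4 : MDifferentiableAt 𝓘(ℝ, ℝ) 𝓘(ℝ, EuclideanSpace ℝ (Fin n) × V × V) (θ ∘ γ) t :=
      (hθ.mdifferentiable.mdifferentiableAt (hO h2)).comp t (hγ.mdifferentiable (by simp) t)
    have h5 := mfderiv_comp t (hθ.mdifferentiable.mdifferentiableAt (hO h2))
      (hγ.mdifferentiable (by simp) t)
    rw [mfderiv_eq_fderiv] at h5
    have h6 := ((hθ.mem_kerForm_iff _ (hO h2) h1 _).1 h3).1
    have h8 : HasDerivAt (fun t => (θ (γ t)).1) (fderiv ℝ (θ ∘ γ) t 1).1 t :=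
      (mdifferentiableAt_iff_differentiableAt.1 h4).hasFDerivAt.fst.hasDerivAt
    rwa [show (fderiv ℝ (θ ∘ γ) t 1).1 = 0 from
      (congrArg Prod.fst (DFunLike.congr_fun h5 (1 : ℝ))).trans h6] at h8
  exact constant_of_has_deriv_right_zero
    (fun t ht => (hd t ht).continuousAt.continuousWithinAt)
    (fun t ht => (hd t ⟨ht.1, ht.2.le⟩).hasDerivWithinAt) t ht

theorem fst_eq_of_mem_fibreIn (hθ : IsFlowBox Ω g H θ) (hO : O ⊆ θ.source) {z y : P}
    (h : y ∈ fibreIn Ω g O z) : (θ y).1 = (θ z).1 := by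
  obtain ⟨γ, h1, rfl, rfl, h4⟩ := h
  exact hθ.fst_eq_of_leafCurve h1 h4 hO (by simp)

/-- A curve in coordinates with constant transverse coordinates is tangent to the fibres. -/
theorem mem_fibreIn_of_curve (hθ : IsFlowBox Ω g H θ) {a : EuclideanSpace ℝ (Fin n)} {c : ℝ → V}
    (hc : ContDiffOn ℝ 1 c (Icc 0 1))
    (h : ∀ t ∈ Icc (0 : ℝ) 1, (a, c t, (0 : V)) ∈ θ.target ∧ θ.symm (a, c t, 0) ∈ O) :
    θ.symm (a, c 1, 0) ∈ fibreIn Ω g O (θ.symm (a, c 0, 0)) := by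
  -- A leaf curve must be C¹ on the whole line, while `c` is only given on [0, 1]. The smooth
  -- transition maps ℝ into [0, 1] and fixes 0 and 1.
  set c' : ℝ → V := fun t => c (Real.smoothTransition t) with hc'
  have hI : ∀ x : ℝ, Real.smoothTransition x ∈ Icc (0 : ℝ) 1 := fun x =>
    ⟨Real.smoothTransition.nonneg x, Real.smoothTransition.le_one x⟩
  have hcs : ContDiff ℝ 1 c' :=
    contDiffOn_univ.1 (hc.comp Real.smoothTransition.contDiff.contDiffOn fun t _ => hI t)
  have hq : ContDiff ℝ 1 (fun t => (a, c' t, (0 : V))) := by fun_prop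
  have ht : ∀ t, (a, c' t, (0 : V)) ∈ θ.target := fun t => (h _ (hI t)).1
  have hγ : ContMDiff 𝓘(ℝ, ℝ) 𝓘(ℝ, E) 1 (fun t => θ.symm (a, c' t, 0)) :=
    (hθ.smooth_symm.of_le (by simp)).comp_contMDiff hq.contMDiff ht
  refine ⟨fun t => θ.symm (a, c' t, 0), hγ, by simp [hc'], by simp [hc'], fun t _ =>
    ⟨hθ.constraint_symm (ht t), (h _ (hI t)).2, ?_⟩⟩
  rw [hθ.mem_kerForm_iff _ (θ.map_target (ht t)) (hθ.constraint_symm (ht t))]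
  have h5 := mfderiv_comp t (hθ.mdifferentiable.mdifferentiableAt (θ.map_target (ht t)))
    (hγ.mdifferentiable (by simp) t)
  have h6 : θ ∘ (fun t => θ.symm (a, c' t, 0)) = fun t => (a, c' t, 0) :=
    funext fun t => θ.right_inv (ht t)
  have h7 : HasFDerivAt (fun t => (a, c' t, (0 : V))) _ t := (hasFDerivAt_const a t).prodMk
    ((hcs.differentiable (by simp) t).hasFDerivAt.prodMk (hasFDerivAt_const (0 : V) t))
  rw [h6, mfderiv_eq_fderiv, h7.fderiv] at h5
  exact ⟨(congrArg Prod.fst (DFunLike.congr_fun h5 (1 : ℝ))).symm,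
    (congrArg (fun q => q.2.2) (DFunLike.congr_fun h5 (1 : ℝ))).symm⟩

end IsFlowBox

end Box

end ConstrainedHamiltonian

end

noncomputable section

namespace ConstrainedHamiltonian

/-! ### Zeros in b of a function k(h, x, b) = h b + O(h²). -/

section Calculus

variable {X V : Type*} [NormedAddCommGroup X] [NormedSpace ℝ X] [NormedAddCommGroup V]
  [NormedSpace ℝ V] {k : ℝ × X × V → V} {Q : Set (ℝ × X × V)}

/-- Strict differentiability compares (h, x, b) with (0, x, b), where k vanishes. This makes the
first order expansion in h uniform in x and b. -/
theorem eventually_norm_sub_smul_le (hQ : IsOpen Q) (hk : ContDiffOn ℝ ∞ k Q)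
    (h0 : ∀ x b, ((0 : ℝ), x, b) ∈ Q → k (0, x, b) = 0)
    (h1 : ∀ x b, ((0 : ℝ), x, b) ∈ Q → fderiv ℝ k (0, x, b) (1, 0, 0) = b) {x₀ : X} {b₀ : V}
    (hmem : ((0 : ℝ), x₀, b₀) ∈ Q) {η : ℝ} (hη : 0 < η) :
    ∀ᶠ p : ℝ × X × V in 𝓝 (0, x₀, b₀), ‖k p - p.1 • b₀‖ ≤ η * |p.1| := by
  have hs : HasStrictFDerivAt k (fderiv ℝ k (0, x₀, b₀)) (0, x₀, b₀) :=
    (hk.contDiffAt (hQ.mem_nhds hmem)).hasStrictFDerivAt (by simp)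
  have hcont : ContinuousAt (fun p : ℝ × X × V => (p, ((0 : ℝ), p.2))) (0, x₀, b₀) := by
    fun_prop
  have h2 := hcont.eventually (hs.isLittleO.def hη)
  have hcont' : ContinuousAt (fun p : ℝ × X × V => ((0 : ℝ), p.2)) (0, x₀, b₀) := by
    fun_prop
  filter_upwards [h2, hcont'.eventually (hQ.mem_nhds hmem)] with p hp hp'
  have h3 : p - (0, p.2) = p.1 • ((1 : ℝ), (0 : X), (0 : V)) := by
    ext <;> simp
  rw [h0 _ _ hp', h3, map_smul, h1 _ _ hmem, sub_zero, norm_smul, Real.norm_eq_abs] at hp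
  refine hp.trans (mul_le_mul_of_nonneg_left ?_ hη.le)
  have : ‖((1 : ℝ), (0 : X), (0 : V))‖ ≤ 1 := by simp [Prod.norm_def]
  exact (mul_le_mul_of_nonneg_left this (abs_nonneg _)).trans (mul_one _).le

theorem eventually_ne_zero (hQ : IsOpen Q) (hk : ContDiffOn ℝ ∞ k Q)
    (h0 : ∀ x b, ((0 : ℝ), x, b) ∈ Q → k (0, x, b) = 0)
    (h1 : ∀ x b, ((0 : ℝ), x, b) ∈ Q → fderiv ℝ k (0, x, b) (1, 0, 0) = b) {x₀ : X} {b₀ : V}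
    (hmem : ((0 : ℝ), x₀, b₀) ∈ Q) (hb : b₀ ≠ 0) :
    ∀ᶠ p : ℝ × X × V in 𝓝 (0, x₀, b₀), p.1 ≠ 0 → k p ≠ 0 := by
  have hb' : 0 < ‖b₀‖ := norm_pos_iff.2 hb
  filter_upwards [eventually_norm_sub_smul_le hQ hk h0 h1 hmem (half_pos hb')] with p hp hp0 hkp
  rw [hkp, zero_sub, norm_neg, norm_smul, Real.norm_eq_abs] at hp
  have := abs_pos.2 hp0
  nlinarith

/-- The derivative ∂_h k is nearly b in the Lipschitz sense near (0, x₀, 0), by strict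
differentiability; the mean value inequality in h, starting from k(0, ·) = 0, yields the factor |h|.
-/
theorem exists_forall_norm_sub_sub_le (hQ : IsOpen Q) (hk : ContDiffOn ℝ ∞ k Q)
    (h0 : ∀ x b, ((0 : ℝ), x, b) ∈ Q → k (0, x, b) = 0)
    (h1 : ∀ x b, ((0 : ℝ), x, b) ∈ Q → fderiv ℝ k (0, x, b) (1, 0, 0) = b) {x₀ : X}
    (hmem : ((0 : ℝ), x₀, (0 : V)) ∈ Q) :
    ∃ δ > 0, ∀ h x b b', |h| < δ → dist x x₀ < δ → ‖b‖ < δ → ‖b'‖ < δ →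
      ‖k (h, x, b) - k (h, x, b') - h • (b - b')‖ ≤ 1 / 2 * ‖b - b'‖ * |h| := by
  set l : ℝ × X × V → V := fun p => fderiv ℝ k p (1, 0, 0) with hl
  have hlc : ContDiffAt ℝ ∞ l (0, x₀, 0) :=
    ((hk.contDiffAt (hQ.mem_nhds hmem)).fderiv_right (m := ∞) (by simp)).clm_apply
      contDiffAt_const
  have hls : HasStrictFDerivAt l (fderiv ℝ l (0, x₀, 0)) (0, x₀, 0) :=
    hlc.hasStrictFDerivAt (by simp)
  -- Since ∂_h k(0, x₀, b) = b for b near 0, its derivative in b is the identity.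
  have hl1 : ∀ v, fderiv ℝ l (0, x₀, 0) (0, 0, v) = v := by
    intro v
    have hi' : HasFDerivAt (𝕜 := ℝ) (fun b : V => (x₀, b)) _ 0 :=
      (hasFDerivAt_const (𝕜 := ℝ) x₀ (0 : V)).prodMk (hasFDerivAt_id (0 : V))
    have hi : HasFDerivAt (fun b : V => ((0 : ℝ), x₀, b)) _ 0 :=
      (hasFDerivAt_const (0 : ℝ) (0 : V)).prodMk hi'
    have h2 := hls.hasFDerivAt.comp (0 : V) hi
    have h3 : (l ∘ fun b : V => ((0 : ℝ), x₀, b)) =ᶠ[𝓝 0] id := by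
      have hcont : ContinuousAt (fun b : V => ((0 : ℝ), x₀, b)) 0 := by fun_prop
      filter_upwards [hcont.eventually (hQ.mem_nhds hmem)] with b hb using h1 _ _ hb
    exact DFunLike.congr_fun (h2.unique ((hasFDerivAt_id _).congr_of_eventuallyEq h3)) v
  have hev := (hls.isLittleO.def (half_pos one_pos)).and
    ((continuous_fst.tendsto' (((0 : ℝ), x₀, (0 : V)), ((0 : ℝ), x₀, (0 : V))) _ rfl).eventually
      (hQ.mem_nhds hmem))
  obtain ⟨δ, hδ, hball⟩ := Metric.eventually_nhds_iff.1 hev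
  have hmemδ : ∀ h x b, |h| < δ → dist x x₀ < δ → ‖b‖ < δ →
      dist (h, x, b) ((0 : ℝ), x₀, (0 : V)) < δ := by
    intro h x b hh hx hb
    simp only [Prod.dist_eq, max_lt_iff]
    exact ⟨by simpa using hh, hx, by simpa using hb⟩
  refine ⟨δ, hδ, fun h x b b' hh hx hb hb' => ?_⟩
  have hd : ∀ s, |s| < δ → ∀ c : V, ‖c‖ < δ →
      HasDerivAt (fun s => k (s, x, c)) (l (s, x, c)) s := by
    intro s hs c hc
    have hQs : (s, x, c) ∈ Q :=
      (hball (y := ((s, x, c), (s, x, c))) (by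
        rw [Prod.dist_eq]; exact max_lt (hmemδ _ _ _ hs hx hc) (hmemδ _ _ _ hs hx hc))).2
    have h2 : HasFDerivAt k (fderiv ℝ k (s, x, c)) (s, x, c) :=
      ((hk.contDiffAt (hQ.mem_nhds hQs)).differentiableAt (by simp)).hasFDerivAt
    exact HasFDerivAt.comp_hasDerivAt (l := k) s h2
      ((hasDerivAt_id s).prodMk ((hasDerivAt_const s x).prodMk (hasDerivAt_const s c)))
  have hd' : ∀ s ∈ Metric.ball (0 : ℝ) δ,
      HasDerivWithinAt (fun s => k (s, x, b) - k (s, x, b') - s • (b - b'))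
        (l (s, x, b) - l (s, x, b') - (b - b')) (Metric.ball 0 δ) s := by
    intro s hs
    have hs' : |s| < δ := by simpa using hs
    have h2 := ((hd s hs' b hb).sub (hd s hs' b' hb')).sub
      ((hasDerivAt_id s).smul_const (b - b'))
    rw [one_smul] at h2
    exact h2.hasDerivWithinAt
  have hbd : ∀ s ∈ Metric.ball (0 : ℝ) δ,
      ‖l (s, x, b) - l (s, x, b') - (b - b')‖ ≤ 1 / 2 * ‖b - b'‖ := by
    intro s hs
    have hs' : |s| < δ := by simpa using hs
    have h2 := (hball (y := ((s, x, b), (s, x, b'))) (by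
        rw [Prod.dist_eq]; exact max_lt (hmemδ _ _ _ hs' hx hb) (hmemδ _ _ _ hs' hx hb'))).1
    have h3 : (s, x, b) - (s, x, b') = (0, 0, b - b') := by simp
    rw [h3, hl1] at h2
    refine h2.trans (mul_le_mul_of_nonneg_left ?_ (by norm_num))
    simp [Prod.norm_def]
  have h2 := (convex_ball (0 : ℝ) δ).norm_image_sub_le_of_norm_hasDerivWithin_le hd' hbd
    (Metric.mem_ball_self hδ) (y := h) (by simpa using hh)
  have hQ0 : ∀ c : V, ‖c‖ < δ → k (0, x, c) = 0 := fun c hc => h0 _ _ (hball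
    (y := ((0, x, c), (0, x, c))) (by
      rw [Prod.dist_eq]
      exact max_lt (hmemδ _ _ _ (by simpa using hδ) hx hc)
        (hmemδ _ _ _ (by simpa using hδ) hx hc))).2
  simpa [hQ0 b hb, hQ0 b' hb'] using h2

/-- Roots are the fixed points of b ↦ b − k(h, x, b)/h. This map is a contraction with constant 1/2,
and it preserves the ball of radius ε once its value at 0 has norm at most ε/2, which holds for
small h. -/
theorem exists_existsUnique_zero [CompleteSpace V] (hQ : IsOpen Q) (hk : ContDiffOn ℝ ∞ k Q)
    (h0 : ∀ x b, ((0 : ℝ), x, b) ∈ Q → k (0, x, b) = 0)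
    (h1 : ∀ x b, ((0 : ℝ), x, b) ∈ Q → fderiv ℝ k (0, x, b) (1, 0, 0) = b) {x₀ : X}
    (hmem : ((0 : ℝ), x₀, (0 : V)) ∈ Q) :
    ∃ ε₀ > 0, ∀ ε, 0 < ε → ε < ε₀ → ∀ᶠ p : ℝ × X in 𝓝 (0, x₀), p.1 ≠ 0 →
      ∃! b, ‖b‖ ≤ ε ∧ k (p.1, p.2, b) = 0 := by
  obtain ⟨δ, hδ, hest⟩ := exists_forall_norm_sub_sub_le hQ hk h0 h1 hmem
  refine ⟨δ, hδ, fun ε hε hεδ => ?_⟩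
  have hcont : ContinuousAt (fun p : ℝ × X => (p.1, p.2, (0 : V))) (0, x₀) := by fun_prop
  have hc1 : ContinuousAt (fun p : ℝ × X => |p.1|) (0, x₀) := by fun_prop
  have hc2 : ContinuousAt (fun p : ℝ × X => dist p.2 x₀) (0, x₀) := by fun_prop
  filter_upwards [hcont.eventually (eventually_norm_sub_smul_le hQ hk h0 h1 hmem (half_pos hε)),
    hc1.eventually (gt_mem_nhds (by simpa using hδ)),
    hc2.eventually (gt_mem_nhds (by simpa using hδ))] with p hp hp1 hp2 hp0
  obtain ⟨h, x⟩ := p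
  simp only at hp hp1 hp2 hp0 ⊢
  rw [smul_zero, sub_zero] at hp
  have hh : 0 < |h| := abs_pos.2 hp0
  have hG : ∀ b b', ‖b‖ ≤ ε → ‖b'‖ ≤ ε →
      ‖(b - h⁻¹ • k (h, x, b)) - (b' - h⁻¹ • k (h, x, b'))‖ ≤ 1 / 2 * ‖b - b'‖ := by
    intro b b' hb hb'
    have h2 := hest h x b b' hp1 hp2 (hb.trans_lt hεδ) (hb'.trans_lt hεδ)
    have h3 : (b - h⁻¹ • k (h, x, b)) - (b' - h⁻¹ • k (h, x, b')) =
        -(h⁻¹ • (k (h, x, b) - k (h, x, b') - h • (b - b'))) := by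
      rw [smul_sub h⁻¹ (k (h, x, b) - k (h, x, b')), inv_smul_smul₀ hp0, smul_sub]
      abel
    rw [h3, norm_neg, norm_smul, norm_inv, Real.norm_eq_abs, inv_mul_le_iff₀ hh]
    linarith
  have hzero : ∀ b, k (h, x, b) = 0 ↔ b - h⁻¹ • k (h, x, b) = b := by
    intro b
    rw [sub_eq_self, smul_eq_zero, or_iff_right (inv_ne_zero hp0)]
  have hmaps : MapsTo (fun b => b - h⁻¹ • k (h, x, b)) (Metric.closedBall 0 ε)
      (Metric.closedBall 0 ε) := by
    intro b hb
    rw [mem_closedBall_zero_iff] at hb ⊢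
    have h2 := hG b 0 hb (by simpa using hε.le)
    rw [sub_zero] at h2
    have h3 : ‖(0 : V) - h⁻¹ • k (h, x, 0)‖ ≤ ε / 2 := by
      rw [zero_sub, norm_neg, norm_smul, norm_inv, Real.norm_eq_abs, inv_mul_le_iff₀ hh]
      linarith
    have h4 := norm_add_le ((b - h⁻¹ • k (h, x, b)) - ((0 : V) - h⁻¹ • k (h, x, 0)))
      ((0 : V) - h⁻¹ • k (h, x, 0))
    rw [sub_add_cancel] at h4
    linarith
  have hcontr : ContractingWith (1 / 2) (hmaps.restrict _ _ _) := by
    refine ⟨by rw [← NNReal.coe_lt_coe]; norm_num, LipschitzWith.of_dist_le_mul fun b b' => ?_⟩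
    have hb := mem_closedBall_zero_iff.1 b.2
    have hb' := mem_closedBall_zero_iff.1 b'.2
    have := hG b b' hb hb'
    simpa [Subtype.dist_eq, dist_eq_norm] using this
  obtain ⟨b, hb, hfix, -⟩ := hcontr.exists_fixedPoint' Metric.isClosed_closedBall.isComplete hmaps
    (Metric.mem_closedBall_self hε.le) (edist_ne_top _ _)
  refine ⟨b, ⟨mem_closedBall_zero_iff.1 hb, (hzero b).2 hfix⟩, fun b' hb' => ?_⟩
  have h2 := hG b' b hb'.1 (mem_closedBall_zero_iff.1 hb)
  rw [(hzero b').1 hb'.2, show b - h⁻¹ • k (h, x, b) = b from hfix] at h2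
  have h3 : ‖b' - b‖ = 0 := le_antisymm (by linarith) (norm_nonneg _)
  exact sub_eq_zero.1 (norm_eq_zero.1 h3)

end Calculus

/-! ### A Lebesgue-number argument with variable radius. -/

section Topology

/-- A neighbourhood of the diagonal of `K` that is fine enough with respect to a given family of
sets. -/
theorem exists_isOpen_fine {P : Type*} [TopologicalSpace P] [TopologicalSpace.MetrizableSpace P]
    {K : Set P} {𝒜 : Set (Set P)} (h𝒜 : ∀ x ∈ K, ∃ A ∈ 𝒜, A ∈ 𝓝 x) :
    ∃ W : Set (P × P), IsOpen W ∧ (∀ x ∈ K, (x, x) ∈ W) ∧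
      (∀ x y z, (x, z) ∈ W → (y, z) ∈ W →
        ∃ A ∈ 𝒜, ∀ w, (x, w) ∈ W ∨ (y, w) ∈ W → w ∈ A) ∧
      ∀ x ∈ K, ∃ A ∈ 𝒜, ∀ᶠ y in 𝓝 x, ∀ w, (y, w) ∈ W → w ∈ A := by
  let _ := TopologicalSpace.metrizableSpaceMetric P
  -- The supremum R(x) of these radii is a local Lebesgue number, 1-Lipschitz in x. Admitting r ≤ 0
  -- keeps the set nonempty where no member of `𝒜` contains a ball around x.
  set G : P → Set ℝ := fun x => {r | r ≤ 1 ∧ (r ≤ 0 ∨ ∃ A ∈ 𝒜, Metric.ball x r ⊆ A)} with hG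
  set R : P → ℝ := fun x => sSup (G x) with hR
  have hbdd : ∀ x, BddAbove (G x) := fun x => ⟨1, fun r hr => hr.1⟩
  have h0 : ∀ x, (0 : ℝ) ∈ G x := fun x => ⟨zero_le_one, Or.inl le_rfl⟩
  have hlip : ∀ x y, R x ≤ R y + dist x y := by
    intro x y
    refine csSup_le ⟨0, h0 x⟩ fun r hr => ?_
    rw [← sub_le_iff_le_add]
    refine le_csSup (hbdd y) ⟨by linarith [hr.1, dist_nonneg (x := x) (y := y)], ?_⟩
    rcases hr.2 with h | ⟨A, hA, h⟩
    · exact Or.inl (by linarith [dist_nonneg (x := x) (y := y)])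
    · refine Or.inr ⟨A, hA, (Metric.ball_subset_ball' ?_).trans h⟩
      rw [dist_comm y x]; linarith
  have hcont : Continuous R := by
    refine (LipschitzWith.of_le_add fun x y => ?_ : LipschitzWith 1 R).continuous
    exact hlip x y
  have hsub : ∀ x r, 0 ≤ r → r < R x → ∃ A ∈ 𝒜, Metric.ball x r ⊆ A := by
    intro x r hr0 hr
    obtain ⟨s, hs, hrs⟩ := exists_lt_of_lt_csSup ⟨0, h0 x⟩ hr
    rcases hs.2 with h | ⟨A, hA, h⟩
    · linarith
    · exact ⟨A, hA, (Metric.ball_subset_ball hrs.le).trans h⟩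
  have hpos : ∀ x ∈ K, 0 < R x := by
    intro x hx
    obtain ⟨A, hA, hAx⟩ := h𝒜 x hx
    obtain ⟨ε, hε, hεA⟩ := Metric.mem_nhds_iff.1 hAx
    exact (lt_min hε one_pos).trans_le (le_csSup (hbdd x) ⟨min_le_right _ _,
      Or.inr ⟨A, hA, (Metric.ball_subset_ball (min_le_left _ _)).trans hεA⟩⟩)
  -- With a quarter of R, two sections with a common point lie within three steps, i.e. within 3/4
  -- of the larger R, of the centre having it; such a ball is still inside one member of `𝒜`.
  refine ⟨{p | dist p.1 p.2 < R p.1 / 4}, isOpen_lt continuous_dist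
    ((hcont.comp continuous_fst).div_const 4), fun x hx => ?_, fun x y z hxz hyz => ?_,
    fun x hx => ?_⟩
  · simpa using hpos x hx
  · simp only [mem_ofPred_eq] at hxz hyz ⊢
    have hx := dist_nonneg (x := x) (y := z)
    have hy := dist_nonneg (x := y) (y := z)
    rcases le_total (R y) (R x) with h | h
    · obtain ⟨A, hA, hAx⟩ := hsub x (3 / 4 * R x) (by linarith) (by linarith)
      refine ⟨A, hA, fun w hw => hAx ?_⟩
      rw [Metric.mem_ball, dist_comm]
      rcases hw with hw | hw
      · linarith
      · linarith [dist_triangle x z w, dist_triangle z y w, dist_comm z y]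
    · obtain ⟨A, hA, hAx⟩ := hsub y (3 / 4 * R y) (by linarith) (by linarith)
      refine ⟨A, hA, fun w hw => hAx ?_⟩
      rw [Metric.mem_ball, dist_comm]
      rcases hw with hw | hw
      · linarith [dist_triangle y z w, dist_triangle z x w, dist_comm z x]
      · linarith
  · have h := hpos x hx
    obtain ⟨A, hA, hAx⟩ := hsub x (3 / 4 * R x) (by linarith) (by linarith)
    refine ⟨A, hA, ?_⟩
    filter_upwards [Metric.ball_mem_nhds x (by linarith : 0 < R x / 4)] with y hy w hw
    rw [Metric.mem_ball] at hy
    have hw : dist y w < R y / 4 := hw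
    refine hAx ?_
    rw [Metric.mem_ball, dist_comm]
    linarith [hlip y x, dist_triangle x y w, dist_comm x y]

end Topology

end ConstrainedHamiltonian

end

noncomputable section

namespace ConstrainedHamiltonian

/-! ### The neighbourhood O and its fibres. -/

section LocalFibres

variable {E V P : Type*} [NormedAddCommGroup E] [NormedSpace ℝ E] [FiniteDimensional ℝ E]
  [NormedAddCommGroup V] [NormedSpace ℝ V] [TopologicalSpace P] [ChartedSpace E P]

/-- A neighbourhood of the diagonal of the hidden constraint set, fine with respect to the flow
boxes inside `N`. -/
structure IsFine (Ω : SymplecticForm E P) (g : P → V) (H : P → ℝ) (N : Set P)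
    (W : Set (P × P)) : Prop where
  isOpen : IsOpen W
  diag : ∀ m ∈ hiddenSet Ω g H, (m, m) ∈ W
  box : ∀ x y z, (x, z) ∈ W → (y, z) ∈ W →
    ∃ (n : ℕ) (θ : OpenPartialHomeomorph P (EuclideanSpace ℝ (Fin n) × V × V)),
      IsFlowBox Ω g H θ ∧ ∀ w, (x, w) ∈ W ∨ (y, w) ∈ W → w ∈ θ.source ∩ N

/-- The fibre of `m` inside the `m`-section of `W`. -/
def localFibre (Ω : SymplecticForm E P) (g : P → V) (W : Set (P × P)) (m : P) : Set P :=
  fibreIn Ω g {y | (m, y) ∈ W} m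

/-- The union of the local fibres through the points of the hidden constraint set, together with
the complement of the constraint manifold. -/
def fibredNhd (Ω : SymplecticForm E P) (g : P → V) (H : P → ℝ) (N : Set P) (W : Set (P × P)) :
    Set P :=
  {z | z ∈ N ∧ (z ∈ constraintSet g → ∃ m ∈ hiddenSet Ω g H, z ∈ localFibre Ω g W m)}

variable {Ω : SymplecticForm E P} {g : P → V} {H : P → ℝ} {N : Set P} {W : Set (P × P)}

/-- In the box the curve from m to z is (a, b(t), 0) with b(0) = 0. For z' near z on M with
coordinates (a', b', 0), the curve (a', b(t) + t(b' − b(1)), 0) joins the hidden point (a', 0, 0) to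
z'. As [0, 1] is compact and W is open, it stays in the W-section of its own starting point. -/
theorem eventually_mem_localFibre (hW : IsOpen W) {n : ℕ}
    {θ : OpenPartialHomeomorph P (EuclideanSpace ℝ (Fin n) × V × V)} (hθ : IsFlowBox Ω g H θ)
    (hcois : IsCoisotropic Ω g) {m : P} (hm : m ∈ hiddenSet Ω g H)
    (hWθ : ∀ w, (m, w) ∈ W → w ∈ θ.source) {z : P} (hz : z ∈ localFibre Ω g W m) :
    ∀ᶠ z' in 𝓝 z, z' ∈ constraintSet g → ((θ z').1, (0 : V), (0 : V)) ∈ θ.target ∧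
      z' ∈ localFibre Ω g W (θ.symm ((θ z').1, 0, 0)) := by
  obtain ⟨γ, h1, rfl, rfl, h4⟩ := hz
  set b : ℝ → V := fun t => (θ (γ t)).2.1 with hb
  set a := (θ (γ 0)).1 with ha
  have hs : ∀ t ∈ Icc (0 : ℝ) 1, γ t ∈ θ.source := fun t ht => hWθ _ (h4 t ht).2.1
  have hm0 : θ (γ 0) = (a, 0, 0) := hθ.apply_eq_of_mem_hiddenSet hcois hm (hs 0 (by simp))
  have hγθ : ∀ t ∈ Icc (0 : ℝ) 1, θ (γ t) = (a, b t, 0) := fun t ht =>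
    Prod.ext (hθ.fst_eq_of_leafCurve h1 h4 hWθ ht)
      (Prod.ext rfl ((hθ.constraint_eq _ (hs t ht)).trans (h4 t ht).1))
  have hb0 : b 0 = 0 := by simp only [hb]; rw [hm0]
  have hbs : ContDiffOn ℝ 1 b (Icc 0 1) := by
    have h5 : ContMDiffOn 𝓘(ℝ, ℝ) 𝓘(ℝ, EuclideanSpace ℝ (Fin n) × V × V) 1 (θ ∘ γ)
      (Icc 0 1) := (hθ.smooth.of_le (by simp)).comp h1.contMDiffOn hs
    exact (contMDiffOn_iff_contDiffOn.1 h5).snd.fst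
  have hbc : ∀ t ∈ Icc (0 : ℝ) 1, ContinuousAt b t := fun t ht =>
    continuous_snd.fst.continuousAt.comp ((θ.continuousAt (hs t ht)).comp h1.continuous.continuousAt)
  have hev : ∀ᶠ p : EuclideanSpace ℝ (Fin n) × V in 𝓝 (a, b 1), ∀ t ∈ Icc (0 : ℝ) 1,
      (p.1, b t + t • (p.2 - b 1), (0 : V)) ∈ θ.target ∧ (p.1, (0 : V), (0 : V)) ∈ θ.target ∧
      (θ.symm (p.1, 0, 0), θ.symm (p.1, b t + t • (p.2 - b 1), 0)) ∈ W := by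
    refine isCompact_Icc.eventually_forall_of_forall_eventually fun t ht => ?_
    have hc : ContinuousAt (fun q : (EuclideanSpace ℝ (Fin n) × V) × ℝ =>
        (q.1.1, b q.2 + q.2 • (q.1.2 - b 1), (0 : V))) ((a, b 1), t) := by
      have h5 : ContinuousAt (fun q : (EuclideanSpace ℝ (Fin n) × V) × ℝ => b q.2)
        ((a, b 1), t) := ContinuousAt.comp (g := b) (hbc t ht) continuous_snd.continuousAt
      fun_prop
    have hc' : ContinuousAt (fun q : (EuclideanSpace ℝ (Fin n) × V) × ℝ =>
        (q.1.1, (0 : V), (0 : V))) ((a, b 1), t) := by fun_prop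
    have he : (a, b t + t • (b 1 - b 1), (0 : V)) = θ (γ t) := by
      rw [hγθ t ht, sub_self, smul_zero, add_zero]
    have ht1 : (a, b t + t • (b 1 - b 1), (0 : V)) ∈ θ.target := he ▸ θ.map_source (hs t ht)
    have ht2 : (a, (0 : V), (0 : V)) ∈ θ.target := hm0 ▸ θ.map_source (hs 0 (by simp))
    have hcW : ContinuousAt (fun q : (EuclideanSpace ℝ (Fin n) × V) × ℝ =>
        (θ.symm (q.1.1, 0, 0), θ.symm (q.1.1, b q.2 + q.2 • (q.1.2 - b 1), 0)))
        ((a, b 1), t) :=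
      (ContinuousAt.comp (g := θ.symm) (x := ((a, b 1), t))
        (f := fun q : (EuclideanSpace ℝ (Fin n) × V) × ℝ => (q.1.1, (0 : V), (0 : V)))
        (θ.continuousAt_symm ht2) hc').prodMk
      (ContinuousAt.comp (g := θ.symm) (x := ((a, b 1), t))
        (f := fun q : (EuclideanSpace ℝ (Fin n) × V) × ℝ =>
          (q.1.1, b q.2 + q.2 • (q.1.2 - b 1), (0 : V))) (θ.continuousAt_symm ht1) hc)
    have hWt : (θ.symm (a, 0, 0), θ.symm (a, b t + t • (b 1 - b 1), 0)) ∈ W := by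
      rw [he, ← hm0, θ.left_inv (hs 0 (by simp)), θ.left_inv (hs t ht)]
      exact (h4 t ht).2.1
    exact (hc.eventually (θ.open_target.mem_nhds ht1)).and
      ((hc'.eventually (θ.open_target.mem_nhds ht2)).and (hcW.eventually (hW.mem_nhds hWt)))
  have hz1 : γ 1 ∈ θ.source := hs 1 (by simp)
  have hcz : Tendsto (fun z => ((θ z).1, (θ z).2.1)) (𝓝 (γ 1)) (𝓝 (a, b 1)) := by
    have h5 : ((θ (γ 1)).1, (θ (γ 1)).2.1) = (a, b 1) := by rw [hγθ 1 (by simp)]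
    have h6 := θ.continuousAt hz1
    have h7 : ContinuousAt (fun z => ((θ z).1, (θ z).2.1)) (γ 1) := by fun_prop
    exact h5 ▸ h7.tendsto
  filter_upwards [hcz.eventually hev, θ.open_source.mem_nhds hz1] with z' hz' hz's hz'M
  have h0 := hz' 0 (by simp)
  refine ⟨h0.2.1, ?_⟩
  have h5 := hθ.mem_fibreIn_of_curve (a := (θ z').1)
    (O := {y | (θ.symm ((θ z').1, 0, 0), y) ∈ W})
    (c := fun t => b t + t • ((θ z').2.1 - b 1))
    (hbs.add (by fun_prop)) fun t ht => ⟨(hz' t ht).1, (hz' t ht).2.2⟩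
  have h6 : ((θ z').1, (θ z').2.1, (0 : V)) = θ z' :=
    Prod.ext rfl (Prod.ext rfl ((hθ.constraint_eq z' hz's).trans hz'M).symm)
  simp only [hb0, zero_smul, add_zero, one_smul, add_sub_cancel, h6, θ.left_inv hz's] at h5
  exact h5

namespace IsFine

theorem self_mem_localFibre (hW : IsFine Ω g H N W) {m : P} (hm : m ∈ hiddenSet Ω g H) :
    m ∈ localFibre Ω g W m :=
  mem_fibreIn_self hm.1 (hW.diag m hm)

theorem localFibre_subset (hW : IsFine Ω g H N W) {m : P} :
    localFibre Ω g W m ⊆ constraintSet g ∩ N := fun z hz => by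
  have h1 := fibreIn_subset _ hz
  obtain ⟨n, θ, -, h⟩ := hW.box m m z h1.2 h1.2
  exact ⟨h1.1, (h z (Or.inl h1.2)).2⟩

/-- Fineness puts both pieces in one box. Sharing a point, they have the same transverse coordinates
a, and (a, 0, 0) is the only hidden point of the box with these coordinates. -/
theorem eq_of_mem_localFibre (hW : IsFine Ω g H N W) (hcois : IsCoisotropic Ω g) {m m' z : P}
    (hm : m ∈ hiddenSet Ω g H) (hm' : m' ∈ hiddenSet Ω g H) (hz : z ∈ localFibre Ω g W m)
    (hz' : z ∈ localFibre Ω g W m') : m = m' := by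
  obtain ⟨n, θ, hθ, h⟩ := hW.box m m' z (fibreIn_subset _ hz).2 (fibreIn_subset _ hz').2
  have h1 : m ∈ θ.source := (h m (Or.inl (hW.diag m hm))).1
  have h2 : m' ∈ θ.source := (h m' (Or.inr (hW.diag m' hm'))).1
  refine θ.injOn h1 h2 ?_
  rw [hθ.apply_eq_of_mem_hiddenSet hcois hm h1, hθ.apply_eq_of_mem_hiddenSet hcois hm' h2,
    ← hθ.fst_eq_of_mem_fibreIn (fun w hw => (h w (Or.inl hw)).1) hz,
    ← hθ.fst_eq_of_mem_fibreIn (fun w hw => (h w (Or.inr hw)).1) hz']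

theorem eq_of_mem_hiddenSet (hW : IsFine Ω g H N W) (hcois : IsCoisotropic Ω g) {m z : P}
    (hm : m ∈ hiddenSet Ω g H) (hz : z ∈ localFibre Ω g W m) (hzH : z ∈ hiddenSet Ω g H) :
    z = m :=
  hW.eq_of_mem_localFibre hcois hzH hm (hW.self_mem_localFibre hzH) hz

theorem localFibre_subset_fibredNhd (hW : IsFine Ω g H N W) {m : P}
    (hm : m ∈ hiddenSet Ω g H) : localFibre Ω g W m ⊆ fibredNhd Ω g H N W := fun _ hz =>
  ⟨(hW.localFibre_subset hz).2, fun _ => ⟨m, hm, hz⟩⟩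

theorem hiddenSet_subset_fibredNhd (hW : IsFine Ω g H N W) :
    hiddenSet Ω g H ⊆ fibredNhd Ω g H N W := fun _ hm =>
  hW.localFibre_subset_fibredNhd hm (hW.self_mem_localFibre hm)

theorem isOpen_fibredNhd (hW : IsFine Ω g H N W) (hcois : IsCoisotropic Ω g) (hN : IsOpen N)
    (hg : Continuous g) : IsOpen (fibredNhd Ω g H N W) := by
  rw [isOpen_iff_mem_nhds]
  rintro z ⟨hzN, hz⟩
  by_cases hzM : z ∈ constraintSet g
  · obtain ⟨m, hm, hzm⟩ := hz hzM
    have hmW := hW.diag m hm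
    obtain ⟨n, θ, hθ, h⟩ := hW.box m m m hmW hmW
    filter_upwards [hN.mem_nhds hzN, eventually_mem_localFibre hW.isOpen hθ hcois hm
      (fun w hw => (h w (Or.inl hw)).1) hzm] with z' h1 h2
    exact ⟨h1, fun h3 => ⟨_, hθ.symm_mem_hiddenSet hcois (h2 h3).1, (h2 h3).2⟩⟩
  · have hM : IsClosed (constraintSet g) := isClosed_singleton.preimage hg
    filter_upwards [hN.mem_nhds hzN, hM.isOpen_compl.mem_nhds hzM] with z' h1 h2
    exact ⟨h1, fun h3 => absurd h3 h2⟩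

/-- The fibres inside the fibred neighbourhood are the local fibres. -/
theorem fibreIn_fibredNhd (hW : IsFine Ω g H N W) (hcois : IsCoisotropic Ω g) {m z : P}
    (hm : m ∈ hiddenSet Ω g H) (hz : z ∈ localFibre Ω g W m) :
    fibreIn Ω g (fibredNhd Ω g H N W) z = localFibre Ω g W m := by
  refine Subset.antisymm ?_ fun y hy => ?_
  · rintro _ ⟨γ, h1, rfl, rfl, h4⟩
    have hex : ∀ t : Icc (0 : ℝ) 1, ∃ m ∈ hiddenSet Ω g H, γ t ∈ localFibre Ω g W m :=
      fun t => (h4 t t.2).2.1.2 (h4 t t.2).1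
    choose μ hμ hμ' using hex
    -- A short piece of the curve stays in the open W-section of the base point `μ t`, hence in its
    -- local fibre; by disjointness of the local fibres the base point does not change. As [0, 1] is
    -- connected, it is constant.
    have hloc : IsLocallyConstant μ := by
      refine (IsLocallyConstant.iff_eventually_eq μ).2 fun t => ?_
      have hO : IsOpen {y | (μ t, y) ∈ W} := hW.isOpen.preimage (by fun_prop)
      have h5 : ∀ᶠ s in 𝓝 (t : ℝ), γ s ∈ {y | (μ t, y) ∈ W} :=
        h1.continuous.continuousAt.eventually (hO.mem_nhds (fibreIn_subset _ (hμ' t)).2)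
      obtain ⟨ε, hε, hball⟩ := Metric.eventually_nhds_iff_ball.1 h5
      filter_upwards [Metric.ball_mem_nhds t hε] with s hs
      have hseg : ∀ r ∈ uIcc (t : ℝ) s, r ∈ Metric.ball (t : ℝ) ε := fun r hr =>
        (convex_ball (t : ℝ) ε).ordConnected.uIcc_subset (Metric.mem_ball_self hε) hs hr
      have hseg' : ∀ r ∈ uIcc (t : ℝ) s, r ∈ Icc (0 : ℝ) 1 := fun r hr =>
        ordConnected_Icc.uIcc_subset t.2 s.2 hr
      have h6 : γ s ∈ fibreIn Ω g {y | (μ t, y) ∈ W} (γ t) :=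
        mem_fibreIn_of_segment h1 (fun r hr => h4 r (hseg' r hr)) fun r hr => hball r (hseg r hr)
      exact hW.eq_of_mem_localFibre hcois (hμ s) (hμ t) (hμ' s) (fibreIn_trans (hμ' t) h6)
    have h7 := hloc.apply_eq_of_preconnectedSpace ⟨1, by simp⟩ ⟨0, by simp⟩
    have h8 : μ ⟨0, by simp⟩ = m :=
      hW.eq_of_mem_localFibre hcois (hμ _) hm (hμ' ⟨0, by simp⟩) hz
    have h9 := hμ' ⟨1, by simp⟩
    rwa [h7, h8] at h9
  · have h5 : ∀ y ∈ localFibre Ω g W m, y ∈ fibreIn Ω g (fibredNhd Ω g H N W) m := fun y hy =>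
      fibreIn_mono (hW.localFibre_subset_fibredNhd hm) m (mem_fibreIn_fibreIn hy)
    exact fibreIn_trans (fibreIn_symm (h5 z hz)) (h5 y hy)

end IsFine

end LocalFibres

end ConstrainedHamiltonian

end

noncomputable section

namespace ConstrainedHamiltonian

theorem isOpen_target_slice {V P : Type*} [NormedAddCommGroup V] [TopologicalSpace P] {n : ℕ}
    (θ : OpenPartialHomeomorph P (EuclideanSpace ℝ (Fin n) × V × V)) :
    IsOpen {p : ℝ × EuclideanSpace ℝ (Fin n) × V | (p.2.1, p.2.2, (0 : V)) ∈ θ.target} :=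
  θ.open_target.preimage (by fun_prop)

/-! ### The Shake equation in a flow box. -/

section Method

variable {E V P : Type*} [NormedAddCommGroup E] [NormedSpace ℝ E] [FiniteDimensional ℝ E]
  [NormedAddCommGroup V] [NormedSpace ℝ V] [TopologicalSpace P] [ChartedSpace E P]

namespace IsConsistentMethod

variable {Ω : SymplecticForm E P} {g : P → V} {H : P → ℝ} {Φ : ℝ → P → P} {D : Set (ℝ × P)}

theorem mdifferentiableAt (hΦ : IsConsistentMethod Ω H Φ D) (y : P) :
    MDifferentiableAt 𝓘(ℝ, ℝ) 𝓘(ℝ, E) (fun h => Φ h y) 0 := by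
  have h1 : ContMDiffAt (𝓘(ℝ, ℝ).prod 𝓘(ℝ, E)) 𝓘(ℝ, E) ∞ (fun q : ℝ × P => Φ q.1 q.2)
    ((0 : ℝ), y) := hΦ.smooth.contMDiffAt (hΦ.isOpen.mem_nhds (hΦ.mem y))
  have h2 : ContMDiffAt 𝓘(ℝ, ℝ) (𝓘(ℝ, ℝ).prod 𝓘(ℝ, E)) ∞ (fun h : ℝ => (h, y)) 0 :=
    contMDiffAt_id.prodMk contMDiffAt_const
  exact (ContMDiffAt.comp (g := fun q : ℝ × P => Φ q.1 q.2) (0 : ℝ) h1 h2).mdifferentiableAt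
    (by simp)

/-- This is where consistency enters: to first order in h, the method moves g by dg(X_H), the
coordinate b of the box. -/
theorem hasDerivAt_constraint (hΦ : IsConsistentMethod Ω H Φ D)
    (hg : ContMDiff 𝓘(ℝ, E) 𝓘(ℝ, V) ∞ g) (y : P) :
    HasDerivAt (fun h => g (Φ h y)) (hiddenFun Ω g H y) 0 := by
  have h1 := hΦ.mdifferentiableAt y
  have h2 := hg.mdifferentiable (by simp) (Φ 0 y)
  have h3 := mfderiv_comp (0 : ℝ) h2 h1
  rw [mfderiv_eq_fderiv] at h3
  have h4 : DifferentiableAt ℝ (g ∘ fun h => Φ h y) 0 :=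
    mdifferentiableAt_iff_differentiableAt.1 (h2.comp (0 : ℝ) h1)
  have h5 := h4.hasFDerivAt.hasDerivAt
  have h6 : fderiv ℝ (g ∘ fun h => Φ h y) 0 1 = hiddenFun Ω g H (Φ 0 y) := by
    refine (DFunLike.congr_fun h3 (1 : ℝ)).trans ?_
    exact congrArg (mfderiv 𝓘(ℝ, E) 𝓘(ℝ, V) g (Φ 0 y)) (hΦ.consistent y)
  rw [h6, hΦ.zero] at h5
  exact h5

end IsConsistentMethod

variable {n : ℕ}

/-- The constraint function after one step of the method, in the coordinates of a flow box. -/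
def stepConstraint (g : P → V) (Φ : ℝ → P → P)
    (θ : OpenPartialHomeomorph P (EuclideanSpace ℝ (Fin n) × V × V))
    (p : ℝ × EuclideanSpace ℝ (Fin n) × V) : V :=
  g (Φ p.1 (θ.symm (p.2.1, p.2.2, 0)))

/-- The domain of `stepConstraint`. -/
def stepDomain (D : Set (ℝ × P))
    (θ : OpenPartialHomeomorph P (EuclideanSpace ℝ (Fin n) × V × V)) :
    Set (ℝ × EuclideanSpace ℝ (Fin n) × V) :=
  {p | (p.2.1, p.2.2, (0 : V)) ∈ θ.target} ∩ (fun p => (p.1, θ.symm (p.2.1, p.2.2, 0))) ⁻¹' D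

variable {Ω : SymplecticForm E P} {g : P → V} {H : P → ℝ} {Φ : ℝ → P → P} {D : Set (ℝ × P)}
  {θ : OpenPartialHomeomorph P (EuclideanSpace ℝ (Fin n) × V × V)}

theorem IsFlowBox.contMDiffOn_step (hθ : IsFlowBox Ω g H θ) :
    ContMDiffOn 𝓘(ℝ, ℝ × EuclideanSpace ℝ (Fin n) × V) (𝓘(ℝ, ℝ).prod 𝓘(ℝ, E)) ∞
      (fun p : ℝ × EuclideanSpace ℝ (Fin n) × V => (p.1, θ.symm (p.2.1, p.2.2, 0)))
      {p | (p.2.1, p.2.2, (0 : V)) ∈ θ.target} := by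
  have h1 : ContDiff ℝ ∞ (fun p : ℝ × EuclideanSpace ℝ (Fin n) × V =>
    (p.2.1, p.2.2, (0 : V))) := by fun_prop
  have h2 : ContDiff ℝ ∞ (fun p : ℝ × EuclideanSpace ℝ (Fin n) × V => p.1) := by fun_prop
  exact h2.contMDiff.contMDiffOn.prodMk
    (hθ.smooth_symm.comp h1.contMDiff.contMDiffOn fun p hp => hp)

theorem IsFlowBox.isOpen_stepDomain (hθ : IsFlowBox Ω g H θ) (hD : IsOpen D) :
    IsOpen (stepDomain D θ) :=
  hθ.contMDiffOn_step.continuousOn.isOpen_inter_preimage (isOpen_target_slice θ) hD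

theorem IsFlowBox.contMDiffOn_step_map (hθ : IsFlowBox Ω g H θ)
    (hΦ : IsConsistentMethod Ω H Φ D) :
    ContMDiffOn 𝓘(ℝ, ℝ × EuclideanSpace ℝ (Fin n) × V) 𝓘(ℝ, E) ∞
      (fun p : ℝ × EuclideanSpace ℝ (Fin n) × V => Φ p.1 (θ.symm (p.2.1, p.2.2, 0)))
      (stepDomain D θ) :=
  ContMDiffOn.comp (g := fun q : ℝ × P => Φ q.1 q.2) hΦ.smooth
    (hθ.contMDiffOn_step.mono inter_subset_left) fun _ hp => hp.2

theorem IsFlowBox.contDiffOn_stepConstraint (hθ : IsFlowBox Ω g H θ)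
    (hΦ : IsConsistentMethod Ω H Φ D) (hg : ContMDiff 𝓘(ℝ, E) 𝓘(ℝ, V) ∞ g) :
    ContDiffOn ℝ ∞ (stepConstraint g Φ θ) (stepDomain D θ) :=
  contMDiffOn_iff_contDiffOn.1 (hg.comp_contMDiffOn (hθ.contMDiffOn_step_map hΦ))

theorem IsFlowBox.stepConstraint_zero (hθ : IsFlowBox Ω g H θ)
    (hΦ : IsConsistentMethod Ω H Φ D) (a b) (h : ((0 : ℝ), a, b) ∈ stepDomain D θ) :
    stepConstraint g Φ θ (0, a, b) = 0 := by
  simp only [stepConstraint, hΦ.zero]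
  exact hθ.constraint_symm h.1

theorem IsFlowBox.fderiv_stepConstraint (hθ : IsFlowBox Ω g H θ)
    (hΦ : IsConsistentMethod Ω H Φ D) (hg : ContMDiff 𝓘(ℝ, E) 𝓘(ℝ, V) ∞ g) (a b)
    (h : ((0 : ℝ), a, b) ∈ stepDomain D θ) :
    fderiv ℝ (stepConstraint g Φ θ) (0, a, b) (1, 0, 0) = b := by
  have h1 : HasFDerivAt (stepConstraint g Φ θ) (fderiv ℝ (stepConstraint g Φ θ) (0, a, b))
      (0, a, b) := (((hθ.contDiffOn_stepConstraint hΦ hg).contDiffAt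
    ((hθ.isOpen_stepDomain hΦ.isOpen).mem_nhds h)).differentiableAt (by simp)).hasFDerivAt
  have h2 := HasFDerivAt.comp_hasDerivAt (l := stepConstraint g Φ θ) (0 : ℝ) h1
      ((hasDerivAt_id (0 : ℝ)).prodMk ((hasDerivAt_const (0 : ℝ) a).prodMk
        (hasDerivAt_const (0 : ℝ) b)))
  have h3 := hΦ.hasDerivAt_constraint hg (θ.symm (a, b, 0))
  exact (h2.unique h3).trans (hθ.hiddenFun_symm h.1)

variable [T2Space P] [CompleteSpace V] {N O : Set P} {W : Set (P × P)}

/-- Solvability of the Shake equation on the local fibres. -/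
theorem eventually_existsUnique_localFibre (hΦ : IsConsistentMethod Ω H Φ D)
    (hg : ContMDiff 𝓘(ℝ, E) 𝓘(ℝ, V) ∞ g) (hcois : IsCoisotropic Ω g) (hW : IsFine Ω g H N W)
    (hO : IsOpen O) {m₀ : P} (hm₀ : m₀ ∈ hiddenSet Ω g H) (hm₀O : m₀ ∈ O) {A : Set P}
    (hA : IsCompact A) (hθ : IsFlowBox Ω g H θ) (hAθ : A ⊆ θ.source)
    (hWA : ∀ᶠ m in 𝓝 m₀, ∀ w, (m, w) ∈ W → w ∈ A) :
    ∀ᶠ p : ℝ × P in 𝓝 (0, m₀), p.1 ≠ 0 → p.2 ∈ hiddenSet Ω g H →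
      (∀ y ∈ localFibre Ω g W p.2, (p.1, y) ∈ D) ∧
      (∃! y, y ∈ localFibre Ω g W p.2 ∧ g (Φ p.1 y) = 0) ∧
      ∀ y ∈ localFibre Ω g W p.2, g (Φ p.1 y) = 0 → Φ p.1 y ∈ O := by
  have hWm₀ : ∀ w, (m₀, w) ∈ W → w ∈ θ.source := fun w hw => hAθ (hWA.self_of_nhds w hw)
  have hm₀θ : m₀ ∈ θ.source := hWm₀ _ (hW.diag _ hm₀)
  set a₀ := (θ m₀).1 with ha₀
  have hθm₀ : θ m₀ = (a₀, 0, 0) := hθ.apply_eq_of_mem_hiddenSet hcois hm₀ hm₀θ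
  have ht₀ : (a₀, (0 : V), (0 : V)) ∈ θ.target := hθm₀ ▸ θ.map_source hm₀θ
  have hsymm : θ.symm (a₀, 0, 0) = m₀ := by rw [← hθm₀, θ.left_inv hm₀θ]
  have hQ := hθ.isOpen_stepDomain hΦ.isOpen
  have hk := hθ.contDiffOn_stepConstraint hΦ hg
  have hk0 := hθ.stepConstraint_zero hΦ
  have hk1 := hθ.fderiv_stepConstraint hΦ hg
  have hmem : ((0 : ℝ), a₀, (0 : V)) ∈ stepDomain D θ := ⟨ht₀, hΦ.mem _⟩
  obtain ⟨ε₀, hε₀, hnear⟩ := exists_existsUnique_zero hQ hk hk0 hk1 hmem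
  -- Near the centre of the box every point (a, b, 0) really belongs to the local fibre of (a, 0,
  -- 0), so a root b found in coordinates is a solution on the fibre.
  have hloc : ∀ᶠ p : ℝ × EuclideanSpace ℝ (Fin n) × V in 𝓝 (0, a₀, 0),
      (p.2.1, p.2.2, (0 : V)) ∈ θ.target ∧ Φ p.1 (θ.symm (p.2.1, p.2.2, 0)) ∈ O ∧
      θ.symm (p.2.1, p.2.2, 0) ∈ localFibre Ω g W (θ.symm (p.2.1, 0, 0)) := by
    have h1 : ∀ᶠ p : ℝ × EuclideanSpace ℝ (Fin n) × V in 𝓝 (0, a₀, 0),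
        Φ p.1 (θ.symm (p.2.1, p.2.2, 0)) ∈ O :=
      ((hθ.contMDiffOn_step_map hΦ).continuousOn.continuousAt (hQ.mem_nhds hmem)).eventually
        (hO.mem_nhds (by simpa [hsymm, hΦ.zero] using hm₀O))
    have h2 : ContinuousAt (fun p : ℝ × EuclideanSpace ℝ (Fin n) × V =>
        θ.symm (p.2.1, p.2.2, 0)) (0, a₀, 0) :=
      ContinuousAt.comp (g := θ.symm) (x := ((0 : ℝ), a₀, (0 : V)))
        (f := fun p : ℝ × EuclideanSpace ℝ (Fin n) × V => (p.2.1, p.2.2, (0 : V)))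
        (θ.continuousAt_symm ht₀) (by fun_prop)
    have h3 := h2.tendsto
    simp only [hsymm] at h3
    filter_upwards [(isOpen_target_slice θ).mem_nhds ht₀, h1, h3.eventually
      (eventually_mem_localFibre hW.isOpen hθ hcois hm₀ hWm₀ (hW.self_mem_localFibre hm₀))]
      with p hp1 hp2 hp3
    refine ⟨hp1, hp2, ?_⟩
    have h4 := (hp3 (hθ.constraint_symm hp1)).2
    rwa [θ.right_inv hp1] at h4
  obtain ⟨δ, hδ, hball⟩ := Metric.eventually_nhds_iff.1 hloc
  -- This ε separates two regimes: for ‖b‖ ≤ ε the contraction argument gives one root, for ‖b‖ ≥ ε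
  -- there is none.
  obtain ⟨ε, hε, hεlt⟩ := exists_between (lt_min hδ hε₀)
  have hεδ : ε < δ := hεlt.trans_le (min_le_left _ _)
  have hnear := hnear ε hε (hεlt.trans_le (min_le_right _ _))
  have hcθ : ContinuousOn (fun y => (θ y).2.1) A :=
    continuous_snd.fst.comp_continuousOn (θ.continuousOn.mono hAθ)
  have hcpt : IsCompact (A ∩ constraintSet g ∩ (fun y => (θ y).2.1) ⁻¹' {b | ε ≤ ‖b‖}) := by
    have h1 : IsCompact (A ∩ constraintSet g) :=
      hA.inter_right (isClosed_singleton.preimage hg.continuous)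
    exact h1.of_isClosed_subset ((hcθ.mono inter_subset_left).preimage_isClosed_of_isClosed
      h1.isClosed (isClosed_le continuous_const continuous_norm)) inter_subset_left
  -- Each point with b ≠ 0 has a neighbourhood free of roots for small h ≠ 0; compactness makes the
  -- bound on h uniform.
  have hfar : ∀ᶠ h : ℝ in 𝓝 0,
      ∀ y ∈ A ∩ constraintSet g ∩ (fun y => (θ y).2.1) ⁻¹' {b | ε ≤ ‖b‖},
        h ≠ 0 → stepConstraint g Φ θ (h, (θ y).1, (θ y).2.1) ≠ 0 := by
    refine hcpt.eventually_forall_of_forall_eventually fun y hy => ?_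
    have hys := hAθ hy.1.1
    have h1 : ContinuousAt (fun z : ℝ × P => (z.1, (θ z.2).1, (θ z.2).2.1)) (0, y) := by
      have h2 : ContinuousAt (fun z : ℝ × P => θ z.2) (0, y) :=
        ContinuousAt.comp (g := θ) (x := ((0 : ℝ), y)) (θ.continuousAt hys)
          continuous_snd.continuousAt
      exact continuous_fst.continuousAt.prodMk (h2.fst.prodMk h2.snd.fst)
    have h3 : θ y = ((θ y).1, (θ y).2.1, 0) :=
      Prod.ext rfl (Prod.ext rfl ((hθ.constraint_eq y hys).trans hy.1.2))
    have h4 : ((θ y).1, (θ y).2.1, (0 : V)) ∈ θ.target := h3 ▸ θ.map_source hys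
    have h5 : (θ y).2.1 ≠ 0 := norm_pos_iff.1 (hε.trans_le hy.2)
    exact h1.eventually (eventually_ne_zero hQ hk hk0 hk1 ⟨h4, hΦ.mem _⟩ h5)
  have hD : ∀ᶠ h : ℝ in 𝓝 0, ∀ y ∈ A, (h, y) ∈ D :=
    hA.eventually_forall_of_forall_eventually fun y _ => hΦ.isOpen.mem_nhds (hΦ.mem y)
  have hca : Tendsto (fun p : ℝ × P => (p.1, (θ p.2).1)) (𝓝 (0, m₀)) (𝓝 (0, a₀)) := by
    have h1 : ContinuousAt (fun p : ℝ × P => θ p.2) (0, m₀) :=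
      ContinuousAt.comp (g := θ) (x := ((0 : ℝ), m₀)) (θ.continuousAt hm₀θ)
        continuous_snd.continuousAt
    exact continuous_fst.continuousAt.prodMk h1.fst
  filter_upwards [continuous_fst.continuousAt.eventually (hfar.and hD),
    continuous_snd.continuousAt.eventually hWA, hca.eventually hnear,
    hca.eventually (Metric.ball_mem_nhds _ hδ)] with p hp1 hp2 hp3 hp4 hp0 hpH
  obtain ⟨h, m⟩ := p
  obtain ⟨hpfar, hpD⟩ := hp1
  simp only at hpfar hpD hp2 hp3 hp0 hpH hp4 ⊢
  have hWm : ∀ w, (m, w) ∈ W → w ∈ θ.source := fun w hw => hAθ (hp2 w hw)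
  have hmθ : m ∈ θ.source := hWm _ (hW.diag _ hpH)
  have hθm : θ m = ((θ m).1, 0, 0) := hθ.apply_eq_of_mem_hiddenSet hcois hpH hmθ
  have hsm : θ.symm ((θ m).1, 0, 0) = m := by rw [← hθm, θ.left_inv hmθ]
  have hpA : ∀ y ∈ localFibre Ω g W m, y ∈ A := fun y hy => hp2 y (fibreIn_subset _ hy).2
  have hyeq : ∀ y ∈ localFibre Ω g W m, θ y = ((θ m).1, (θ y).2.1, 0) := fun y hy =>
    Prod.ext (hθ.fst_eq_of_mem_fibreIn hWm hy) (Prod.ext rfl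
      ((hθ.constraint_eq y (hAθ (hpA y hy))).trans (fibreIn_subset _ hy).1))
  have hstep : ∀ y ∈ localFibre Ω g W m,
      θ.symm ((θ m).1, (θ y).2.1, 0) = y := fun y hy => by
    rw [← hyeq y hy, θ.left_inv (hAθ (hpA y hy))]
  have hsmall : ∀ y ∈ localFibre Ω g W m, g (Φ h y) = 0 → ‖(θ y).2.1‖ ≤ ε ∧
      stepConstraint g Φ θ (h, (θ m).1, (θ y).2.1) = 0 := by
    intro y hy hgy
    have h1 : stepConstraint g Φ θ (h, (θ m).1, (θ y).2.1) = 0 := by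
      simp only [stepConstraint, hstep y hy, hgy]
    refine ⟨?_, h1⟩
    by_contra hlt
    refine hpfar y ⟨⟨hpA y hy, (fibreIn_subset _ hy).1⟩, (not_le.1 hlt).le⟩ hp0 ?_
    rwa [hθ.fst_eq_of_mem_fibreIn hWm hy]
  rw [Prod.dist_eq, max_lt_iff] at hp4
  have hb : ∀ b : V, ‖b‖ ≤ ε → ((θ m).1, b, (0 : V)) ∈ θ.target ∧
      Φ h (θ.symm ((θ m).1, b, 0)) ∈ O ∧
      θ.symm ((θ m).1, b, 0) ∈ localFibre Ω g W m := by
    intro b hb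
    have h1 := @hball (h, (θ m).1, b) (by
      rw [Prod.dist_eq, Prod.dist_eq, max_lt_iff, max_lt_iff]
      exact ⟨hp4.1, hp4.2, by simpa using hb.trans_lt hεδ⟩)
    simpa only [hsm] using h1
  refine ⟨fun y hy => hpD y (hpA y hy), ?_, fun y hy hgy => ?_⟩
  · obtain ⟨b, ⟨hb1, hb2⟩, hbu⟩ := hp3 hp0
    refine ⟨θ.symm ((θ m).1, b, 0), ⟨(hb b hb1).2.2, hb2⟩, fun y hy => ?_⟩
    rw [← hbu _ (hsmall y hy.1 hy.2), hstep y hy.1]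
  · have h1 := (hb _ (hsmall y hy hgy).1).2.1
    rwa [hstep y hy] at h1

end Method

end ConstrainedHamiltonian

end

noncomputable section

namespace ConstrainedHamiltonian

/-! ### Patching the boxes and the final statement. -/

section Global

variable {E V P : Type*} [NormedAddCommGroup E] [NormedSpace ℝ E] [FiniteDimensional ℝ E]
  [NormedAddCommGroup V] [NormedSpace ℝ V] [FiniteDimensional ℝ V] [TopologicalSpace P]
  [ChartedSpace E P] [T2Space P]
  {Ω : SymplecticForm E P} {g : P → V} {H : P → ℝ} {Φ : ℝ → P → P} {D : Set (ℝ × P)} {N : Set P}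

/-- The covering sets are compact subsets of N inside flow boxes. The box property of W comes from
overlapping sections; the compact set containing all sections near m supplies the uniformity in h.
-/
theorem exists_isFine [IsManifold 𝓘(ℝ, E) ∞ P] [SecondCountableTopology P] (hH : ContMDiff 𝓘(ℝ, E) 𝓘(ℝ, ℝ) ∞ H)
    (hg : ContMDiff 𝓘(ℝ, E) 𝓘(ℝ, V) ∞ g) (hreg : IsRegularConstraint E g)
    (hnondeg : IsNondegenerate Ω g H) (hcois : IsCoisotropic Ω g)
    (hN : IsOpen N) (hHN : hiddenSet Ω g H ⊆ N) :
    ∃ W : Set (P × P), IsFine Ω g H N W ∧ ∀ m ∈ hiddenSet Ω g H,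
      ∃ (A : Set P) (n : ℕ) (θ : OpenPartialHomeomorph P (EuclideanSpace ℝ (Fin n) × V × V)),
        IsCompact A ∧ IsFlowBox Ω g H θ ∧ A ⊆ θ.source ∧
          ∀ᶠ y in 𝓝 m, ∀ w, (y, w) ∈ W → w ∈ A := by
  have hlc : LocallyCompactSpace P := ChartedSpace.locallyCompactSpace E P
  have hmet : TopologicalSpace.MetrizableSpace P := Manifold.metrizableSpace 𝓘(ℝ, E) P
  obtain ⟨W, hW1, hW2, hW3, hW4⟩ := exists_isOpen_fine (K := hiddenSet Ω g H)
    (𝒜 := {A | IsCompact A ∧ A ⊆ N ∧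
      ∃ (n : ℕ) (θ : OpenPartialHomeomorph P (EuclideanSpace ℝ (Fin n) × V × V)),
        IsFlowBox Ω g H θ ∧ A ⊆ θ.source}) fun m hm => by
      obtain ⟨n, θ, hmθ, hθ⟩ := exists_isFlowBox hH hg hreg hnondeg hcois hm
      obtain ⟨A, hAm, hAs, hA⟩ := local_compact_nhds
        (inter_mem (θ.open_source.mem_nhds hmθ) (hN.mem_nhds (hHN hm)))
      exact ⟨A, ⟨hA, fun y hy => (hAs hy).2, n, θ, hθ, fun y hy => (hAs hy).1⟩, hAm⟩
  refine ⟨W, ⟨hW1, hW2, fun x y z hx hy => ?_⟩, fun m hm => ?_⟩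
  · obtain ⟨A, ⟨-, hAN, n, θ, hθ, hAθ⟩, h⟩ := hW3 x y z hx hy
    exact ⟨n, θ, hθ, fun w hw => ⟨hAθ (h w hw), hAN (h w hw)⟩⟩
  · obtain ⟨A, ⟨hA, -, n, θ, hθ, hAθ⟩, h⟩ := hW4 m hm
    exact ⟨A, n, θ, hA, hθ, hAθ, h⟩

/-- For small steps, the Shake equation is uniquely solvable on the fibres inside the fibred
neighbourhood, and its solution stays in that neighbourhood. -/
theorem exists_forall_existsUnique (hΦ : IsConsistentMethod Ω H Φ D)
    (hg : ContMDiff 𝓘(ℝ, E) 𝓘(ℝ, V) ∞ g) (hcois : IsCoisotropic Ω g) {W : Set (P × P)}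
    (hW : IsFine Ω g H N W) (hN : IsOpen N)
    (hbox : ∀ m ∈ hiddenSet Ω g H,
      ∃ (A : Set P) (n : ℕ) (θ : OpenPartialHomeomorph P (EuclideanSpace ℝ (Fin n) × V × V)),
        IsCompact A ∧ IsFlowBox Ω g H θ ∧ A ⊆ θ.source ∧
          ∀ᶠ y in 𝓝 m, ∀ w, (y, w) ∈ W → w ∈ A) {z₀ : P}
    (hz₀ : z₀ ∈ constraintSet g ∩ fibredNhd Ω g H N W) :
    ∃ h₀ > (0 : ℝ), ∃ U : Set P, IsOpen U ∧ z₀ ∈ U ∧ U ⊆ fibredNhd Ω g H N W ∧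
      ∀ h : ℝ, h ≠ 0 → |h| < h₀ → ∀ z ∈ constraintSet g ∩ U,
        (∀ y ∈ fibreIn Ω g (fibredNhd Ω g H N W) z, (h, y) ∈ D) ∧
        (∃! y, y ∈ fibreIn Ω g (fibredNhd Ω g H N W) z ∧ g (Φ h y) = 0) ∧
        ∀ y ∈ fibreIn Ω g (fibredNhd Ω g H N W) z, g (Φ h y) = 0 →
          Φ h y ∈ fibredNhd Ω g H N W := by
  have hO := hW.isOpen_fibredNhd hcois hN hg.continuous
  obtain ⟨m₀, hm₀, hz₀m⟩ := hz₀.2.2 hz₀.1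
  obtain ⟨A, n, θ, hA, hθ, hAθ, hWA⟩ := hbox m₀ hm₀
  have hWm₀ : ∀ w, (m₀, w) ∈ W → w ∈ θ.source := fun w hw => hAθ (hWA.self_of_nhds w hw)
  have : CompleteSpace V := FiniteDimensional.complete ℝ V
  have hev := eventually_existsUnique_localFibre hΦ hg hcois hW hO hm₀
    (hW.hiddenSet_subset_fibredNhd hm₀) hA hθ hAθ hWA
  have hm₀θ : m₀ ∈ θ.source := hWm₀ _ (hW.diag _ hm₀)
  have hz₀θ : z₀ ∈ θ.source := hWm₀ _ (fibreIn_subset _ hz₀m).2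
  have hθz₀ : θ m₀ = ((θ z₀).1, 0, 0) := by
    rw [hθ.fst_eq_of_mem_fibreIn hWm₀ hz₀m]
    exact hθ.apply_eq_of_mem_hiddenSet hcois hm₀ hm₀θ
  -- The base point (a(z), 0, 0) of the fibre of z tends to m₀ as z tends to z₀, so the statement
  -- near (0, m₀) pulls back to one near (0, z₀).
  have htend : Tendsto (fun p : ℝ × P => (p.1, θ.symm ((θ p.2).1, (0 : V), (0 : V))))
      (𝓝 (0, z₀)) (𝓝 (0, m₀)) := by
    have h1 : ContinuousAt (fun p : ℝ × P => θ p.2) (0, z₀) :=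
      ContinuousAt.comp (g := θ) (x := ((0 : ℝ), z₀)) (θ.continuousAt hz₀θ)
        continuous_snd.continuousAt
    have h2 : ContinuousAt (fun p : ℝ × P => ((θ p.2).1, (0 : V), (0 : V))) (0, z₀) :=
      h1.fst.prodMk continuousAt_const
    have h3 : ((θ z₀).1, (0 : V), (0 : V)) ∈ θ.target := hθz₀ ▸ θ.map_source hm₀θ
    have h4 : ContinuousAt (fun p : ℝ × P => (p.1, θ.symm ((θ p.2).1, (0 : V), (0 : V))))
        (0, z₀) := continuous_fst.continuousAt.prodMk
      (ContinuousAt.comp (g := θ.symm) (x := ((0 : ℝ), z₀))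
        (f := fun p : ℝ × P => ((θ p.2).1, (0 : V), (0 : V))) (θ.continuousAt_symm h3) h2)
    have h5 := h4.tendsto
    simp only [← hθz₀, θ.left_inv hm₀θ] at h5
    exact h5
  have hall := (htend.eventually hev).and (continuous_snd.continuousAt.eventually
    ((eventually_mem_localFibre hW.isOpen hθ hcois hm₀ hWm₀ hz₀m).and (hO.mem_nhds hz₀.2)))
  -- Splitting the product neighbourhood yields one bound h₀ valid for all z in U.
  rw [nhds_prod_eq] at hall
  obtain ⟨ph, hph, pz, hpz, hpq⟩ := eventually_prod_iff.1 hall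
  obtain ⟨h₀, hh₀, hball⟩ := Metric.eventually_nhds_iff.1 hph
  obtain ⟨U, hUp, hU, hz₀U⟩ := eventually_nhds_iff.1 hpz
  refine ⟨h₀, hh₀, U, hU, hz₀U, fun z hz => (hpq hph.self_of_nhds (hUp z hz)).2.2,
    fun h hh hlt z hz => ?_⟩
  obtain ⟨h1, h2, -⟩ := hpq (hball (by simpa using hlt : dist h 0 < h₀)) (hUp z hz.2)
  obtain ⟨h3, h4⟩ := h2 hz.1
  have h5 := hθ.symm_mem_hiddenSet hcois h3
  rw [hW.fibreIn_fibredNhd hcois h5 h4]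
  exact h1 hh h5

end Global

end ConstrainedHamiltonian

end

theorem mainTheorem2 {E V P : Type*}
    [NormedAddCommGroup E] [NormedSpace ℝ E] [FiniteDimensional ℝ E]
    [NormedAddCommGroup V] [NormedSpace ℝ V] [FiniteDimensional ℝ V]
    [TopologicalSpace P] [T2Space P] [SecondCountableTopology P]
    [ChartedSpace E P] [IsManifold 𝓘(ℝ, E) ∞ P]
    (Ω : SymplecticForm E P)
    (H : P → ℝ) (hH : ContMDiff 𝓘(ℝ, E) 𝓘(ℝ, ℝ) ∞ H)
    (g : P → V) (hg : ContMDiff 𝓘(ℝ, E) 𝓘(ℝ, V) ∞ g) (hreg : IsRegularConstraint E g)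
    (hnondeg : IsNondegenerate Ω g H) (hcois : IsCoisotropic Ω g)
    (Φ : ℝ → P → P) (D : Set (ℝ × P)) (hΦ : IsConsistentMethod Ω H Φ D)
    (N : Set P) (hN : IsOpen N) (hHN : hiddenSet Ω g H ⊆ N) :
    ∃ O : Set P, IsOpen O ∧ hiddenSet Ω g H ⊆ O ∧ O ⊆ N ∧
      ∀ z₀ ∈ constraintSet g ∩ O, ∃ h₀ > (0 : ℝ), ∃ U : Set P, IsOpen U ∧ z₀ ∈ U ∧ U ⊆ O ∧
        ∀ h : ℝ, h ≠ 0 → |h| < h₀ → ∀ z ∈ constraintSet g ∩ U,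
          (∀ y ∈ fibreIn Ω g O z, (h, y) ∈ D) ∧
          (∃! y : P, y ∈ fibreIn Ω g O z ∧ g (Φ h y) = 0) ∧
          (∃! w : P, IsShakeStep Ω g Φ O h z w) ∧
          (∀ w : P, IsShakeStep Ω g Φ O h z w → w ∈ constraintSet g ∩ O) ∧
          (∃! z₁ : P, IsRattleStep Ω g H Φ O h z z₁) := by
  obtain ⟨W, hW, hbox⟩ := exists_isFine hH hg hreg hnondeg hcois hN hHN
  refine ⟨fibredNhd Ω g H N W, hW.isOpen_fibredNhd hcois hN hg.continuous,
    hW.hiddenSet_subset_fibredNhd, fun z hz => hz.1, fun z₀ hz₀ => ?_⟩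
  obtain ⟨h₀, hh₀, U, hU, hz₀U, hUO, hall⟩ :=
    exists_forall_existsUnique hΦ hg hcois hW hN hbox hz₀
  refine ⟨h₀, hh₀, U, hU, hz₀U, hUO, fun h hh hlt z hz => ?_⟩
  obtain ⟨h1, h2, h3⟩ := hall h hh hlt z hz
  obtain ⟨y, ⟨hy, hgy⟩, hyu⟩ := h2
  have hshake : ∀ w, IsShakeStep Ω g Φ (fibredNhd Ω g H N W) h z w ↔ w = Φ h y := by
    intro w
    constructor
    · rintro ⟨y', hy', hgy', rfl⟩
      rw [hyu y' ⟨hy', hgy'⟩]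
    · rintro rfl
      exact ⟨y, hy, hgy, rfl⟩
  have hwO : Φ h y ∈ fibredNhd Ω g H N W := h3 y hy hgy
  -- The Shake point lies in M ∩ O, hence on the local fibre of some hidden point m; this m is the
  -- Rattle point.
  obtain ⟨m, hm, hwm⟩ := hwO.2 hgy
  have hfib := hW.fibreIn_fibredNhd hcois hm hwm
  refine ⟨h1, ⟨y, ⟨hy, hgy⟩, hyu⟩, ⟨_, (hshake _).2 rfl, fun w hw => (hshake w).1 hw⟩, fun w hw => ?_,
    ⟨m, ⟨_, (hshake _).2 rfl, hfib ▸ hW.self_mem_localFibre hm, hm⟩, ?_⟩⟩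
  · rw [(hshake w).1 hw]
    exact ⟨hgy, hwO⟩
  · rintro z₁ ⟨w, hw, hz₁, hz₁H⟩
    rw [(hshake w).1 hw, hfib] at hz₁
    exact hW.eq_of_mem_hiddenSet hcois hm hz₁ hz₁H
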